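/- Write $\mathbb{R}_*=(0,\infty)$, let $\mathcal M_+(\mathbb{R}_*)$ be the set of positive Radon measures on $\mathbb{R}_*$ and $\mathcal M_{+,b}(\mathbb{R}_*)$ the subset of those with finite total mass. Let $\gamma,\lambda\in\mathbb{R}$ satisfy $|\gamma+2\lambda|<1$ and $\gamma<1$, and let $K:\mathbb{R}_*^2\to[0,\infty)$ be a continuous function for which there are constants $0<c_1\le c_2<\infty$ with $$c_1\left(x^{\gamma+\lambda}y^{-\lambda}+x^{-\lambda}y^{\gamma+\lambda}\right)\le K(x,y)\le c_2\left(x^{\gamma+\lambda}y^{-\lambda}+x^{-\lambda}y^{\gamma+\lambda}\right)\qquad\text{for all }x,y\in\mathbb{R}_*.$$ For a measure $\mu\in\mathcal M_+(\mathbb{R}_*)$ and $z>0$ put $$J_\mu(z)=\iint_{\Omega_z}xK(x,y)\,\mu(\mathrm dx)\,\mu(\mathrm dy),\qquad \Omega_z=\{(x,y)\in\mathbb{R}_*^2: 0<x\le z,\ z-x<y\}.$$ Let $T>0$ and let $f_0\in\mathcal M_+(\mathbb{R}_*)$ be such that $xf_0\in\mathcal M_{+,b}(\mathbb{R}_*)$.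 Then there exists a weak flux solution on $[0,T]$ with initial data $f_0$ of the coagulation equation with kernel $K$, that is, a family $(f_t)_{t\in[0,T]}$ in $\mathcal M_+(\mathbb{R}_*)$ which equals $f_0$ at $t=0$ and has the following properties. 1. The map $t\mapsto f_t$ is continuous from $[0,T]$ to $\mathcal M_+(\mathbb{R}_*)$ with the weak-* topology (tested against $C_c(\mathbb{R}_*)$). Moreover $xf_t\in\mathcal M_{+,b}(\mathbb{R}_*)$ for every $t\in[0,T]$, and $t\mapsto xf_t$ is continuous from $[0,T]$ to $\mathcal M_{+,b}(\mathbb{R}_*)$ with the weak-* topology (tested against the space $C_0(\mathbb{R}_*)$ of continuous functions that vanish at $0$ and at $\infty$). 2. For almost every $z\in\mathbb{R}_*$, the time-integrated flux $\int_0^tJ_{f_s}(z)\,\mathrm ds$ is finite for all $t\in[0,T]$, and for almost every $(t,z)\in[0,T]\times\mathbb{R}_*$, $$\int_{(0,z]}x\,f_t(\mathrm dx)-\int_{(0,z]}x\,f_0(\mathrm dx)=-\int_0^tJ_{f_s}(z)\,\mathrm ds+t.$$ -/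

import Mathlib

open MeasureTheory Set

noncomputable section

namespace FluxCoagulation

/-- The space `ℝ_* = (0, ∞)` of particle sizes, with its usual topology and Borel sigma-algebra.
Positive Radon measures on it are Borel measures `μ : Measure PosR` with `μ.Regular`
(in particular finite on compact subsets of `(0, ∞)`, but possibly of infinite mass near `0`). -/
abbrev PosR : Type := Set.Ioi (0 : ℝ)

/-- Kernel regularity: `K` is a continuous, nonnegative function on `(0, ∞)²` which is bounded from
above and from below by multiples of `x^(γ+λ) y^(-λ) + x^(-λ) y^(γ+λ)`
(the exponent `λ` is written `lam`). -/
structure KernelRegularity (K : PosR → PosR → ℝ) (γ lam : ℝ) : Prop where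
  continuous : Continuous (fun p : PosR × PosR => K p.1 p.2)
  nonneg : ∀ x y : PosR, 0 ≤ K x y
  bounds : ∃ c₁ c₂ : ℝ, 0 < c₁ ∧ c₁ ≤ c₂ ∧ ∀ x y : PosR,
    c₁ * ((x : ℝ) ^ (γ + lam) * (y : ℝ) ^ (-lam) + (x : ℝ) ^ (-lam) * (y : ℝ) ^ (γ + lam)) ≤ K x y ∧
    K x y ≤
      c₂ * ((x : ℝ) ^ (γ + lam) * (y : ℝ) ^ (-lam) + (x : ℝ) ^ (-lam) * (y : ℝ) ^ (γ + lam))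

/-- The first moment measure `x μ(dx)`. -/
def firstMoment (μ : Measure PosR) : Measure PosR :=
  μ.withDensity (fun x => ENNReal.ofReal (x : ℝ))

/-- The region `Ω_z = {(x, y) ∈ (0, ∞)² : 0 < x ≤ z, z - x < y}`. -/
def fluxRegion (z : ℝ) : Set (PosR × PosR) :=
  {p | (p.1 : ℝ) ≤ z ∧ z - (p.1 : ℝ) < (p.2 : ℝ)}

/-- The mass flux `J_μ(z) = ∬_{Ω_z} x K(x,y) μ(dx) μ(dy)`, with values in `[0, ∞]`. -/
def flux (K : PosR → PosR → ℝ) (μ : Measure PosR) (z : ℝ) : ENNReal :=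
  ∫⁻ p in fluxRegion z, ENNReal.ofReal ((p.1 : ℝ) * K p.1 p.2) ∂(μ.prod μ)

/-- The time-integrated flux `∫_0^t J_{f_s}(z) ds`, with values in `[0, ∞]`. -/
def integratedFlux (K : PosR → PosR → ℝ) (f : ℝ → Measure PosR) (t z : ℝ) : ENNReal :=
  ∫⁻ s in Set.Ioc 0 t, flux K (f s) z

/-- The mass `∫_{(0,z]} x μ(dx)` carried by particles of size at most `z`. -/
def massUpTo (μ : Measure PosR) (z : ℝ) : ℝ :=
  ∫ x in {x : PosR | (x : ℝ) ≤ z}, (x : ℝ) ∂μ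

/-- Weak flux solutions on `[0, T]` of the coagulation equation with kernel `K` and initial data
`f₀`. Only the values `f t` with `t ∈ [0, T]` matter. -/
structure IsWeakFluxSolution (K : PosR → PosR → ℝ) (T : ℝ) (f₀ : Measure PosR)
    (f : ℝ → Measure PosR) : Prop where
  /-- Every `f t` is a positive Radon measure on `(0, ∞)`. -/
  radon : ∀ t ∈ Set.Icc 0 T, (f t).Regular
  /-- `f` is continuous in time for the weak-* topology of Radon measures, the dual of `C_c`. -/
  weakStar_continuous : ∀ φ : CompactlySupportedContinuousMap PosR ℝ,
    ContinuousOn (fun t => ∫ x, φ x ∂(f t)) (Set.Icc 0 T)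
  /-- The initial data are attained. -/
  initial : f 0 = f₀
  /-- Every `x f t` is a bounded measure. -/
  firstMoment_finite : ∀ t ∈ Set.Icc 0 T, IsFiniteMeasure (firstMoment (f t))
  /-- `x f` is continuous in time for the weak-* topology of bounded measures, the dual of `C_0`. -/
  firstMoment_weakStar_continuous : ∀ φ : ZeroAtInftyContinuousMap PosR ℝ,
    ContinuousOn (fun t => ∫ x, φ x ∂(firstMoment (f t))) (Set.Icc 0 T)
  /-- For almost every `z > 0` the time-integrated flux is finite for all `t ∈ [0, T]`. -/
  flux_finite : ∀ᵐ z ∂(volume.restrict (Set.Ioi (0 : ℝ))), ∀ t ∈ Set.Icc 0 T,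
    integratedFlux K f t z < ⊤
  /-- The flux equation holds for almost every `(t, z) ∈ [0, T] × (0, ∞)`. -/
  flux_eq : ∀ᵐ p ∂((volume : Measure (ℝ × ℝ)).restrict (Set.Icc 0 T ×ˢ Set.Ioi 0)),
    massUpTo (f p.1) p.2 - massUpTo f₀ p.2 = -(integratedFlux K f p.1 p.2).toReal + p.1

end FluxCoagulation

end

noncomputable section

namespace FluxCoagulation

open scoped ENNReal NNReal Topology
open Filter Function

/-! ### Explicit Euler scheme for the mass form of the equation. -/

section EulerScheme

variable {X : Type*} [MeasurableSpace X]

/-! The unknown is replaced by the mass measure `g = x f`. A unit of mass at `x` then jumps to `x +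
y` at rate `(K(x,y) / y) g(dy)`, and the flux `J(z)` is the rate at which mass jumps across `z`. The
source at size zero is approximated by injection at a small size `ε` at unit rate; the initial mass
below `ε` is removed and the rate is cut at `ε^(γ-1)`. The resulting bounded dynamics is solved up
to a small error by an explicit Euler scheme (`exists_approxSol`), which keeps measures positive and
makes the total mass grow at rate at most one.

The a priori estimate comes from dissipation. The mass below `z` is bounded, so the time-integrated
flux through `z` is bounded by a constant `M`. Two particles in `(z/2, z]` always produce one beyond
`z`, at a rate at least of order `z^(γ-1)`; the truncation leaves this bound intact because no mass
lies below `ε`. Hence the time integral of `g((z/2, z])^2` is of order `z^(1-γ)`, that of `g((z/2,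
z])` is of order `z^((1-γ)/2)` (`dyadic_bound`), and a dyadic sum controls the time integral of `x^p
g` on sizes at most `δ` by `δ^(p + (1-γ)/2)` as soon as `p > -(1-γ)/2` (`lintegral_smallWeight_le`).
All of this is uniform in `ε`.

The condition `|γ + 2λ| < 1` says exactly that `p = γ + λ` and `p = -λ` are both admissible;
together with `γ < 1` it also makes both exponents smaller than `1`. So the flux averaged over `z ∈
(α, β)` receives a uniformly small contribution from outside compact subsets of `(0,∞)²`
(`flux_tail`): small sizes are handled by the estimate, large `y` by the factor `1/y`. Averaging in
`z` also turns the indicator of a crossing into the continuous function `crossed`.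

Flux bounds give equicontinuity in time against `C_c` functions, and a limit along an ultrafilter
exists (`exists_isLimit`). At a fixed positive time no mass concentrates at size zero
(`small_mass`), so the averaged balance law passes to the limit (`balance`). Since `(α, β)` is
arbitrary, the law holds for almost every `z` (`mass_add_flux_ae`); dividing by `x` returns to the
number density. -/

/-- The double integral `∬ F(x, y) μ(dx) μ(dy)`. -/
def pairInt (μ : Measure X) (F : X → X → ℝ≥0∞) : ℝ≥0∞ := ∫⁻ x, ∫⁻ y, F x y ∂μ ∂μ

lemma pairInt_mono (μ : Measure X) {F G : X → X → ℝ≥0∞} (h : ∀ x y, F x y ≤ G x y) :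
    pairInt μ F ≤ pairInt μ G :=
  lintegral_mono fun x => lintegral_mono fun y => h x y

lemma pairInt_add (μ : Measure X) [SFinite μ] {F G : X → X → ℝ≥0∞} (hF : Measurable (uncurry F)) :
    pairInt μ (fun x y => F x y + G x y) = pairInt μ F + pairInt μ G := by
  have hF' : Measurable fun x => ∫⁻ y, F x y ∂μ := hF.lintegral_prod_right'
  unfold pairInt
  rw [← lintegral_add_left hF']
  exact lintegral_congr fun x => lintegral_add_left hF.of_uncurry_left _

lemma pairInt_const_mul (μ : Measure X) [SFinite μ] {F : X → X → ℝ≥0∞} (c : ℝ≥0∞)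
    (hF : Measurable (uncurry F)) :
    pairInt μ (fun x y => c * F x y) = c * pairInt μ F := by
  have hF' : Measurable fun x => ∫⁻ y, F x y ∂μ := hF.lintegral_prod_right'
  unfold pairInt
  rw [← lintegral_const_mul c hF']
  exact lintegral_congr fun x => lintegral_const_mul c hF.of_uncurry_left

lemma pairInt_const (μ : Measure X) (c : ℝ≥0∞) :
    pairInt μ (fun _ _ => c) = c * μ univ * μ univ := by
  simp [pairInt]

lemma pairInt_left (μ : Measure X) [SFinite μ] {f : X → ℝ≥0∞} (hf : Measurable f) :
    pairInt μ (fun x _ => f x) = μ univ * ∫⁻ x, f x ∂μ := by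
  simp only [pairInt, lintegral_const]
  rw [lintegral_mul_const _ hf, mul_comm]

lemma pairInt_right (μ : Measure X) (f : X → ℝ≥0∞) :
    pairInt μ (fun _ y => f y) = μ univ * ∫⁻ x, f x ∂μ := by
  simp only [pairInt, lintegral_const, mul_comm]

lemma pairInt_le_const {μ : Measure X} {F : X → X → ℝ≥0∞} {c M : ℝ≥0∞} (h : ∀ x y, F x y ≤ c)
    (hM : μ univ ≤ M) : pairInt μ F ≤ c * M * M := by
  refine (pairInt_mono μ h).trans ?_
  rw [pairInt_const]
  gcongr

lemma measurable_pairInt {ι : Type*} [MeasurableSpace ι] {G : ι → Measure X} (hG : Measurable G)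
    {M : ℝ≥0∞} (hM : M ≠ ∞) (hGM : ∀ t, G t univ ≤ M) {F : ι → X → X → ℝ≥0∞}
    (hF : Measurable fun p : ι × X × X => F p.1 p.2.1 p.2.2) :
    Measurable fun t => pairInt (G t) (F t) := by
  let κ : ProbabilityTheory.Kernel ι X := ⟨G, hG⟩
  have hκ : ProbabilityTheory.IsFiniteKernel κ := ⟨M, hM.lt_top, hGM⟩
  let κ' : ProbabilityTheory.Kernel (ι × X) X := κ.comap Prod.fst measurable_fst
  have h1 : Measurable fun p : ι × X => ∫⁻ y, F p.1 p.2 y ∂(κ' p) := by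
    refine Measurable.lintegral_kernel_prod_right' (κ := κ')
      (f := fun q : (ι × X) × X => F q.1.1 q.1.2 q.2) ?_
    exact hF.comp (by fun_prop : Measurable fun q : (ι × X) × X => (q.1.1, q.1.2, q.2))
  exact Measurable.lintegral_kernel_prod_right' (κ := κ) h1

lemma measurable_lintegral_family {ι : Type*} [MeasurableSpace ι] {G : ι → Measure X}
    (hG : Measurable G) {M : ℝ≥0∞} (hM : M ≠ ∞) (hGM : ∀ t, G t univ ≤ M) {F : ι → X → ℝ≥0∞}
    (hF : Measurable (uncurry F)) :
    Measurable fun t => ∫⁻ x, F t x ∂(G t) := by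
  let κ : ProbabilityTheory.Kernel ι X := ⟨G, hG⟩
  have hκ : ProbabilityTheory.IsFiniteKernel κ := ⟨M, hM.lt_top, hGM⟩
  exact Measurable.lintegral_kernel_prod_right' (κ := κ) hF

/-- One explicit Euler step of length `h` of the coagulation dynamics in mass form: a unit of mass
at `x` jumps to `op x y` at rate `κ x y g(dy)`, and mass is injected at `e` at rate `1`. -/
def coagStep (op : X → X → X) (κ : X → X → ℝ≥0∞) (h : ℝ≥0∞) (e : X) (g : Measure X) : Measure X :=
  g.withDensity (fun x => 1 - h * ∫⁻ y, κ x y ∂g) +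
    h • ((g.prod g).withDensity (uncurry κ)).map (uncurry op) + h • Measure.dirac e

/-- The iterated Euler scheme. -/
def coagSeq (op : X → X → X) (κ : X → X → ℝ≥0∞) (h : ℝ≥0∞) (e : X) (g : Measure X) :
    ℕ → Measure X
  | 0 => g
  | n + 1 => coagStep op κ h e (coagSeq op κ h e g n)

variable {op : X → X → X} {κ : X → X → ℝ≥0∞}

/-- The weak form of one step. The loss term stands on the left because integrals take values in
`[0, ∞]`; `hle` makes the truncated subtraction in `coagStep` an honest one. -/
lemma lintegral_coagStep (hop : Measurable (uncurry op)) (hκ : Measurable (uncurry κ)) {h : ℝ≥0∞}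
    (e : X) {g : Measure X} [SFinite g] (hle : ∀ x, h * ∫⁻ y, κ x y ∂g ≤ 1) {ψ : X → ℝ≥0∞}
    (hψ : Measurable ψ) :
    ∫⁻ x, ψ x ∂(coagStep op κ h e g) + h * pairInt g (fun x y => κ x y * ψ x) =
      ∫⁻ x, ψ x ∂g + h * pairInt g (fun x y => κ x y * ψ (op x y)) + h * ψ e := by
  have ha : Measurable fun x => ∫⁻ y, κ x y ∂g := hκ.lintegral_prod_right'
  have hd : Measurable fun x => 1 - h * ∫⁻ y, κ x y ∂g := (ha.const_mul h).const_sub 1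
  have h1 : ∫⁻ x, ψ x ∂(g.withDensity fun x => 1 - h * ∫⁻ y, κ x y ∂g)
      + h * pairInt g (fun x y => κ x y * ψ x) = ∫⁻ x, ψ x ∂g := by
    rw [lintegral_withDensity_eq_lintegral_mul _ hd hψ]
    have : h * pairInt g (fun x y => κ x y * ψ x)
        = ∫⁻ x, (h * ∫⁻ y, κ x y ∂g) * ψ x ∂g := by
      unfold pairInt
      rw [← lintegral_const_mul]
      · refine lintegral_congr fun x => ?_
        rw [lintegral_mul_const _ hκ.of_uncurry_left, mul_assoc]
      · exact (hκ.mul (hψ.comp measurable_fst)).lintegral_prod_right'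
    rw [this, ← lintegral_add_left (hd.mul hψ)]
    refine lintegral_congr fun x => ?_
    simp only [Pi.mul_apply]
    rw [← add_mul, tsub_add_cancel_of_le (hle x), one_mul]
  have h2 : ∫⁻ x, ψ x ∂(((g.prod g).withDensity (uncurry κ)).map (uncurry op))
      = pairInt g (fun x y => κ x y * ψ (op x y)) := by
    have hc : Measurable fun p : X × X => ψ (uncurry op p) := hψ.comp hop
    rw [lintegral_map hψ hop, lintegral_withDensity_eq_lintegral_mul _ hκ hc,
      lintegral_prod _ (hκ.mul hc).aemeasurable]
    rfl
  unfold coagStep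
  rw [lintegral_add_measure, lintegral_add_measure, lintegral_smul_measure, lintegral_smul_measure,
    h2, lintegral_dirac' _ hψ, ← h1]
  simp only [smul_eq_mul]
  ring

variable {h M L : ℝ≥0∞} {e : X} {g : Measure X} {N : ℕ}

/-- The step size is small enough for `N` Euler steps. -/
structure EulerData (op : X → X → X) (κ : X → X → ℝ≥0∞) (h : ℝ≥0∞) (g : Measure X)
    (N : ℕ) (M L : ℝ≥0∞) : Prop where
  op : Measurable (uncurry op)
  ker : Measurable (uncurry κ)
  ker_le : ∀ x y, κ x y ≤ L
  L_ne : L ≠ ∞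
  M_ne : M ≠ ∞
  mass : g univ + N * h ≤ M
  small : h * (L * M) ≤ 1

namespace EulerData

variable (E : EulerData op κ h g N M L)

include E in
lemma small' {μ : Measure X} (hμ : μ univ ≤ M) (x : X) : h * ∫⁻ y, κ x y ∂μ ≤ 1 := by
  refine le_trans ?_ E.small
  gcongr
  calc ∫⁻ y, κ x y ∂μ ≤ ∫⁻ _, L ∂μ := lintegral_mono fun y => E.ker_le x y
    _ = L * μ univ := by simp
    _ ≤ L * M := by gcongr

include E in
lemma pairInt_le {μ : Measure X} (hμ : μ univ ≤ M) {D : X → X → ℝ≥0∞} {C : ℝ≥0∞}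
    (hD : ∀ x y, D x y ≤ C) : pairInt μ (fun x y => κ x y * D x y) ≤ C * (L * M * M) := by
  refine (pairInt_le_const (c := L * C) (fun x y => ?_) hμ).trans_eq (by ring)
  gcongr
  exacts [E.ker_le x y, hD x y]

include E in
lemma pairInt_ne {μ : Measure X} (hμ : μ univ ≤ M) {D : X → X → ℝ≥0∞} {C : ℝ≥0∞} (hC : C ≠ ∞)
    (hD : ∀ x y, D x y ≤ C) : pairInt μ (fun x y => κ x y * D x y) ≠ ∞ :=
  ((E.pairInt_le hμ hD).trans_lt (ENNReal.mul_lt_top hC.lt_top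
    (ENNReal.mul_lt_top (ENNReal.mul_lt_top E.L_ne.lt_top E.M_ne.lt_top) E.M_ne.lt_top))).ne

include E in
lemma mass_step {μ : Measure X} (hh : h ≠ ∞) (hμ : μ univ ≤ M) :
    coagStep op κ h e μ univ = μ univ + h := by
  have : IsFiniteMeasure μ := ⟨hμ.trans_lt E.M_ne.lt_top⟩
  have h1 := lintegral_coagStep E.op E.ker e (E.small' hμ) (ψ := fun _ => 1) measurable_const
  simp only [lintegral_const, one_mul, mul_one] at h1
  have hA := E.pairInt_ne hμ ENNReal.one_ne_top (D := fun _ _ => 1) (fun _ _ => le_rfl)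
  simp only [mul_one] at hA
  have hA' := ENNReal.mul_ne_top hh hA
  rw [add_right_comm] at h1
  exact (ENNReal.add_left_inj hA').1 h1

include E in
lemma mass_seq (hh : h ≠ ∞) {k : ℕ} (hk : k ≤ N) :
    coagSeq op κ h e g k univ = g univ + k * h ∧ coagSeq op κ h e g k univ ≤ M := by
  have hle : ∀ j ≤ N, g univ + j * h ≤ M := fun j hj => le_trans (by gcongr) E.mass
  induction k with
  | zero => exact ⟨by simp [coagSeq], by simpa [coagSeq] using hle 0 (Nat.zero_le _)⟩
  | succ k ih =>
    obtain ⟨h1, h2⟩ := ih (by omega)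
    have h3 : coagSeq op κ h e g (k + 1) univ = g univ + (k + 1 : ℕ) * h := by
      rw [coagSeq, E.mass_step hh h2, h1]
      push_cast
      ring
    exact ⟨h3, h3 ▸ hle _ hk⟩

variable {μ : Measure X} {φ : X → ℝ≥0∞} {D : X → X → ℝ≥0∞} {C : ℝ≥0∞}

include E in
-- `D` dominates the gain of `φ` in a jump. The loss term is finite because `φ`, the kernel and the
-- mass are bounded, so it can be cancelled from the weak form.
lemma step_le (hh : h ≠ ∞) (hμ : μ univ ≤ M) (hφ : Measurable φ) (hC : C ≠ ∞) (hφC : ∀ x, φ x ≤ C)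
    (hD : ∀ x y, φ (op x y) ≤ φ x + D x y) :
    ∫⁻ x, φ x ∂(coagStep op κ h e μ) ≤
      ∫⁻ x, φ x ∂μ + h * pairInt μ (fun x y => κ x y * D x y) + h * φ e := by
  have : IsFiniteMeasure μ := ⟨hμ.trans_lt E.M_ne.lt_top⟩
  have h1 := lintegral_coagStep E.op E.ker e (E.small' hμ) hφ
  have hA := ENNReal.mul_ne_top hh (E.pairInt_ne hμ hC (D := fun x _ => φ x) (fun x _ => hφC x))
  have hB : pairInt μ (fun x y => κ x y * φ (op x y)) ≤
      pairInt μ (fun x y => κ x y * φ x) + pairInt μ (fun x y => κ x y * D x y) := by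
    rw [← pairInt_add _ (E.ker.mul (hφ.comp measurable_fst))]
    exact pairInt_mono _ fun x y => by rw [← mul_add]; gcongr; exact hD x y
  refine (ENNReal.add_le_add_iff_right hA).1 (h1.le.trans ?_)
  calc _ ≤ ∫⁻ x, φ x ∂μ + h * (pairInt μ (fun x y => κ x y * φ x) +
        pairInt μ (fun x y => κ x y * D x y)) + h * φ e := by gcongr
    _ = _ := by ring

include E in
lemma step_ge (hh : h ≠ ∞) (hμ : μ univ ≤ M) (hφ : Measurable φ) (hC : C ≠ ∞) (hφC : ∀ x, φ x ≤ C)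
    (hD : ∀ x y, φ x ≤ φ (op x y) + D x y) :
    ∫⁻ x, φ x ∂μ ≤
      ∫⁻ x, φ x ∂(coagStep op κ h e μ) + h * pairInt μ (fun x y => κ x y * D x y) := by
  have : IsFiniteMeasure μ := ⟨hμ.trans_lt E.M_ne.lt_top⟩
  have h1 := lintegral_coagStep E.op E.ker e (E.small' hμ) hφ
  have hB := ENNReal.mul_ne_top hh
    (E.pairInt_ne hμ hC (D := fun x y => φ (op x y)) (fun x y => hφC _))
  have hA : pairInt μ (fun x y => κ x y * φ x) ≤
      pairInt μ (fun x y => κ x y * φ (op x y)) + pairInt μ (fun x y => κ x y * D x y) := by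
    rw [← pairInt_add _ (E.ker.mul (hφ.comp E.op))]
    exact pairInt_mono _ fun x y => by rw [← mul_add]; gcongr; exact hD x y
  refine (ENNReal.add_le_add_iff_right hB).1 ((le_self_add.trans h1.ge).trans ?_)
  calc _ ≤ ∫⁻ x, φ x ∂(coagStep op κ h e μ) + h * (pairInt μ (fun x y => κ x y * φ (op x y)) +
        pairInt μ (fun x y => κ x y * D x y)) := by gcongr
    _ = _ := by ring

include E in
lemma step_eq (hh : h ≠ ∞) (hμ : μ univ ≤ M) (hφ : Measurable φ) (hC : C ≠ ∞) (hφC : ∀ x, φ x ≤ C)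
    (hD : ∀ x y, φ x = φ (op x y) + D x y) :
    ∫⁻ x, φ x ∂(coagStep op κ h e μ) + h * pairInt μ (fun x y => κ x y * D x y) =
      ∫⁻ x, φ x ∂μ + h * φ e := by
  have : IsFiniteMeasure μ := ⟨hμ.trans_lt E.M_ne.lt_top⟩
  have h1 := lintegral_coagStep E.op E.ker e (E.small' hμ) hφ
  have hB := ENNReal.mul_ne_top hh
    (E.pairInt_ne hμ hC (D := fun x y => φ (op x y)) (fun x y => hφC _))
  have hA : pairInt μ (fun x y => κ x y * φ x) =
      pairInt μ (fun x y => κ x y * φ (op x y)) + pairInt μ (fun x y => κ x y * D x y) := by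
    rw [← pairInt_add _ (E.ker.mul (hφ.comp E.op))]
    unfold pairInt
    simp_rw [← mul_add, ← hD]
  refine (ENNReal.add_left_inj hB).1 ?_
  rw [hA] at h1
  calc _ = ∫⁻ x, φ x ∂(coagStep op κ h e μ) + h * (pairInt μ (fun x y => κ x y * φ (op x y)) +
        pairInt μ (fun x y => κ x y * D x y)) := by ring
    _ = _ := by rw [h1]; ring

include E in
lemma seq_le (hh : h ≠ ∞) (hφ : Measurable φ) (hC : C ≠ ∞) (hφC : ∀ x, φ x ≤ C)
    (hD : ∀ x y, φ (op x y) ≤ φ x + D x y) {j k : ℕ} (hjk : j ≤ k) (hk : k ≤ N) :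
    ∫⁻ x, φ x ∂(coagSeq op κ h e g k) ≤ ∫⁻ x, φ x ∂(coagSeq op κ h e g j) +
      ∑ i ∈ Finset.Ico j k, h * pairInt (coagSeq op κ h e g i) (fun x y => κ x y * D x y) +
      (k - j : ℕ) * h * φ e := by
  induction k, hjk using Nat.le_induction with
  | base => simp
  | succ k hjk ih =>
    refine (E.step_le hh (E.mass_seq hh (by omega)).2 hφ hC hφC hD).trans ?_
    rw [Finset.sum_Ico_succ_top hjk, Nat.succ_sub hjk, Nat.cast_succ]
    refine (add_le_add_left (add_le_add_left (ih (by omega)) _) _).trans_eq ?_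
    ring

include E in
lemma seq_ge (hh : h ≠ ∞) (hφ : Measurable φ) (hC : C ≠ ∞) (hφC : ∀ x, φ x ≤ C)
    (hD : ∀ x y, φ x ≤ φ (op x y) + D x y) {j k : ℕ} (hjk : j ≤ k) (hk : k ≤ N) :
    ∫⁻ x, φ x ∂(coagSeq op κ h e g j) ≤ ∫⁻ x, φ x ∂(coagSeq op κ h e g k) +
      ∑ i ∈ Finset.Ico j k, h * pairInt (coagSeq op κ h e g i) (fun x y => κ x y * D x y) := by
  induction k, hjk using Nat.le_induction with
  | base => simp
  | succ k hjk ih =>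
    refine (ih (by omega)).trans ?_
    rw [Finset.sum_Ico_succ_top hjk]
    have := E.step_ge (e := e) hh (E.mass_seq (e := e) hh (k := k) (by omega)).2 hφ hC hφC hD
    refine (add_le_add_left this _).trans_eq ?_
    rw [add_assoc, add_comm (_ * _)]
    rfl

include E in
lemma seq_eq (hh : h ≠ ∞) (hφ : Measurable φ) (hC : C ≠ ∞) (hφC : ∀ x, φ x ≤ C)
    (hD : ∀ x y, φ x = φ (op x y) + D x y) {k : ℕ} (hk : k ≤ N) :
    ∫⁻ x, φ x ∂(coagSeq op κ h e g k) +
      ∑ i ∈ Finset.range k, h * pairInt (coagSeq op κ h e g i) (fun x y => κ x y * D x y) =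
      ∫⁻ x, φ x ∂g + k * h * φ e := by
  induction k with
  | zero => simp [coagSeq]
  | succ k ih =>
    rw [Finset.sum_range_succ]
    have := E.step_eq (e := e) hh (E.mass_seq (e := e) hh (k := k) (by omega)).2 hφ hC hφC hD
    rw [add_comm (Finset.sum _ _), ← add_assoc, coagSeq, this, add_right_comm, ih (by omega)]
    push_cast
    ring

include E in
-- Jumps never enter `S` from outside and the injection point lies outside it, so the indicator of
-- `S` is a test function with zero gain.
lemma seq_null (hh : h ≠ ∞) {S : Set X} (hS : MeasurableSet S) (hop : ∀ x y, op x y ∈ S → x ∈ S)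
    (he : e ∉ S) (hg : g S = 0) {k : ℕ} (hk : k ≤ N) : coagSeq op κ h e g k S = 0 := by
  have h1 := E.seq_le (e := e) (D := fun _ _ => 0) hh (φ := S.indicator 1)
    (measurable_one.indicator hS) ENNReal.one_ne_top
    (fun x => indicator_le_self' (fun _ _ => zero_le) x) (fun x y => by
      by_cases hx : op x y ∈ S
      · simp [hx, hop x y hx]
      · simp [hx]) (Nat.zero_le k) hk
  simpa [lintegral_indicator_one hS, coagSeq, hg, he, pairInt] using h1

end EulerData

/-! ### Euler sums as time integrals of step functions. -/

section PiecewiseConstant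

lemma setLIntegral_floor (c : ℕ → ℝ≥0∞) {τ : ℝ} (hτ : 0 < τ) {j k : ℕ} (hjk : j ≤ k) :
    ∫⁻ s in Ioc (j * τ) (k * τ), c ⌊s / τ⌋₊ = ∑ i ∈ Finset.Ico j k, ENNReal.ofReal τ * c i := by
  induction k, hjk using Nat.le_induction with
  | base => simp
  | succ k hjk ih =>
    have hle : (j : ℝ) * τ ≤ k * τ := by gcongr
    have hle' : (k : ℝ) * τ ≤ (k + 1 : ℕ) * τ := by gcongr; omega
    rw [Finset.sum_Ico_succ_top hjk, ← ih, ← Ioc_union_Ioc_eq_Ioc hle hle',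
      lintegral_union measurableSet_Ioc (Ioc_disjoint_Ioc_of_le le_rfl)]
    congr 1
    rw [← setLIntegral_congr (Ico_ae_eq_Ioc (μ := volume))]
    have : ∀ s ∈ Ico (k * τ) ((k + 1 : ℕ) * τ), c ⌊s / τ⌋₊ = c k := by
      intro s hs
      congr 1
      have h0 : 0 ≤ s := le_trans (by positivity) hs.1
      rw [Nat.floor_eq_iff (by positivity), le_div_iff₀ hτ, div_lt_iff₀ hτ]
      exact ⟨hs.1, by simpa using hs.2⟩
    rw [setLIntegral_congr_fun measurableSet_Ico this]
    simp only [lintegral_const, MeasurableSet.univ, Measure.restrict_apply, univ_inter,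
      Real.volume_Ico]
    rw [mul_comm]
    congr 2
    push_cast
    ring

variable {c : ℕ → ℝ≥0∞} {τ : ℝ} {s t : ℝ}

lemma floor_mul_le (hτ : 0 < τ) (ht : 0 ≤ t) : (⌊t / τ⌋₊ : ℝ) * τ ≤ t := by
  rw [← le_div_iff₀ hτ]
  exact Nat.floor_le (by positivity)

lemma lt_floor_succ_mul (hτ : 0 < τ) : t < ((⌊t / τ⌋₊ + 1 : ℕ) : ℝ) * τ := by
  rw [← div_lt_iff₀ hτ]
  exact_mod_cast Nat.lt_floor_add_one _

/-- The cell containing `s` starts at or before `s` and is only partly covered by the integral; the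
extra term pays for it. -/
lemma sum_floor_le (hτ : 0 < τ) (hs : 0 ≤ s) (hst : s ≤ t) :
    ∑ i ∈ Finset.Ico ⌊s / τ⌋₊ ⌊t / τ⌋₊, ENNReal.ofReal τ * c i ≤
      (∫⁻ u in Ioc s t, c ⌊u / τ⌋₊) + ENNReal.ofReal τ * c ⌊s / τ⌋₊ := by
  rcases (Nat.floor_mono (by gcongr : s / τ ≤ t / τ)).eq_or_lt with h | h
  · simp [h]
  · rw [Finset.sum_eq_sum_Ico_succ_bot h, add_comm, ← setLIntegral_floor c hτ (by omega)]
    refine add_le_add_left (lintegral_mono_set (Ioc_subset_Ioc (α := ℝ) ?_ ?_)) _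
    · exact (lt_floor_succ_mul hτ).le
    · exact floor_mul_le hτ (hs.trans hst)

lemma le_sum_floor (hτ : 0 < τ) (t : ℝ) :
    ∫⁻ u in Ioc 0 t, c ⌊u / τ⌋₊ ≤
      ∑ i ∈ Finset.range ⌊t / τ⌋₊, ENNReal.ofReal τ * c i + ENNReal.ofReal τ * c ⌊t / τ⌋₊ := by
  rw [← Finset.sum_range_succ, Finset.range_eq_Ico, ← setLIntegral_floor c hτ (Nat.zero_le _)]
  refine lintegral_mono_set (Ioc_subset_Ioc (by simp) (lt_floor_succ_mul hτ).le)

end PiecewiseConstant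

/-- A family of measures that solves, up to an error `r`, the coagulation equation in mass form with
kernel `κ`, injection of mass at `e` at rate `1`, and initial data `g`. -/
structure ApproxSol (op : X → X → X) (κ : X → X → ℝ≥0∞) (e : X) (g : Measure X) (T : ℝ)
    (r : ℝ≥0∞) (G : ℝ → Measure X) : Prop where
  measurable : Measurable G
  mass : ∀ t, G t univ ≤ g univ + ENNReal.ofReal T
  initial : G 0 = g
  null : ∀ S, MeasurableSet S → (∀ x y, op x y ∈ S → x ∈ S) → e ∉ S → g S = 0 → ∀ t, G t S = 0
  upper : ∀ (φ : X → ℝ≥0∞) (D : X → X → ℝ≥0∞) (C : ℝ≥0∞), C ≠ ∞ → Measurable φ →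
    (∀ x, φ x ≤ C) → (∀ x y, D x y ≤ C) → (∀ x y, φ (op x y) ≤ φ x + D x y) →
    ∀ s t, 0 ≤ s → s ≤ t → t ≤ T → ∫⁻ x, φ x ∂(G t) ≤ ∫⁻ x, φ x ∂(G s) +
      (∫⁻ u in Ioc s t, pairInt (G u) (fun x y => κ x y * D x y)) + C * ENNReal.ofReal (t - s) + C * r
  lower : ∀ (φ : X → ℝ≥0∞) (D : X → X → ℝ≥0∞) (C : ℝ≥0∞), C ≠ ∞ → Measurable φ →
    (∀ x, φ x ≤ C) → (∀ x y, D x y ≤ C) → (∀ x y, φ x ≤ φ (op x y) + D x y) →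
    ∀ s t, 0 ≤ s → s ≤ t → t ≤ T → ∫⁻ x, φ x ∂(G s) ≤ ∫⁻ x, φ x ∂(G t) +
      (∫⁻ u in Ioc s t, pairInt (G u) (fun x y => κ x y * D x y)) + C * r
  balance_le : ∀ (φ : X → ℝ≥0∞) (D : X → X → ℝ≥0∞) (C : ℝ≥0∞), C ≠ ∞ → Measurable φ →
    (∀ x, φ x ≤ C) → (∀ x y, D x y ≤ C) → (∀ x y, φ x = φ (op x y) + D x y) →
    ∀ t, 0 ≤ t → t ≤ T → ∫⁻ x, φ x ∂(G t) +
      (∫⁻ u in Ioc 0 t, pairInt (G u) (fun x y => κ x y * D x y)) ≤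
      ∫⁻ x, φ x ∂g + ENNReal.ofReal t * φ e + C * r
  balance_ge : ∀ (φ : X → ℝ≥0∞) (D : X → X → ℝ≥0∞) (C : ℝ≥0∞), C ≠ ∞ → Measurable φ →
    (∀ x, φ x ≤ C) → (∀ x y, D x y ≤ C) → (∀ x y, φ x = φ (op x y) + D x y) →
    ∀ t, 0 ≤ t → t ≤ T → ∫⁻ x, φ x ∂g + ENNReal.ofReal t * φ e ≤ ∫⁻ x, φ x ∂(G t) +
      (∫⁻ u in Ioc 0 t, pairInt (G u) (fun x y => κ x y * D x y)) + C * r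

theorem exists_approxSol (hop : Measurable (uncurry op)) (hκ : Measurable (uncurry κ))
    {L : ℝ≥0∞} (hL : L ≠ ∞) (hκL : ∀ x y, κ x y ≤ L) (e : X) (g : Measure X) [IsFiniteMeasure g]
    {T : ℝ} (hT : 0 < T) {r : ℝ≥0∞} (hr : r ≠ 0) :
    ∃ G : ℝ → Measure X, ApproxSol op κ e g T r G := by
  set M := g univ + ENNReal.ofReal T with hM_def
  have hM : M ≠ ∞ := by simp [hM_def]
  -- The three summands of `Q` pay for one cell of integrated flux, for nonnegativity of the
  -- remaining mass in a step, and for one cell of injection. The step is chosen with `h * Q ≤ min r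
  -- 1`.
  set Q := L * M * M + L * M + 1 with hQ_def
  have hQ : Q ≠ ∞ := by
    simp [hQ_def, ENNReal.mul_ne_top, hL, hM]
  obtain ⟨ρ, hρ, hρr⟩ : ∃ ρ : ℝ, 0 < ρ ∧ ENNReal.ofReal ρ ≤ min r 1 := by
    refine ⟨(min r 1).toReal, ENNReal.toReal_pos ?_ ?_, ENNReal.ofReal_toReal_le⟩
    · simp [hr]
    · simp
  obtain ⟨N, hN⟩ := exists_nat_gt (T * Q.toReal / ρ)
  have hN0 : (0 : ℝ) < N := lt_of_le_of_lt (by positivity) hN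
  set τ := T / N with hτ_def
  have hτ : 0 < τ := by positivity
  have hNτ : N * τ = T := by rw [hτ_def]; field_simp
  set h := ENNReal.ofReal τ with h_def
  have hh : h ≠ ∞ := ENNReal.ofReal_ne_top
  have hhQ : h * Q ≤ min r 1 := by
    refine le_trans ?_ hρr
    rw [← ENNReal.ofReal_toReal hQ, h_def, ← ENNReal.ofReal_mul hτ.le]
    refine ENNReal.ofReal_le_ofReal ?_
    rw [hτ_def, div_mul_eq_mul_div, div_le_iff₀ hN0]
    rw [div_lt_iff₀ hρ] at hN
    linarith
  have hE : EulerData op κ h g N M L :=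
    { op := hop
      ker := hκ
      ker_le := hκL
      L_ne := hL
      M_ne := hM
      mass := by
        rw [h_def, ← ENNReal.ofReal_natCast, ← ENNReal.ofReal_mul hN0.le, hNτ]
      small := by
        refine le_trans ?_ (hhQ.trans (min_le_right _ _))
        gcongr
        exact le_add_right le_add_self }
  have hhr : h ≤ r := by
    refine le_trans ?_ (hhQ.trans (min_le_left _ _))
    exact le_mul_of_one_le_right zero_le le_add_self
  have hQr : h * (L * M * M) ≤ r := by
    refine le_trans ?_ (hhQ.trans (min_le_left _ _))
    gcongr
    exact le_add_right le_self_add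
  set S := coagSeq op κ h e g with hS
  have hfl : ∀ t, t ≤ T → ⌊t / τ⌋₊ ≤ N := by
    intro t ht
    refine Nat.floor_le_of_le ?_
    rw [div_le_iff₀ hτ, hNτ]
    exact ht
  -- Freezing the scheme after step `N` keeps the mass bound valid for all real times.
  let G : ℝ → Measure X := fun t => S (min N ⌊t / τ⌋₊)
  have hGS : ∀ t, t ≤ T → G t = S ⌊t / τ⌋₊ := fun t ht => by
    simp only [G, min_eq_right (hfl t ht)]
  have hint : ∀ (D : X → X → ℝ≥0∞) s t, t ≤ T →
      (∫⁻ u in Ioc s t, pairInt (G u) (fun x y => κ x y * D x y)) =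
      ∫⁻ u in Ioc s t, (fun j => pairInt (S j) (fun x y => κ x y * D x y)) ⌊u / τ⌋₊ := by
    intro D s t ht
    refine setLIntegral_congr_fun measurableSet_Ioc fun u hu => ?_
    simp only
    rw [hGS u (hu.2.trans ht)]
  have hcr : ∀ (D : X → X → ℝ≥0∞) (C : ℝ≥0∞), (∀ x y, D x y ≤ C) → ∀ j ≤ N,
      h * pairInt (S j) (fun x y => κ x y * D x y) ≤ C * r := by
    intro D C hD j hj
    calc _ ≤ h * (C * (L * M * M)) := by
          gcongr
          exact hE.pairInt_le (hE.mass_seq hh hj).2 hD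
      _ = C * (h * (L * M * M)) := by ring
      _ ≤ C * r := by gcongr
  have hk_le : ∀ t, 0 ≤ t → (⌊t / τ⌋₊ : ℝ≥0∞) * h ≤ ENNReal.ofReal t := by
    intro t ht
    rw [h_def, ← ENNReal.ofReal_natCast, ← ENNReal.ofReal_mul (by positivity)]
    exact ENNReal.ofReal_le_ofReal (floor_mul_le hτ ht)
  have hk_ge : ∀ t, ENNReal.ofReal t ≤ (⌊t / τ⌋₊ : ℝ≥0∞) * h + h := by
    intro t
    have : (⌊t / τ⌋₊ : ℝ≥0∞) * h + h = ((⌊t / τ⌋₊ + 1 : ℕ) : ℝ≥0∞) * h := by push_cast; ring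
    rw [this, h_def, ← ENNReal.ofReal_natCast, ← ENNReal.ofReal_mul (by positivity)]
    exact ENNReal.ofReal_le_ofReal (lt_floor_succ_mul hτ).le
  refine ⟨G, ?_, ?_, ?_, ?_, ?_, ?_, ?_, ?_⟩
  · exact (measurable_from_nat (f := fun j => S (min N j))).comp
      (Nat.measurable_floor.comp (measurable_id.div_const τ))
  · exact fun t => (hE.mass_seq hh (min_le_left _ _)).2
  · simp [G, hS, coagSeq]
  · exact fun A hA hAop heA hgA t => hE.seq_null hh hA hAop heA hgA (min_le_left _ _)
  · intro φ D C hC hφ hφC hDC hφD s t hs hst ht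
    have hjk : ⌊s / τ⌋₊ ≤ ⌊t / τ⌋₊ := Nat.floor_mono (by gcongr)
    rw [hGS t ht, hGS s (hst.trans ht), hint D s t ht]
    refine (hE.seq_le (e := e) hh hφ hC hφC hφD hjk (hfl t ht)).trans ?_
    have h1 := sum_floor_le (c := fun j => pairInt (S j) (fun x y => κ x y * D x y)) hτ hs hst
    -- The errors of the two ends of `[s, t]`, one cell of flux and one of injection, together fit
    -- into `C * r`.
    have h2 : h * pairInt (S ⌊s / τ⌋₊) (fun x y => κ x y * D x y) + C * h ≤ C * r := by
      calc _ ≤ h * (C * (L * M * M)) + C * h := by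
            gcongr
            exact hE.pairInt_le (hE.mass_seq hh (hfl s (hst.trans ht))).2 hDC
        _ = C * (h * (L * M * M + 1)) := by ring
        _ ≤ C * r := by
          gcongr
          refine le_trans ?_ (hhQ.trans (min_le_left _ _))
          rw [hQ_def, add_right_comm]
          exact mul_le_mul_right le_self_add h
    have h3 : ((⌊t / τ⌋₊ - ⌊s / τ⌋₊ : ℕ) : ℝ≥0∞) * h ≤ ENNReal.ofReal (t - s) + h := by
      rw [h_def, ← ENNReal.ofReal_add (by linarith) hτ.le, ← ENNReal.ofReal_natCast,
        ← ENNReal.ofReal_mul (by positivity), Nat.cast_sub hjk]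
      refine ENNReal.ofReal_le_ofReal ?_
      have h4 := floor_mul_le hτ (hs.trans hst)
      have h5 := lt_floor_succ_mul (t := s) hτ
      push_cast at h5
      linarith
    calc _ ≤ ∫⁻ x, φ x ∂(S ⌊s / τ⌋₊) + ((∫⁻ u in Ioc s t,
            (fun j => pairInt (S j) (fun x y => κ x y * D x y)) ⌊u / τ⌋₊) +
            h * pairInt (S ⌊s / τ⌋₊) (fun x y => κ x y * D x y)) +
            (ENNReal.ofReal (t - s) + h) * C := by
          refine add_le_add (add_le_add_right h1 _) ?_
          gcongr
          exact hφC e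
      _ = ∫⁻ x, φ x ∂(S ⌊s / τ⌋₊) + (∫⁻ u in Ioc s t,
            (fun j => pairInt (S j) (fun x y => κ x y * D x y)) ⌊u / τ⌋₊) +
            C * ENNReal.ofReal (t - s) +
            (h * pairInt (S ⌊s / τ⌋₊) (fun x y => κ x y * D x y) + C * h) := by ring
      _ ≤ _ := add_le_add_right h2 _
  · intro φ D C hC hφ hφC hDC hφD s t hs hst ht
    have hjk : ⌊s / τ⌋₊ ≤ ⌊t / τ⌋₊ := Nat.floor_mono (by gcongr)
    rw [hGS t ht, hGS s (hst.trans ht), hint D s t ht]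
    refine (hE.seq_ge (e := e) hh hφ hC hφC hφD hjk (hfl t ht)).trans ?_
    rw [add_assoc]
    refine add_le_add_right ((sum_floor_le hτ hs hst).trans ?_) _
    exact add_le_add_right (hcr D C hDC _ (hfl s (hst.trans ht))) _
  · intro φ D C hC hφ hφC hDC hφD t ht0 ht
    rw [hGS t ht, hint D 0 t ht]
    refine (add_le_add_right (le_sum_floor
      (c := fun j => pairInt (S j) (fun x y => κ x y * D x y)) hτ t) _).trans ?_
    rw [← add_assoc, hE.seq_eq (e := e) hh hφ hC hφC hφD (hfl t ht)]
    refine add_le_add (add_le_add_right ?_ _) (hcr D C hDC _ (hfl t ht))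
    gcongr
    exact hk_le t ht0
  · intro φ D C hC hφ hφC hDC hφD t ht0 ht
    rw [hGS t ht, hint D 0 t ht]
    have h1 := hE.seq_eq (e := e) hh hφ hC hφC hφD (hfl t ht)
    calc ∫⁻ x, φ x ∂g + ENNReal.ofReal t * φ e
        ≤ ∫⁻ x, φ x ∂g + ((⌊t / τ⌋₊ : ℝ≥0∞) * h + h) * φ e := by
          gcongr
          exact hk_ge t
      _ = (∫⁻ x, φ x ∂g + (⌊t / τ⌋₊ : ℝ≥0∞) * h * φ e) + h * φ e := by ring
      _ ≤ _ := by
        rw [← h1]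
        refine add_le_add (add_le_add_right ?_ _) ?_
        · rw [Finset.range_eq_Ico, ← setLIntegral_floor _ hτ (Nat.zero_le _)]
          exact lintegral_mono_set (Ioc_subset_Ioc (by simp) (floor_mul_le hτ ht0))
        · rw [mul_comm]
          gcongr
          exact hφC e

end EulerScheme

/-! ### The jump rate, its test functions, and bounds from the kernel exponents. -/

section Kernels

/-- Addition of particle sizes. -/
def addP (x y : PosR) : PosR := ⟨x + y, mem_Ioi.2 (add_pos x.2.out y.2.out)⟩

@[simp] lemma coe_addP (x y : PosR) : (addP x y : ℝ) = x + y := rfl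

lemma measurable_addP : Measurable (uncurry addP) :=
  Measurable.subtype_mk (by fun_prop)

/-- The rate kernel `K(x, y) / y` of the mass form of the equation. -/
def rate (K : PosR → PosR → ℝ) (x y : PosR) : ℝ≥0∞ := ENNReal.ofReal (K x y / y)

/-- The function `u ↦ ∫_0^u 1_{(α, β)}(z) dz + α`. -/
def clamp (α β u : ℝ) : ℝ := max α (min u β)

/-- The amount of `z ∈ (α, β)` crossed by a jump from `x` to `x + y`. -/
def crossed (α β : ℝ) (x y : PosR) : ℝ := clamp α β (x + y) - clamp α β x

/-- `∫_x^∞ 1_{(α, β)}(z) dz`. -/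
def tailLength (α β : ℝ) (x : PosR) : ℝ := β - clamp α β x

lemma clamp_mono (α β : ℝ) : Monotone (clamp α β) := fun _ _ h => by unfold clamp; gcongr

lemma crossed_nonneg (α β : ℝ) (x y : PosR) : 0 ≤ crossed α β x y :=
  sub_nonneg.2 (clamp_mono α β (by linarith [y.2.out]))

lemma tailLength_nonneg {α β : ℝ} (h : α ≤ β) (x : PosR) : 0 ≤ tailLength α β x := by
  simp [tailLength, clamp, h]

lemma tailLength_le (α β : ℝ) (x : PosR) : tailLength α β x ≤ β - α :=
  sub_le_sub_left (le_max_left _ _) _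

lemma crossed_le {α β : ℝ} (h : α ≤ β) (x y : PosR) : crossed α β x y ≤ β - α := by
  have h1 : clamp α β (x + y) ≤ β := by simp [clamp, h]
  have h2 : α ≤ clamp α β x := by simp [clamp]
  unfold crossed
  linarith

lemma crossed_le_right (α β : ℝ) (x y : PosR) : crossed α β x y ≤ y := by
  have := y.2.out
  unfold crossed clamp
  simp only [tsub_le_iff_right, max_le_iff]
  refine ⟨by linarith [le_max_left α (min (x : ℝ) β)], ?_⟩
  have : min ((x : ℝ) + y) β ≤ y + min (x : ℝ) β := by
    rw [← min_add_add_left]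
    exact min_le_min (by linarith) (by linarith)
  linarith [le_max_right α (min (x : ℝ) β)]

lemma crossed_eq_zero_of_le {α β : ℝ} {x y : PosR} (hx : β ≤ x) : crossed α β x y = 0 := by
  have := y.2.out
  simp [crossed, clamp, hx, show β ≤ x + y by linarith]

lemma crossed_eq_zero_of_add_le {α β : ℝ} {x y : PosR} (hx : (x : ℝ) + y ≤ α) :
    crossed α β x y = 0 := by
  have := y.2.out
  simp [crossed, clamp, hx, show (x : ℝ) ≤ α by linarith]

/-- This makes `tailLength` the test function whose loss in a jump is `crossed`; tested with it, the
balance law is the flux equation integrated over `z ∈ (α, β)`. -/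
lemma tailLength_eq (α β : ℝ) (x y : PosR) :
    tailLength α β x = tailLength α β (addP x y) + crossed α β x y := by
  simp [tailLength, crossed]

lemma tailLength_eq_of_le {α β : ℝ} {x : PosR} (hx : (x : ℝ) ≤ α) :
    tailLength α β x = β - α := by
  simp [tailLength, clamp, hx]

lemma continuous_clamp (α β : ℝ) : Continuous (clamp α β) := by unfold clamp; fun_prop

lemma continuous_crossed (α β : ℝ) : Continuous (uncurry (crossed α β)) := by
  have := continuous_clamp α β
  unfold crossed uncurry
  fun_prop

lemma continuous_tailLength (α β : ℝ) : Continuous (tailLength α β) := by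
  have := continuous_clamp α β
  unfold tailLength
  fun_prop

/-- A continuous cutoff function with values in `[0, 1]`, supported in `[1/(2m), 2m]` and equal to
`1` on `[1/m, m]`. -/
def cutoff (m : ℝ) (x : PosR) : ℝ := min 1 (max 0 (2 * m * x - 1)) * min 1 (max 0 (2 - x / m))

lemma cutoff_nonneg (m : ℝ) (x : PosR) : 0 ≤ cutoff m x := by unfold cutoff; positivity

lemma cutoff_le_one (m : ℝ) (x : PosR) : cutoff m x ≤ 1 :=
  mul_le_one₀ (min_le_left _ _) (by positivity) (min_le_left _ _)

lemma continuous_cutoff (m : ℝ) : Continuous (cutoff m) := by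
  unfold cutoff
  fun_prop

lemma cutoff_mono {m m' : ℝ} (hm : 0 < m) (h : m ≤ m') (x : PosR) : cutoff m x ≤ cutoff m' x := by
  have := x.2.out
  unfold cutoff
  gcongr

lemma cutoff_eq_one {m : ℝ} (hm : 0 < m) {x : PosR} (h1 : 1 / m ≤ x) (h2 : x ≤ m) :
    cutoff m x = 1 := by
  rw [div_le_iff₀ hm] at h1
  have h3 : (x : ℝ) / m ≤ 1 := by rwa [div_le_one hm]
  have h4 : (1 : ℝ) ≤ max 0 (2 * m * x - 1) := le_max_of_le_right (by linarith)
  have h5 : (1 : ℝ) ≤ max 0 (2 - x / m) := le_max_of_le_right (by linarith)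
  simp [cutoff, h4, h5]

lemma mem_of_cutoff_ne_zero {m : ℝ} (hm : 0 < m) {x : PosR} (h : cutoff m x ≠ 0) :
    1 / (2 * m) ≤ x ∧ x ≤ 2 * m := by
  constructor <;> by_contra! hc <;> apply h
  · rw [lt_div_iff₀ (by positivity)] at hc
    have : 2 * m * x - 1 ≤ (0 : ℝ) := by linarith
    simp [cutoff, this]
  · have : 2 - x / m ≤ (0 : ℝ) := by
      rw [sub_nonpos, le_div_iff₀ hm]
      exact hc.le
    simp [cutoff, this]

lemma isCompact_sizeInterval {u : ℝ} (hu : 0 < u) (v : ℝ) :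
    IsCompact {x : PosR | u ≤ x ∧ (x : ℝ) ≤ v} := by
  rw [Topology.IsEmbedding.subtypeVal.isCompact_iff]
  convert isCompact_Icc (a := u) (b := v) using 1
  ext z
  simp only [mem_image, mem_ofPred_eq, Subtype.exists, mem_Icc]
  exact ⟨fun ⟨a, ha, h, e⟩ => e ▸ h, fun h => ⟨z, hu.trans_le h.1, h, rfl⟩⟩

lemma hasCompactSupport_cutoff {m : ℝ} (hm : 0 < m) : HasCompactSupport (cutoff m) :=
  HasCompactSupport.intro (isCompact_sizeInterval (u := 1 / (2 * m)) (by positivity) (2 * m))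
    fun _ hx => by_contra fun h => hx (mem_of_cutoff_ne_zero hm h)

lemma eventually_cutoff_eq_one (x : PosR) : ∀ᶠ m : ℕ in atTop, cutoff (m + 1) x = 1 := by
  obtain ⟨N, hN⟩ := exists_nat_ge (max (x : ℝ) (1 / x))
  filter_upwards [eventually_ge_atTop N] with m hm
  have hx := x.2.out
  have hm' : (N : ℝ) ≤ m := by exact_mod_cast hm
  have h1 : (x : ℝ) ≤ m + 1 := by linarith [le_max_left (x : ℝ) (1 / x)]
  have h2 : 1 / (x : ℝ) ≤ m + 1 := by linarith [le_max_right (x : ℝ) (1 / x)]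
  refine cutoff_eq_one (by positivity) ?_ h1
  rwa [div_le_comm₀ (by positivity) hx]

/-- The weight `x^p 1_{x ≤ δ}`. -/
def smallWeight (p δ : ℝ) (x : PosR) : ℝ≥0∞ :=
  {x : PosR | (x : ℝ) ≤ δ}.indicator (fun x => ENNReal.ofReal ((x : ℝ) ^ p)) x

lemma measurableSet_le (δ : ℝ) : MeasurableSet {x : PosR | (x : ℝ) ≤ δ} :=
  measurableSet_Iic.preimage measurable_subtype_coe

lemma measurable_smallWeight (p δ : ℝ) : Measurable (smallWeight p δ) :=
  Measurable.indicator (by fun_prop) (measurableSet_le δ)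

lemma smallWeight_of_le {p δ : ℝ} {x : PosR} (h : (x : ℝ) ≤ δ) :
    smallWeight p δ x = ENNReal.ofReal ((x : ℝ) ^ p) := by
  simp [smallWeight, h]

variable {K : PosR → PosR → ℝ} {a b : ℝ}

lemma rpow_le_endpoints {u v x : ℝ} (hu : 0 < u) (h1 : u ≤ x) (h2 : x ≤ v) (s : ℝ) :
    x ^ s ≤ u ^ s + v ^ s := by
  have hx : 0 < x := hu.trans_le h1
  have hv : 0 < v := hx.trans_le h2
  rcases le_total 0 s with h | h
  · have := Real.rpow_le_rpow hx.le h2 h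
    have := Real.rpow_nonneg hu.le s
    linarith
  · have := Real.rpow_le_rpow_of_nonpos hu h1 h
    have := Real.rpow_nonneg hv.le s
    linarith

/-- On `[z/2, z]²` both powers are comparable to powers of `z`, so `K / y` is at least of order
`z^(a+b-1)`. The truncation level `e^(a+b-1)` is no smaller than `z^(a+b-1)`, since `z ≥ e` and the
exponent is nonpositive. -/
lemma kernel_lower {c₁ : ℝ} (hc : 0 < c₁)
    (hK : ∀ x y : PosR, c₁ * ((x : ℝ) ^ a * (y : ℝ) ^ b + (x : ℝ) ^ b * (y : ℝ) ^ a) ≤ K x y) :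
    ∃ c : ℝ, 0 < c ∧ ∀ (e z : ℝ), 0 < e → e ≤ z → a + b ≤ 1 → ∀ x y : PosR, z / 2 ≤ x → x ≤ z →
      z / 2 ≤ y → y ≤ z →
      ENNReal.ofReal (c * z ^ (a + b - 1)) ≤
        min (rate K x y) (ENNReal.ofReal (e ^ (a + b - 1))) := by
  have half : ∀ (s z x : ℝ), 0 < z → z / 2 ≤ x → x ≤ z → 2 ^ (-|s|) * z ^ s ≤ x ^ s := by
    intro s z x hz h1 h2
    have hx : 0 < x := by linarith
    rcases le_total 0 s with h | h
    · rw [abs_of_nonneg h, Real.rpow_neg (by norm_num), ← div_eq_inv_mul,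
        ← Real.div_rpow hz.le (by norm_num)]
      exact Real.rpow_le_rpow (by positivity) h1 h
    · rw [abs_of_nonpos h, neg_neg]
      calc (2 : ℝ) ^ s * z ^ s ≤ 1 * z ^ s := by
            gcongr
            exact Real.rpow_le_one_of_one_le_of_nonpos (by norm_num) h
        _ ≤ x ^ s := by
          rw [one_mul]
          exact Real.rpow_le_rpow_of_nonpos hx h2 h
  set c' : ℝ := c₁ * (2 ^ (-|a|) * 2 ^ (-|b|)) with hc'
  refine ⟨min c' 1, lt_min (by positivity) one_pos, fun e z he hez hab x y hx1 hx2 hy1 hy2 => le_min (α := ℝ≥0∞) ?_ ?_⟩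
  · have hz : 0 < z := he.trans_le hez
    refine ENNReal.ofReal_le_ofReal ?_
    rw [le_div_iff₀ y.2.out]
    calc min c' 1 * z ^ (a + b - 1) * y ≤ c' * z ^ (a + b - 1) * z := by
          gcongr
          exacts [y.2.out.le, min_le_left c' 1]
      _ = c₁ * ((2 ^ (-|a|) * z ^ a) * (2 ^ (-|b|) * z ^ b)) := by
          rw [hc', Real.rpow_sub hz, Real.rpow_one, Real.rpow_add hz]
          field_simp
      _ ≤ c₁ * ((x : ℝ) ^ a * (y : ℝ) ^ b + (x : ℝ) ^ b * (y : ℝ) ^ a) := by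
          have h1 := half a z x hz hx1 hx2
          have h2 := half b z y hz hy1 hy2
          have hx := x.2.out
          have hy := y.2.out
          gcongr
          refine le_trans ?_ (le_add_of_nonneg_right (by positivity))
          gcongr
      _ ≤ K x y := hK x y
  · refine ENNReal.ofReal_le_ofReal ?_
    calc min c' 1 * z ^ (a + b - 1) ≤ 1 * z ^ (a + b - 1) := by
          have : 0 < z := he.trans_le hez
          gcongr
          exact min_le_right _ _
      _ ≤ e ^ (a + b - 1) := by
          rw [one_mul]
          exact Real.rpow_le_rpow_of_nonpos he hez (by linarith)

/-- Away from compact subsets of `(0, ∞)²`, the kernel `K(x, y) / y` tested against `crossed` is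
controlled by small-size weights. -/
lemma rate_crossed_tail {c₂ p q α β : ℝ} (hc : 0 ≤ c₂)
    (hK : ∀ x y : PosR, K x y ≤ c₂ * ((x : ℝ) ^ a * (y : ℝ) ^ b + (x : ℝ) ^ b * (y : ℝ) ^ a))
    (hpa : p ≤ a) (hpb : p ≤ b) (haq : a ≤ q) (hbq : b ≤ q) (hq : q < 1) (hα : 0 < α)
    (hαβ : α < β) :
    ∃ C : ℝ, 0 ≤ C ∧ ∃ m₀ : ℝ, 1 ≤ m₀ ∧ ∀ m, m₀ ≤ m → ∀ x y : PosR,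
      ∀ k ≤ rate K x y, k * ENNReal.ofReal (crossed α β x y) ≤
        k * ENNReal.ofReal (crossed α β x y * (cutoff m x * cutoff m y)) +
          ENNReal.ofReal C * (smallWeight p (1 / m) x + smallWeight p (1 / m) y +
            ENNReal.ofReal (m ^ (q - 1)) * smallWeight p β x) := by
  have hβ : 0 < β := hα.trans hαβ
  set A : ℝ := (α / 2) ^ a + β ^ a + ((α / 2) ^ b + β ^ b) with hA
  set B : ℝ := (α / 2) ^ (a - 1) + (α / 2) ^ (b - 1) with hB
  set E : ℝ := β ^ (a - p) + β ^ (b - p) with hE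
  set C : ℝ := 2 * (c₂ * A) + c₂ * β * B + c₂ * β * E with hC
  have hA0 : 0 ≤ A := by positivity
  have hB0 : 0 ≤ B := by positivity
  have hE0 : 0 ≤ E := by positivity
  -- For `m ≥ 2/α`, at most one of `x`, `y` is below `1/m` when `x + y > α`; for `m ≥ β`, every `x <
  -- β` lies below the upper end of the cutoff.
  refine ⟨C, by positivity, max 1 (max (2 / α) β), le_max_left _ _, fun m hm x y k hk => ?_⟩
  have hm1 : 1 ≤ m := (le_max_left _ _).trans hm
  have hm2 : 2 / α ≤ m := (le_max_of_le_right (le_max_left _ _)).trans hm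
  have hm3 : β ≤ m := (le_max_of_le_right (le_max_right _ _)).trans hm
  have hm0 : 0 < m := by linarith
  have hmα : 1 / m ≤ α / 2 := by
    rw [div_le_iff₀ hα] at hm2
    rw [div_le_div_iff₀ hm0 two_pos]
    linarith
  have hmone : 1 / m ≤ 1 := by rw [div_le_one hm0]; exact hm1
  have hx := x.2.out
  have hy := y.2.out
  by_cases hxβ : β ≤ x
  · simp [crossed_eq_zero_of_le hxβ]
  push Not at hxβ
  by_cases hxy : (x : ℝ) + y ≤ α
  · simp [crossed_eq_zero_of_add_le hxy]
  push Not at hxy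
  by_cases hcut : cutoff m x = 1 ∧ cutoff m y = 1
  · simp [hcut.1, hcut.2]
  have hcr := crossed_nonneg α β x y
  have hcrβ : crossed α β x y ≤ β := (crossed_le hαβ.le x y).trans (by linarith)
  have key : ∀ (s : ℝ), K x y / y * crossed α β x y ≤ C * s → ENNReal.ofReal s ≤
      smallWeight p (1 / m) x + smallWeight p (1 / m) y +
            ENNReal.ofReal (m ^ (q - 1)) * smallWeight p β x →
      k * ENNReal.ofReal (crossed α β x y) ≤
        k * ENNReal.ofReal (crossed α β x y * (cutoff m x * cutoff m y)) +
          ENNReal.ofReal C * (smallWeight p (1 / m) x + smallWeight p (1 / m) y +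
            ENNReal.ofReal (m ^ (q - 1)) * smallWeight p β x) := by
    intro s h1 h2
    refine le_add_left ?_
    calc k * ENNReal.ofReal (crossed α β x y)
        ≤ rate K x y * ENNReal.ofReal (crossed α β x y) := by gcongr
      _ = ENNReal.ofReal (K x y / y * crossed α β x y) := by
          rw [rate, ENNReal.ofReal_mul' hcr]
      _ ≤ ENNReal.ofReal (C * s) := ENNReal.ofReal_le_ofReal h1
      _ = ENNReal.ofReal C * ENNReal.ofReal s := ENNReal.ofReal_mul (by positivity)
      _ ≤ _ := by gcongr
  have hKy : K x y / y ≤ c₂ * ((x : ℝ) ^ a * (y : ℝ) ^ (b - 1) + (x : ℝ) ^ b * (y : ℝ) ^ (a - 1)) := by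
    rw [div_le_iff₀ hy]
    refine (hK x y).trans_eq ?_
    rw [Real.rpow_sub_one hy.ne', Real.rpow_sub_one hy.ne']
    field_simp
  -- Small `x`: then `y ≥ α/2`, so the negative powers of `y` are bounded and only `x^a`, `x^b`
  -- matter.
  rcases lt_or_ge (x : ℝ) (1 / m) with hx1 | hx1
  · refine key ((x : ℝ) ^ p) ?_ ?_
    · have hyα : α / 2 ≤ y := by linarith
      have e1 : (x : ℝ) ^ a ≤ (x : ℝ) ^ p := Real.rpow_le_rpow_of_exponent_ge hx (by linarith) hpa
      have e2 : (x : ℝ) ^ b ≤ (x : ℝ) ^ p := Real.rpow_le_rpow_of_exponent_ge hx (by linarith) hpb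
      have e3 : (y : ℝ) ^ (a - 1) ≤ (α / 2) ^ (a - 1) :=
        Real.rpow_le_rpow_of_nonpos (by positivity) hyα (by linarith)
      have e4 : (y : ℝ) ^ (b - 1) ≤ (α / 2) ^ (b - 1) :=
        Real.rpow_le_rpow_of_nonpos (by positivity) hyα (by linarith)
      calc K x y / y * crossed α β x y
          ≤ (c₂ * ((x : ℝ) ^ p * (α / 2) ^ (b - 1) + (x : ℝ) ^ p * (α / 2) ^ (a - 1))) * β := by
            refine mul_le_mul (hKy.trans ?_) hcrβ hcr (by positivity)
            gcongr
        _ = c₂ * β * B * (x : ℝ) ^ p := by rw [hB]; ring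
        _ ≤ C * (x : ℝ) ^ p := by
          gcongr
          rw [hC]
          have : 0 ≤ c₂ * A := by positivity
          have : 0 ≤ c₂ * β * E := by positivity
          linarith
    · rw [smallWeight_of_le hx1.le, add_assoc]
      exact le_self_add
  -- Small `y`: then `x` stays in `[α/2, β]`, and `crossed ≤ y` cancels the singular factor `1/y`.
  rcases lt_or_ge (y : ℝ) (1 / m) with hy1 | hy1
  · refine key ((y : ℝ) ^ p) ?_ ?_
    · have hxα : α / 2 ≤ x := by linarith
      have e1 : (y : ℝ) ^ a ≤ (y : ℝ) ^ p := Real.rpow_le_rpow_of_exponent_ge hy (by linarith) hpa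
      have e2 : (y : ℝ) ^ b ≤ (y : ℝ) ^ p := Real.rpow_le_rpow_of_exponent_ge hy (by linarith) hpb
      have e3 : (x : ℝ) ^ a ≤ A := (rpow_le_endpoints (by positivity) hxα hxβ.le a).trans
        (le_add_of_nonneg_right (by positivity))
      have e4 : (x : ℝ) ^ b ≤ A := (rpow_le_endpoints (by positivity) hxα hxβ.le b).trans
        (le_add_of_nonneg_left (by positivity))
      calc K x y / y * crossed α β x y
          ≤ (c₂ * (A * (y : ℝ) ^ (b - 1) + A * (y : ℝ) ^ (a - 1))) * y := by
            refine mul_le_mul (hKy.trans ?_) (crossed_le_right α β x y) hcr (by positivity)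
            gcongr
        _ = c₂ * A * ((y : ℝ) ^ b + (y : ℝ) ^ a) := by
          rw [Real.rpow_sub_one hy.ne', Real.rpow_sub_one hy.ne']
          field_simp
        _ ≤ c₂ * A * ((y : ℝ) ^ p + (y : ℝ) ^ p) := by gcongr
        _ = 2 * (c₂ * A) * (y : ℝ) ^ p := by ring
        _ ≤ C * (y : ℝ) ^ p := by
          gcongr
          rw [hC]
          have : 0 ≤ c₂ * β * B := by positivity
          have : 0 ≤ c₂ * β * E := by positivity
          linarith
    · rw [smallWeight_of_le hy1.le, add_right_comm]
      exact le_add_self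
  -- Only large `y` remains, where `y^(a-1)` and `y^(b-1)` are at most `m^(q-1)`, which decays
  -- because `q < 1`.
  · have hmy : m ≤ y := by
      by_contra! h
      exact hcut ⟨cutoff_eq_one hm0 hx1 (by linarith), cutoff_eq_one hm0 hy1 h.le⟩
    have hyone : (1 : ℝ) ≤ y := hm1.trans hmy
    refine key (m ^ (q - 1) * (x : ℝ) ^ p) ?_ ?_
    · have e1 : ∀ s, p ≤ s → (x : ℝ) ^ s ≤ (x : ℝ) ^ p * β ^ (s - p) := by
        intro s hs
        calc (x : ℝ) ^ s = (x : ℝ) ^ p * (x : ℝ) ^ (s - p) := by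
              rw [← Real.rpow_add hx]; congr 1; ring
          _ ≤ _ := by
            gcongr
      have e2 : ∀ s, s ≤ q → (y : ℝ) ^ (s - 1) ≤ m ^ (q - 1) := by
        intro s hs
        calc (y : ℝ) ^ (s - 1) ≤ (y : ℝ) ^ (q - 1) :=
              Real.rpow_le_rpow_of_exponent_le hyone (by linarith)
          _ ≤ _ := Real.rpow_le_rpow_of_nonpos hm0 hmy (by linarith)
      calc K x y / y * crossed α β x y
          ≤ (c₂ * ((x : ℝ) ^ p * β ^ (a - p) * m ^ (q - 1) +
              (x : ℝ) ^ p * β ^ (b - p) * m ^ (q - 1))) * β := by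
            refine mul_le_mul (hKy.trans ?_) hcrβ hcr (by positivity)
            gcongr
            exacts [e1 a hpa, e2 b hbq, e1 b hpb, e2 a haq]
        _ = c₂ * β * E * (m ^ (q - 1) * (x : ℝ) ^ p) := by rw [hE]; ring
        _ ≤ C * (m ^ (q - 1) * (x : ℝ) ^ p) := by
          gcongr
          rw [hC]
          have : 0 ≤ c₂ * A := by positivity
          have : 0 ≤ c₂ * β * B := by positivity
          linarith
    · rw [smallWeight_of_le hxβ.le, ENNReal.ofReal_mul (by positivity)]
      exact le_add_self

end Kernels

/-! ### A priori estimate at small sizes from dissipation. -/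

section SmallSizes

/-- Young's inequality, used with an optimal `η` in place of Cauchy–Schwarz in time. -/
lemma ENNReal_le_mul_sq_add {η : ℝ} (hη : 0 < η) (x : ℝ≥0∞) :
    x ≤ ENNReal.ofReal η * x ^ 2 + ENNReal.ofReal η⁻¹ := by
  rcases le_total x (ENNReal.ofReal η⁻¹) with h | h
  · exact le_add_left h
  · refine le_add_right ?_
    calc x = (ENNReal.ofReal η * ENNReal.ofReal η⁻¹) * x := by
          rw [← ENNReal.ofReal_mul hη.le, mul_inv_cancel₀ hη.ne', ENNReal.ofReal_one, one_mul]
      _ ≤ (ENNReal.ofReal η * x) * x := by gcongr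
      _ = _ := by ring

/-- The dyadic size interval `(z/2, z]`. -/
def dyadic (z : ℝ) : Set PosR := {x | z / 2 < x ∧ (x : ℝ) ≤ z}

lemma measurableSet_dyadic (z : ℝ) : MeasurableSet (dyadic z) :=
  (measurableSet_Ioc (a := z / 2) (b := z)).preimage measurable_subtype_coe

lemma smallWeight_le_tsum {p δ : ℝ} (hp : p ≤ 0) (hδ : 0 < δ) (x : PosR) :
    smallWeight p δ x ≤ ∑' i : ℕ, ENNReal.ofReal ((δ * (1 / 2) ^ i / 2) ^ p) *
      (dyadic (δ * (1 / 2) ^ i)).indicator 1 x := by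
  by_cases hx : (x : ℝ) ≤ δ
  · have hx0 := x.2.out
    obtain ⟨i, h1, h2⟩ := exists_nat_pow_near_of_lt_one (x := (x : ℝ) / δ) (y := 1 / 2)
      (by positivity) (by rwa [div_le_one hδ]) (by norm_num) (by norm_num)
    rw [lt_div_iff₀ hδ] at h1
    rw [div_le_iff₀ hδ] at h2
    have hmem : x ∈ dyadic (δ * (1 / 2) ^ i) := by
      refine ⟨?_, by linarith⟩
      rw [pow_succ] at h1
      linarith
    refine le_trans ?_ (ENNReal.le_tsum i)
    rw [smallWeight_of_le hx, indicator_of_mem hmem, Pi.one_apply, mul_one]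
    exact ENNReal.ofReal_le_ofReal
      (Real.rpow_le_rpow_of_nonpos (by positivity) hmem.1.le hp)
  · simp [smallWeight, hx]

variable {G : ℝ → Measure PosR} {M : ℝ≥0∞} {T : ℝ}

/-- Bounds on dyadic intervals sum up to a bound for the weight `x^p` near `0`. -/
lemma lintegral_smallWeight_le (hG : Measurable G)
    {B s p : ℝ} (hB : 0 ≤ B) (hp : p ≤ 0) (hps : 0 < p + s)
    (hdy : ∀ z, 0 < z → ∫⁻ u in Ioc 0 T, G u (dyadic z) ≤ ENNReal.ofReal (B * z ^ s)) {δ : ℝ}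
    (hδ : 0 < δ) :
    ∫⁻ u in Ioc 0 T, ∫⁻ x, smallWeight p δ x ∂(G u) ≤
      ENNReal.ofReal (B * 2 ^ (-p) * (1 - (1 / 2) ^ (p + s))⁻¹ * δ ^ (p + s)) := by
  set ρ : ℝ := (1 / 2) ^ (p + s) with hρ
  have hρ1 : ρ < 1 := Real.rpow_lt_one (by norm_num) (by norm_num) hps
  have hρ0 : 0 ≤ ρ := by positivity
  have hmeas : ∀ i : ℕ, Measurable fun u => G u (dyadic (δ * (1 / 2) ^ i)) := fun i =>
    Measure.measurable_measure.1 hG _ (measurableSet_dyadic _)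
  calc ∫⁻ u in Ioc 0 T, ∫⁻ x, smallWeight p δ x ∂(G u)
      ≤ ∫⁻ u in Ioc 0 T, ∑' i : ℕ, ENNReal.ofReal ((δ * (1 / 2) ^ i / 2) ^ p) *
          G u (dyadic (δ * (1 / 2) ^ i)) := by
        refine lintegral_mono fun u => ?_
        refine (lintegral_mono (smallWeight_le_tsum hp hδ)).trans_eq ?_
        rw [lintegral_tsum]
        · congr 1
          ext i
          rw [lintegral_const_mul _ (measurable_one.indicator (measurableSet_dyadic _)),
            lintegral_indicator_one (measurableSet_dyadic _)]
        · exact fun i => ((measurable_one.indicator (measurableSet_dyadic _)).const_mul _).aemeasurable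
    _ = ∑' i : ℕ, ENNReal.ofReal ((δ * (1 / 2) ^ i / 2) ^ p) *
          ∫⁻ u in Ioc 0 T, G u (dyadic (δ * (1 / 2) ^ i)) := by
        rw [lintegral_tsum fun i => ((hmeas i).const_mul _).aemeasurable]
        congr 1
        ext i
        rw [lintegral_const_mul _ (hmeas i)]
    _ ≤ ∑' i : ℕ, ENNReal.ofReal (B * 2 ^ (-p) * δ ^ (p + s) * ρ ^ i) := by
        refine ENNReal.tsum_le_tsum fun i => ?_
        refine (mul_le_mul_right (hdy _ (by positivity)) _).trans_eq ?_
        rw [← ENNReal.ofReal_mul (by positivity)]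
        congr 1
        have h2 : (0 : ℝ) < (1 / 2) ^ i := by positivity
        rw [Real.div_rpow (by positivity) (by norm_num), Real.mul_rpow hδ.le h2.le,
          Real.mul_rpow hδ.le h2.le, Real.rpow_add hδ, hρ, Real.rpow_add (by norm_num),
          Real.rpow_neg (by norm_num), mul_pow, ← Real.rpow_natCast (1 / 2) i,
          ← Real.rpow_natCast ((1 / 2) ^ p), ← Real.rpow_natCast ((1 / 2) ^ s),
          ← Real.rpow_mul (by norm_num), ← Real.rpow_mul (by norm_num),
          ← Real.rpow_mul (by norm_num), ← Real.rpow_mul (by norm_num), mul_comm (i : ℝ) p,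
          mul_comm (i : ℝ) s]
        ring
    _ = _ := by
        rw [← ENNReal.ofReal_tsum_of_nonneg (fun i => by positivity)
          ((summable_geometric_of_lt_one hρ0 hρ1).mul_left _), tsum_mul_left,
          tsum_geometric_of_lt_one hρ0 hρ1]
        congr 1
        ring

variable {K : PosR → PosR → ℝ} {a b : ℝ}

/-- The dissipation of mass through size `z` controls the mass in the dyadic interval. -/
lemma dyadic_bound {c : ℝ} (hc : 0 < c) {κ : PosR → PosR → ℝ≥0∞} {e : PosR} {g : Measure PosR}
    {r : ℝ≥0∞} (hT : 0 ≤ T) (hG : ApproxSol addP κ e g T r G) (hM : M ≠ ∞)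
    (hg : g univ + ENNReal.ofReal T + r ≤ M) (hge : g {x | (x : ℝ) < e} = 0)
    {s : ℝ} (hκ : ∀ z : ℝ, (e : ℝ) ≤ z → ∀ x y : PosR, z / 2 ≤ x → x ≤ z → z / 2 ≤ y → y ≤ z →
      ENNReal.ofReal (c * z ^ (-(2 * s))) ≤ κ x y) {z : ℝ} (hz : 0 < z) :
    ∫⁻ u in Ioc 0 T, G u (dyadic z) ≤ ENNReal.ofReal ((M.toReal / c + T) * z ^ s) := by
  have hmeas : Measurable fun u => G u (dyadic z) :=
    Measure.measurable_measure.1 hG.measurable _ (measurableSet_dyadic _)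
  by_cases hez : (e : ℝ) ≤ z
  swap
  -- Sizes only grow and injection happens at `e`, so no mass ever lies below `e`.
  · have : ∀ u, G u (dyadic z) = 0 := fun u => by
      refine measure_mono_null (fun x hx => ?_) (hG.null {x | (x : ℝ) < e}
        (measurableSet_Iio.preimage measurable_subtype_coe) (fun x y h => ?_) (by simp) hge u)
      · have := hx.2
        simp only [mem_ofPred_eq]
        linarith
      · have := y.2.out
        simp only [mem_ofPred_eq, coe_addP] at h ⊢
        linarith
    simp [this]
  -- The mass at sizes at most `z` is lost exactly through jumps across `z`, whose indicator is `D`;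
  -- the balance bounds the integrated flux by `M`.
  let φ : PosR → ℝ≥0∞ := {x : PosR | (x : ℝ) ≤ z}.indicator 1
  let D : PosR → PosR → ℝ≥0∞ := fun x y => ({x : PosR | (x : ℝ) ≤ z}.indicator 1 x) *
    ({x : PosR | z < x}.indicator 1 (addP x y))
  have hbal := hG.balance_le φ D 1 ENNReal.one_ne_top
    (measurable_one.indicator (measurableSet_le z))
    (fun x => indicator_le_self' (fun _ _ => zero_le) x)
    (fun x y => mul_le_one' (indicator_le_self' (fun _ _ => zero_le) x)
      (indicator_le_self' (fun _ _ => zero_le) _))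
    (fun x y => by
      have := y.2.out
      simp only [φ, D, indicator_apply, mem_ofPred_eq, coe_addP, Pi.one_apply]
      by_cases h1 : (x : ℝ) ≤ z <;> by_cases h2 : z < (x : ℝ) + y
      · simp [h1, h2, not_le.2 h2]
      · simp [h1, h2, not_lt.1 h2]
      · simp [h1, not_le.2 h2]
      · exfalso; linarith) T hT le_rfl
  have hP : ∀ u, ENNReal.ofReal (c * z ^ (-(2 * s))) * G u (dyadic z) ^ 2 ≤
      pairInt (G u) (fun x y => κ x y * D x y) := by
    intro u
    have h1 : ENNReal.ofReal (c * z ^ (-(2 * s))) * G u (dyadic z) ^ 2 = pairInt (G u)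
        (fun x y => ENNReal.ofReal (c * z ^ (-(2 * s))) *
          (dyadic z).indicator 1 x * (dyadic z).indicator 1 y) := by
      unfold pairInt
      have hm := (measurable_one (α := ℝ≥0∞)).indicator (measurableSet_dyadic z)
      simp_rw [lintegral_const_mul _ hm, lintegral_indicator_one (measurableSet_dyadic z)]
      rw [lintegral_mul_const _ (hm.const_mul _), lintegral_const_mul _ hm,
        lintegral_indicator_one (measurableSet_dyadic z)]
      ring
    rw [h1]
    refine pairInt_mono _ fun x y => ?_
    by_cases hx : x ∈ dyadic z
    swap; · simp [hx]
    by_cases hy : y ∈ dyadic z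
    swap; · simp [hy]
    -- The reason for dyadic intervals: any two sizes above `z/2` have a sum above `z`.
    have h2 : z < (x : ℝ) + y := by linarith [hx.1, hy.1]
    have h3 : D x y = 1 := by simp [D, indicator_apply, hx.2, h2]
    simpa [hx, hy, h3] using hκ z hez x y hx.1.le hx.2 hy.1.le hy.2
  have hsq : ENNReal.ofReal (c * z ^ (-(2 * s))) * ∫⁻ u in Ioc 0 T, G u (dyadic z) ^ 2 ≤ M := by
    rw [← lintegral_const_mul _ (hmeas.pow_const 2)]
    refine (lintegral_mono hP).trans (le_trans (le_add_self.trans hbal) ?_)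
    refine le_trans ?_ hg
    rw [one_mul]
    gcongr
    · refine (lintegral_indicator_one (measurableSet_le z)).trans_le (measure_mono (subset_univ _))
    · refine mul_le_of_le_one_right zero_le (indicator_le_self' (fun _ _ => zero_le) _)
  have hsq' : ∫⁻ u in Ioc 0 T, G u (dyadic z) ^ 2 ≤ ENNReal.ofReal (M.toReal / c * z ^ (2 * s)) := by
    have hpos : 0 < c * z ^ (-(2 * s)) := by positivity
    have : ENNReal.ofReal (M.toReal / c * z ^ (2 * s)) = M / ENNReal.ofReal (c * z ^ (-(2 * s))) := by
      conv_rhs => rw [← ENNReal.ofReal_toReal hM]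
      rw [← ENNReal.ofReal_div_of_pos hpos, Real.rpow_neg hz.le]
      congr 1
      field_simp
    rw [this, ENNReal.le_div_iff_mul_le (Or.inl (by simpa using hpos)) (Or.inl (by simp)), mul_comm]
    exact hsq
  -- This choice gives both terms of Young's inequality the order `z^s`, the square being of order
  -- `z^(2s)`.
  set η : ℝ := z ^ (-s) with hη
  have hη0 : 0 < η := by positivity
  have hηinv : η⁻¹ = z ^ s := by rw [hη, Real.rpow_neg hz.le, inv_inv]
  calc ∫⁻ u in Ioc 0 T, G u (dyadic z)
      ≤ ∫⁻ u in Ioc 0 T, (ENNReal.ofReal η * G u (dyadic z) ^ 2 + ENNReal.ofReal η⁻¹) :=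
        lintegral_mono fun u => ENNReal_le_mul_sq_add hη0 _
    _ = ENNReal.ofReal η * (∫⁻ u in Ioc 0 T, G u (dyadic z) ^ 2) +
          ENNReal.ofReal η⁻¹ * ENNReal.ofReal T := by
        rw [lintegral_add_right _ measurable_const, lintegral_const_mul _ (hmeas.pow_const 2)]
        simp
    _ ≤ ENNReal.ofReal η * ENNReal.ofReal (M.toReal / c * z ^ (2 * s)) +
          ENNReal.ofReal η⁻¹ * ENNReal.ofReal T := by gcongr
    _ = _ := by
        have h0 : 0 ≤ M.toReal / c := by positivity
        rw [← ENNReal.ofReal_mul hη0.le, ← ENNReal.ofReal_mul (by positivity),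
          ← ENNReal.ofReal_add (by positivity) (by positivity), hηinv]
        congr 1
        rw [hη, Real.rpow_neg hz.le, two_mul, Real.rpow_add hz]
        field_simp

end SmallSizes

/-! ### Weak-* compactness and convergence of quadratic functionals. -/

section Compactness

lemma exists_lipschitz_approx {X : Type*} [PseudoMetricSpace X] {f : X → ℝ} (hf : Continuous f)
    (hs : HasCompactSupport f) (h0 : ∀ x, 0 ≤ f x) {ε : ℝ} (hε : 0 < ε) :
    ∃ f' : X → ℝ, ∃ L : ℝ, 0 ≤ L ∧ (∀ x y, |f' x - f' y| ≤ L * dist x y) ∧ (∀ x, 0 ≤ f' x) ∧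
      (∀ x, f' x ≤ f x) ∧ ∀ x, f x ≤ f' x + ε := by
  -- The approximation is the inf-convolution of `f` with `L * dist`. With `L` equal to a bound of
  -- `f` divided by the modulus `δ`, points farther than `δ` cost more than `f` itself and nearby
  -- points change `f` by less than `ε`.
  have huc : UniformContinuous f := hs.uniformContinuous_of_continuous hf
  obtain ⟨δ, hδ, hδ'⟩ := Metric.uniformContinuous_iff.1 huc ε hε
  obtain ⟨B, hB⟩ := hs.exists_bound_of_continuous hf
  have hB' : ∀ x, f x ≤ max B 0 := fun x => (le_abs_self _).trans ((hB x).trans (le_max_left _ _))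
  set L := max B 0 / δ with hL
  have hL0 : 0 ≤ L := by positivity
  have hbdd : ∀ x, BddBelow (range fun y => f y + L * dist x y) := fun x =>
    ⟨0, by rintro _ ⟨y, rfl⟩; have := h0 y; positivity⟩
  have hle : ∀ x y, (⨅ z, f z + L * dist x z) ≤ (⨅ z, f z + L * dist y z) + L * dist x y := by
    intro x y
    have : Nonempty X := ⟨x⟩
    rw [← sub_le_iff_le_add]
    refine le_ciInf fun z => ?_
    rw [sub_le_iff_le_add]
    refine (ciInf_le (hbdd x) z).trans ?_
    nlinarith [dist_triangle x y z]
  refine ⟨fun x => ⨅ y, f y + L * dist x y, L, hL0, fun x y => ?_, fun x => ?_, fun x => ?_,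
    fun x => ?_⟩
  · rw [abs_sub_le_iff]
    have h1 := hle x y
    have h2 := hle y x
    rw [dist_comm y x] at h2
    constructor <;> linarith
  · exact Real.iInf_nonneg fun y => add_nonneg (h0 y) (by positivity)
  · exact (ciInf_le (hbdd x) x).trans (by simp)
  · have : Nonempty X := ⟨x⟩
    rw [← sub_le_iff_le_add]
    refine le_ciInf fun y => ?_
    rcases lt_or_ge (dist x y) δ with h | h
    · have h1 := hδ' h
      rw [Real.dist_eq, abs_lt] at h1
      have : 0 ≤ L * dist x y := by positivity
      linarith
    · have h1 : L * δ ≤ L * dist x y := by gcongr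
      rw [hL, div_mul_cancel₀ _ hδ.ne', ← hL] at h1
      linarith [h0 y, hB' x]

/-- A pointwise limit of asymptotically equicontinuous functions on a compact interval is a uniform
limit, along any filter. -/
lemma uniform_of_pointwise {ι : Type*} {l : Filter ι} [l.NeBot] {u : ι → ℝ → ℝ} {v : ℝ → ℝ} {T : ℝ}
    (hu : ∀ t ∈ Icc 0 T, Tendsto (fun n => u n t) l (𝓝 (v t)))
    (heq : ∀ ε > 0, ∃ η > 0, ∀ᶠ n in l, ∀ s ∈ Icc 0 T, ∀ t ∈ Icc 0 T, |t - s| ≤ η →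
      |u n t - u n s| ≤ ε) :
    ContinuousOn v (Icc 0 T) ∧ ∀ ε > 0, ∀ᶠ n in l, ∀ t ∈ Icc 0 T, |u n t - v t| ≤ ε := by
  have hv : ∀ ε > 0, ∃ η > 0, (∀ᶠ n in l, ∀ s ∈ Icc 0 T, ∀ t ∈ Icc 0 T, |t - s| ≤ η →
      |u n t - u n s| ≤ ε) ∧ ∀ s ∈ Icc 0 T, ∀ t ∈ Icc 0 T, |t - s| ≤ η → |v t - v s| ≤ ε := by
    intro ε hε
    obtain ⟨η, hη, h⟩ := heq ε hε
    refine ⟨η, hη, h, fun s hs t ht hst => ?_⟩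
    exact le_of_tendsto ((hu t ht).sub (hu s hs)).abs (h.mono fun n hn => hn s hs t ht hst)
  constructor
  · rw [Metric.continuousOn_iff]
    intro s hs ε hε
    obtain ⟨η, hη, -, h⟩ := hv (ε / 2) (by positivity)
    refine ⟨η, hη, fun t ht hts => ?_⟩
    rw [Real.dist_eq] at hts ⊢
    linarith [h s hs t ht hts.le]
  · intro ε hε
    obtain ⟨η, hη, h1, h2⟩ := hv (ε / 3) (by positivity)
    obtain ⟨F, hF, hfin, hcov⟩ := (isCompact_Icc (a := (0 : ℝ)) (b := T)).finite_cover_balls hη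
    have h3 : ∀ᶠ n in l, ∀ s ∈ F, |u n s - v s| ≤ ε / 3 := by
      rw [eventually_all_finite hfin]
      intro s hs
      have := (tendsto_iff_dist_tendsto_zero.1 (hu s (hF hs))).eventually_le_const
        (show (0 : ℝ) < ε / 3 by positivity)
      simpa [Real.dist_eq] using this
    filter_upwards [h1, h3] with n hn1 hn3 t ht
    obtain ⟨s, hs, hts⟩ := mem_iUnion₂.1 (hcov ht)
    rw [Metric.mem_ball, Real.dist_eq] at hts
    have e1 := hn1 s (hF hs) t ht hts.le
    have e2 := h2 s (hF hs) t ht hts.le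
    have e3 := hn3 s hs
    rw [abs_le] at *
    constructor <;> linarith

lemma hasCompactSupport_section {X : Type*} [MetricSpace X] {φ : X → X → ℝ} (hs : HasCompactSupport (uncurry φ)) (x : X) :
    HasCompactSupport (φ x) :=
  HasCompactSupport.intro (hs.image continuous_snd) fun y hy => by
    by_contra h
    exact hy ⟨(x, y), subset_tsupport _ h, rfl⟩

/-- The sections of `φ` form a totally bounded set in the uniform norm; `0` represents the points
whose section vanishes. -/
lemma exists_finite_net {X : Type*} [MetricSpace X] {φ : X → X → ℝ} (hφ : Continuous (uncurry φ))
    (hs : HasCompactSupport (uncurry φ)) {ε : ℝ} (hε : 0 < ε) :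
    ∃ F : Set (X → ℝ), F.Finite ∧ (∀ f ∈ F, Continuous f ∧ HasCompactSupport f) ∧
      ∀ x, ∃ f ∈ F, ∀ y, |φ x y - f y| ≤ ε := by
  have huc : UniformContinuous (uncurry φ) := hs.uniformContinuous_of_continuous hφ
  obtain ⟨δ, hδ, h⟩ := Metric.uniformContinuous_iff.1 huc ε hε
  obtain ⟨S, -, hfin, hcov⟩ := (hs.image continuous_fst).finite_cover_balls hδ
  refine ⟨φ '' S ∪ {0}, (hfin.image _).union (finite_singleton _), ?_, fun x => ?_⟩
  · rintro f (⟨x, -, rfl⟩ | rfl)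
    · exact ⟨hφ.comp (Continuous.prodMk_right x), hasCompactSupport_section hs x⟩
    · exact ⟨continuous_zero, HasCompactSupport.zero⟩
  · by_cases hx : x ∈ Prod.fst '' tsupport (uncurry φ)
    · obtain ⟨z, hz, hxz⟩ := mem_iUnion₂.1 (hcov hx)
      refine ⟨φ z, Or.inl ⟨z, hz, rfl⟩, fun y => ?_⟩
      have := h (a := (x, y)) (b := (z, y)) (by simpa [Prod.dist_eq, hδ] using hxz)
      exact this.le
    · refine ⟨0, Or.inr rfl, fun y => ?_⟩
      have : φ x y = 0 := by
        by_contra h0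
        exact hx ⟨(x, y), subset_tsupport _ h0, rfl⟩
      simp [this, hε.le]

lemma abs_integral_le_of_bound {X : Type*} [MeasurableSpace X] {μ : Measure X} {M : ℝ} (hM : 0 ≤ M)
    (hμ : μ univ ≤ ENNReal.ofReal M) {f : X → ℝ} {ε : ℝ} (hε : 0 ≤ ε) (h : ∀ x, |f x| ≤ ε) :
    |∫ x, f x ∂μ| ≤ ε * M := by
  have : IsFiniteMeasure μ := ⟨hμ.trans_lt ENNReal.ofReal_lt_top⟩
  rw [← Real.norm_eq_abs]
  refine (norm_integral_le_of_norm_le_const (C := ε)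
    (Eventually.of_forall fun x => (Real.norm_eq_abs _).trans_le (h x))).trans ?_
  gcongr
  exact ENNReal.toReal_le_of_le_ofReal hM hμ

variable {X : Type*} [MetricSpace X] [MeasurableSpace X]

/-- Weak-* compactness along an ultrafilter. -/
lemma exists_ultralimit_measure [LocallyCompactSpace X] [BorelSpace X] {ι : Type*} (l : Ultrafilter ι) {μ : ι → Measure X} {M : ℝ}
    (hM : 0 ≤ M) (hμ : ∀ n, μ n univ ≤ ENNReal.ofReal M) :
    ∃ ν : Measure X, ν.Regular ∧ ν univ ≤ ENNReal.ofReal M ∧ ∀ f : X → ℝ, Continuous f →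
      HasCompactSupport f → Tendsto (fun n => ∫ x, f x ∂(μ n)) l (𝓝 (∫ x, f x ∂ν)) := by
  have hfin : ∀ n, IsFiniteMeasure (μ n) := fun n => ⟨(hμ n).trans_lt ENNReal.ofReal_lt_top⟩
  have hex : ∀ f : CompactlySupportedContinuousMap X ℝ,
      ∃ c, Tendsto (fun n => ∫ x, f x ∂(μ n)) l (𝓝 c) := by
    intro f
    obtain ⟨B, hB⟩ := f.hasCompactSupport.exists_bound_of_continuous f.continuous
    have hb : ∀ n, (∫ x, f x ∂(μ n)) ∈ Icc (-(max B 0 * M)) (max B 0 * M) := fun n =>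
      abs_le.1 (abs_integral_le_of_bound hM (hμ n) (le_max_right _ _)
        fun x => (hB x).trans (le_max_left _ _))
    -- A bounded family of reals converges along any ultrafilter. Thus one ultrafilter serves all
    -- test functions, and later all times, without extracting subsequences; the limit functional is
    -- positive and is represented by Riesz–Markov–Kakutani.
    obtain ⟨c, -, hc⟩ := isCompact_Icc.ultrafilter_le_nhds
      (l.map fun n => ∫ x, f x ∂(μ n)) (by
        rw [le_principal_iff]
        exact Eventually.of_forall (f := (l : Filter ι)) hb)
    exact ⟨c, hc⟩
  choose Λ hΛ using hex
  have hint : ∀ (f : CompactlySupportedContinuousMap X ℝ) n, Integrable f (μ n) := fun f n =>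
    f.continuous.integrable_of_hasCompactSupport f.hasCompactSupport
  let Λ' : CompactlySupportedContinuousMap X ℝ →ₚ[ℝ] ℝ := PositiveLinearMap.mk₀
    { toFun := Λ
      map_add' := fun f g => tendsto_nhds_unique (hΛ (f + g)) (by
        have := (hΛ f).add (hΛ g)
        refine this.congr fun n => ?_
        rw [← integral_add (hint f n) (hint g n)]
        rfl)
      map_smul' := fun c f => tendsto_nhds_unique (hΛ (c • f)) (by
        have := (hΛ f).const_mul c
        refine this.congr fun n => ?_
        rw [← integral_const_mul]
        rfl) }
    (fun f hf => ge_of_tendsto' (hΛ f) fun n => integral_nonneg hf)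
  have hΛ' : ∀ f, Λ' f = Λ f := fun f => rfl
  refine ⟨RealRMK.rieszMeasure Λ', inferInstance, ?_, fun f hf hs => ?_⟩
  · rw [isOpen_univ.measure_eq_iSup_isCompact]
    refine iSup₂_le fun A _ => iSup_le fun hA => ?_
    obtain ⟨f, hf1, -, hfs, hf01⟩ := exists_continuous_one_zero_of_isCompact hA isClosed_empty
      (disjoint_empty A)
    let F : CompactlySupportedContinuousMap X ℝ := ⟨f, hfs⟩
    refine (RealRMK.rieszMeasure_le_of_eq_one Λ' (f := F) (fun x => (hf01 x).1) hA hf1).trans ?_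
    refine ENNReal.ofReal_le_ofReal ?_
    rw [hΛ']
    refine le_of_tendsto' (hΛ F) fun n => ?_
    have := abs_integral_le_of_bound hM (hμ n) zero_le_one (f := F)
      (fun x => abs_le.2 ⟨by linarith [(hf01 x).1, show F x = f x from rfl], (hf01 x).2⟩)
    linarith [le_abs_self (∫ x, F x ∂(μ n))]
  · let F : CompactlySupportedContinuousMap X ℝ := ⟨⟨f, hf⟩, hs⟩
    have h1 := RealRMK.integral_rieszMeasure Λ' F
    have h2 := hΛ F
    rw [← hΛ', ← h1] at h2
    exact h2

/-- The integrals of `f` against the families `G n` are equicontinuous in time, asymptotically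
along `l`. -/
def AsympEquicontinuous {ι : Type*} (l : Filter ι) (G : ι → ℝ → Measure X) (T : ℝ) (f : X → ℝ) :
    Prop :=
  ∀ ε > 0, ∃ η > 0, ∀ᶠ n in l, ∀ s ∈ Icc 0 T, ∀ t ∈ Icc 0 T, |t - s| ≤ η →
    |∫ x, f x ∂(G n t) - ∫ x, f x ∂(G n s)| ≤ ε

variable {ι : Type*} {l : Filter ι} {G : ι → ℝ → Measure X} {T M : ℝ}

/-- Nonnegative Lipschitz functions approximate nonnegative `C_c` functions uniformly and the masses
are bounded by `M`; a signed function is split into positive and negative parts. -/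
lemma AsympEquicontinuous.of_lipschitz [BorelSpace X] (hM : 0 ≤ M)
    (hG : ∀ n t, G n t univ ≤ ENNReal.ofReal M)
    (h : ∀ f : X → ℝ, Continuous f → HasCompactSupport f → (∀ x, 0 ≤ f x) →
      (∃ L, 0 ≤ L ∧ ∀ x y, |f x - f y| ≤ L * dist x y) → AsympEquicontinuous l G T f)
    {f : X → ℝ} (hf : Continuous f) (hs : HasCompactSupport f) : AsympEquicontinuous l G T f := by
  have hfin : ∀ n t, IsFiniteMeasure (G n t) := fun n t =>
    ⟨(hG n t).trans_lt ENNReal.ofReal_lt_top⟩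
  have hcont : ∀ f' : X → ℝ, (∃ L, 0 ≤ L ∧ ∀ x y, |f' x - f' y| ≤ L * dist x y) →
      Continuous f' := fun f' ⟨L, hL, h⟩ =>
    (LipschitzWith.of_dist_le_mul (K := ⟨L, hL⟩) h).continuous
  have hpos : ∀ f : X → ℝ, Continuous f → HasCompactSupport f → (∀ x, 0 ≤ f x) →
      AsympEquicontinuous l G T f := by
    intro f hf hs h0 ε hε
    obtain ⟨f', L, hL, hLip, h0', hle, hge⟩ := exists_lipschitz_approx hf hs h0
      (ε := ε / (3 * (M + 1))) (by positivity)
    have hs' : HasCompactSupport f' := hs.mono fun x hx => by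
      intro h
      exact hx (le_antisymm ((hle x).trans h.le) (h0' x))
    have hf' := hcont f' ⟨L, hL, hLip⟩
    obtain ⟨η, hη, hev⟩ := h f' hf' hs' h0' ⟨L, hL, hLip⟩ (ε / 3) (by positivity)
    refine ⟨η, hη, hev.mono fun n hn s hs1 t ht hst => ?_⟩
    have h1 : ∀ t, |∫ x, f x ∂(G n t) - ∫ x, f' x ∂(G n t)| ≤ ε / 3 := by
      intro t
      rw [← integral_sub (hf.integrable_of_hasCompactSupport hs)
        (hf'.integrable_of_hasCompactSupport hs')]
      refine (abs_integral_le_of_bound hM (hG n t) (ε := ε / (3 * (M + 1))) (by positivity)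
        fun x => ?_).trans ?_
      · rw [abs_of_nonneg (by linarith [hle x])]
        linarith [hge x]
      · rw [div_mul_eq_mul_div, div_le_div_iff₀ (by positivity) (by positivity)]
        nlinarith
    have h2 := h1 t
    have h3 := h1 s
    have h4 := hn s hs1 t ht hst
    rw [abs_le] at *
    constructor <;> linarith
  intro ε hε
  obtain ⟨η₁, hη₁, h1⟩ := hpos (fun x => max (f x) 0) (by fun_prop)
    (hs.comp_left (g := fun y => max y 0) (by simp)) (fun x => le_max_right _ _) (ε / 2)
    (by positivity)
  obtain ⟨η₂, hη₂, h2⟩ := hpos (fun x => max (-f x) 0) (by fun_prop)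
    (hs.comp_left (g := fun y => max (-y) 0) (by simp)) (fun x => le_max_right _ _) (ε / 2)
    (by positivity)
  refine ⟨min η₁ η₂, lt_min hη₁ hη₂, ?_⟩
  filter_upwards [h1, h2] with n hn1 hn2 s hs1 t ht hst
  have h3 : ∀ t, ∫ x, f x ∂(G n t) = ∫ x, max (f x) 0 ∂(G n t) - ∫ x, max (-f x) 0 ∂(G n t) := by
    intro t
    have hi := hf.integrable_of_hasCompactSupport (μ := G n t) hs
    rw [← integral_sub hi.pos_part hi.neg_part]
    refine integral_congr_ae (Eventually.of_forall fun x => ?_)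
    simp only
    rcases le_total 0 (f x) with h | h
    · rw [max_eq_left h, max_eq_right (by linarith)]; ring
    · rw [max_eq_right h, max_eq_left (by linarith)]; ring
  have h4 := hn1 s hs1 t ht (hst.trans (min_le_left _ _))
  have h5 := hn2 s hs1 t ht (hst.trans (min_le_right _ _))
  rw [h3, h3]
  rw [abs_le] at *
  constructor <;> linarith

lemma abs_section_integral_sub_le (hM : 0 ≤ M) {μ ν : Measure X} [BorelSpace X]
    (hμ : μ univ ≤ ENNReal.ofReal M) (hν : ν univ ≤ ENNReal.ofReal M) {g f : X → ℝ} {ε : ℝ}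
    (hε : 0 ≤ ε) (hg : Continuous g) (hgs : HasCompactSupport g) (hf : Continuous f)
    (hfs : HasCompactSupport f) (hgf : ∀ y, |g y - f y| ≤ ε)
    (h : |∫ y, f y ∂μ - ∫ y, f y ∂ν| ≤ ε) :
    |∫ y, g y ∂μ - ∫ y, g y ∂ν| ≤ (2 * M + 1) * ε := by
  have : IsFiniteMeasure μ := ⟨hμ.trans_lt ENNReal.ofReal_lt_top⟩
  have : IsFiniteMeasure ν := ⟨hν.trans_lt ENNReal.ofReal_lt_top⟩
  have h1 := abs_integral_le_of_bound hM hμ hε hgf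
  have h2 := abs_integral_le_of_bound hM hν hε hgf
  rw [integral_sub (hg.integrable_of_hasCompactSupport hgs)
    (hf.integrable_of_hasCompactSupport hfs)] at h1 h2
  rw [abs_le] at *
  constructor <;> linarith

variable [BorelSpace X] [SecondCountableTopology X]

/-- Double integrals of a compactly supported continuous function are uniformly continuous for the
weak-* topology on bounded sets of measures. -/
lemma abs_pair_integral_sub_le (hM : 0 ≤ M) {φ : X → X → ℝ} (hφ : Continuous (uncurry φ))
    (hs : HasCompactSupport (uncurry φ)) {ε : ℝ} (hε : 0 < ε) :
    ∃ F : Set (X → ℝ), F.Finite ∧ (∀ f ∈ F, Continuous f ∧ HasCompactSupport f) ∧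
      ∀ μ ν : Measure X, μ univ ≤ ENNReal.ofReal M → ν univ ≤ ENNReal.ofReal M →
        (∀ f ∈ F, |∫ x, f x ∂μ - ∫ x, f x ∂ν| ≤ ε) →
        |∫ x, ∫ y, φ x y ∂μ ∂μ - ∫ x, ∫ y, φ x y ∂ν ∂ν| ≤ (2 * M + 1) * ε * M * 2 := by
  have hφ' : Continuous (uncurry fun y x => φ x y) := hφ.comp continuous_swap
  have hs' : HasCompactSupport (uncurry fun y x => φ x y) :=
    hs.comp_homeomorph (Homeomorph.prodComm X X)
  obtain ⟨F₁, hF₁, hF₁c, h₁⟩ := exists_finite_net hφ hs hε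
  obtain ⟨F₂, hF₂, hF₂c, h₂⟩ := exists_finite_net hφ' hs' hε
  refine ⟨F₁ ∪ F₂, hF₁.union hF₂, fun f hf => hf.elim (hF₁c f) (hF₂c f), fun μ ν hμ hν hF => ?_⟩
  have : IsFiniteMeasure μ := ⟨hμ.trans_lt ENNReal.ofReal_lt_top⟩
  have : IsFiniteMeasure ν := ⟨hν.trans_lt ENNReal.ofReal_lt_top⟩
  have hA : ∀ x, |∫ y, φ x y ∂μ - ∫ y, φ x y ∂ν| ≤ (2 * M + 1) * ε := by
    intro x
    obtain ⟨f, hf, hfx⟩ := h₁ x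
    exact abs_section_integral_sub_le hM hμ hν hε.le (hφ.comp (Continuous.prodMk_right x))
      (hasCompactSupport_section hs x) (hF₁c f hf).1 (hF₁c f hf).2 hfx (hF f (Or.inl hf))
  have hB : ∀ y, |∫ x, φ x y ∂μ - ∫ x, φ x y ∂ν| ≤ (2 * M + 1) * ε := by
    intro y
    obtain ⟨f, hf, hfy⟩ := h₂ y
    exact abs_section_integral_sub_le hM hμ hν hε.le (hφ'.comp (Continuous.prodMk_right y))
      (hasCompactSupport_section hs' y) (hF₂c f hf).1 (hF₂c f hf).2 hfy (hF f (Or.inr hf))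
  have hi : ∀ (ρ σ : Measure X) [IsFiniteMeasure ρ] [IsFiniteMeasure σ],
      Integrable (uncurry φ) (ρ.prod σ) := fun ρ σ _ _ => hφ.integrable_of_hasCompactSupport hs
  -- The two measures are exchanged one variable at a time; the second exchange uses Fubini, hence
  -- the net for the transposed function.
  have h3 : ∫ x, ∫ y, φ x y ∂μ ∂μ - ∫ x, ∫ y, φ x y ∂ν ∂μ =
      ∫ x, (∫ y, φ x y ∂μ - ∫ y, φ x y ∂ν) ∂μ :=
    (integral_sub (hi μ μ).integral_prod_left (hi μ ν).integral_prod_left).symm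
  have h4 : ∫ x, ∫ y, φ x y ∂ν ∂μ - ∫ x, ∫ y, φ x y ∂ν ∂ν =
      ∫ y, (∫ x, φ x y ∂μ - ∫ x, φ x y ∂ν) ∂ν := by
    rw [integral_integral_swap (hi μ ν), integral_integral_swap (hi ν ν)]
    exact (integral_sub (hi μ ν).integral_prod_right (hi ν ν).integral_prod_right).symm
  have h5 := abs_integral_le_of_bound hM hμ (by positivity) hA
  have h6 := abs_integral_le_of_bound hM hν (by positivity) hB
  rw [← h3] at h5
  rw [← h4] at h6
  rw [abs_le] at *
  constructor <;> linarith

lemma pairInt_ofReal {μ : Measure X} [IsFiniteMeasure μ] {φ : X → X → ℝ}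
    (hφ : Continuous (uncurry φ)) (hs : HasCompactSupport (uncurry φ)) (h0 : ∀ x y, 0 ≤ φ x y) :
    pairInt μ (fun x y => ENNReal.ofReal (φ x y)) = ENNReal.ofReal (∫ x, ∫ y, φ x y ∂μ ∂μ) := by
  have hi : Integrable (uncurry φ) (μ.prod μ) := hφ.integrable_of_hasCompactSupport hs
  rw [ofReal_integral_eq_lintegral_ofReal (f := fun x => ∫ y, φ x y ∂μ) hi.integral_prod_left
    (Eventually.of_forall fun x => integral_nonneg (h0 x))]
  refine lintegral_congr fun x => ?_
  rw [ofReal_integral_eq_lintegral_ofReal (f := φ x) ((hφ.comp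
    (Continuous.prodMk_right x)).integrable_of_hasCompactSupport (hasCompactSupport_section hs x))
    (Eventually.of_forall (h0 x))]

/-- Convergence of the values `a n` to `b` along `l`, expressed by inequalities. -/
def CloseTo {ι : Type*} (l : Filter ι) (a : ι → ℝ≥0∞) (b : ℝ≥0∞) : Prop :=
  ∀ ε : ℝ, 0 < ε → ∀ᶠ n in l, a n ≤ b + ENNReal.ofReal ε ∧ b ≤ a n + ENNReal.ofReal ε

/-- Time integrals of double integrals pass to the limit. -/
lemma closeTo_lintegral_pairInt (hM : 0 ≤ M) (hT : 0 ≤ T)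
    (hG : ∀ n t, G n t univ ≤ ENNReal.ofReal M)
    {g : ℝ → Measure X} (hg : ∀ t, g t univ ≤ ENNReal.ofReal M)
    (hunif : ∀ f : X → ℝ, Continuous f → HasCompactSupport f → ∀ ε > 0, ∀ᶠ n in l,
      ∀ t ∈ Icc 0 T, |∫ x, f x ∂(G n t) - ∫ x, f x ∂(g t)| ≤ ε)
    {φ : X → X → ℝ} (hφ : Continuous (uncurry φ)) (hs : HasCompactSupport (uncurry φ))
    (h0 : ∀ x y, 0 ≤ φ x y) {t : ℝ} (ht : t ∈ Icc 0 T) :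
    CloseTo l (fun n => ∫⁻ u in Ioc 0 t, pairInt (G n u) fun x y => ENNReal.ofReal (φ x y))
      (∫⁻ u in Ioc 0 t, pairInt (g u) fun x y => ENNReal.ofReal (φ x y)) := by
  have hfin : ∀ n t, IsFiniteMeasure (G n t) := fun n t =>
    ⟨(hG n t).trans_lt ENNReal.ofReal_lt_top⟩
  have hfin' : ∀ t, IsFiniteMeasure (g t) := fun t => ⟨(hg t).trans_lt ENNReal.ofReal_lt_top⟩
  intro ε hε
  set ε' := ε / (((2 * M + 1) * M * 2 + 1) * (T + 1)) with hε'
  have hε'0 : 0 < ε' := by positivity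
  obtain ⟨F, hF, hFc, hpair⟩ := abs_pair_integral_sub_le hM hφ hs hε'0
  have hev : ∀ᶠ n in l, ∀ f ∈ F, ∀ t ∈ Icc 0 T,
      |∫ x, f x ∂(G n t) - ∫ x, f x ∂(g t)| ≤ ε' := by
    rw [eventually_all_finite hF]
    exact fun f hf => hunif f (hFc f hf).1 (hFc f hf).2 ε' hε'0
  have hsmall : (2 * M + 1) * ε' * M * 2 * t ≤ ε := by
    have h1 : ((2 * M + 1) * M * 2 + 1) * (T + 1) * ε' = ε := by rw [hε']; field_simp
    have h2 : (2 * M + 1) * M * 2 * t ≤ ((2 * M + 1) * M * 2 + 1) * (T + 1) := by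
      have := ht.1
      have := ht.2
      gcongr <;> linarith
    nlinarith
  have key : ∀ A B : ℝ → ℝ, (∀ u ∈ Ioc 0 t, A u ≤ B u + (2 * M + 1) * ε' * M * 2) →
      ∫⁻ u in Ioc 0 t, ENNReal.ofReal (A u) ≤
        (∫⁻ u in Ioc 0 t, ENNReal.ofReal (B u)) + ENNReal.ofReal ε := by
    intro A B hAB
    calc ∫⁻ u in Ioc 0 t, ENNReal.ofReal (A u)
        ≤ ∫⁻ u in Ioc 0 t, (ENNReal.ofReal (B u) + ENNReal.ofReal ((2 * M + 1) * ε' * M * 2)) :=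
          setLIntegral_mono' measurableSet_Ioc fun u hu =>
            (ENNReal.ofReal_le_ofReal (hAB u hu)).trans ENNReal.ofReal_add_le
      _ = (∫⁻ u in Ioc 0 t, ENNReal.ofReal (B u)) +
            ENNReal.ofReal ((2 * M + 1) * ε' * M * 2) * ENNReal.ofReal t := by
          rw [lintegral_add_right _ measurable_const]
          simp
      _ ≤ _ := by
          rw [← ENNReal.ofReal_mul (by positivity)]
          gcongr
  filter_upwards [hev] with n hn
  have hn' : ∀ u ∈ Ioc 0 t, |∫ x, ∫ y, φ x y ∂(G n u) ∂(G n u) -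
      ∫ x, ∫ y, φ x y ∂(g u) ∂(g u)| ≤ (2 * M + 1) * ε' * M * 2 := fun u hu =>
    hpair _ _ (hG n u) (hg u) fun f hf => hn f hf u ⟨hu.1.le, hu.2.trans ht.2⟩
  simp_rw [pairInt_ofReal hφ hs h0]
  exact ⟨key _ _ fun u hu => by linarith [(abs_le.1 (hn' u hu)).2],
    key _ _ fun u hu => by linarith [(abs_le.1 (hn' u hu)).1]⟩

end Compactness

/-! ### Uniform estimates for the approximating family. -/

section Approximation

/-- The injection size of the `n`-th approximation. -/
def eps (n : ℕ) : PosR := ⟨1 / (n + 1), mem_Ioi.2 (by positivity)⟩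

/-- The truncated rate kernel of the `n`-th approximation. -/
def truncRate (K : PosR → PosR → ℝ) (γ : ℝ) (n : ℕ) (x y : PosR) : ℝ≥0∞ :=
  min (rate K x y) (ENNReal.ofReal ((eps n : ℝ) ^ (γ - 1)))

/-- Approximate solutions with vanishing injection size and vanishing error. -/
def IsApproximation (K : PosR → PosR → ℝ) (γ T : ℝ) (g₀ : Measure PosR)
    (G : ℕ → ℝ → Measure PosR) : Prop :=
  ∀ n, ApproxSol addP (truncRate K γ n) (eps n) (g₀.restrict {x | (eps n : ℝ) ≤ x}) T
    (ENNReal.ofReal (1 / (n + 1))) (G n)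

lemma coe_eps (n : ℕ) : (eps n : ℝ) = 1 / (n + 1) := rfl

variable {K : PosR → PosR → ℝ} {γ lam T : ℝ} {g₀ : Measure PosR} {G : ℕ → ℝ → Measure PosR}

lemma KernelRegularity.continuous_rate (hK : KernelRegularity K γ lam) :
    Continuous fun p : PosR × PosR => K p.1 p.2 / p.2 :=
  hK.continuous.div (by fun_prop) fun p => p.2.2.out.ne'

lemma KernelRegularity.measurable_rate (hK : KernelRegularity K γ lam) :
    Measurable (uncurry (rate K)) :=
  hK.continuous_rate.measurable.ennreal_ofReal

lemma KernelRegularity.measurable_truncRate (hK : KernelRegularity K γ lam) (n : ℕ) :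
    Measurable (uncurry (truncRate K γ n)) :=
  hK.measurable_rate.min measurable_const

lemma exists_isApproximation (hK : KernelRegularity K γ lam) (hT : 0 < T) [IsFiniteMeasure g₀] :
    ∃ G, IsApproximation K γ T g₀ G := by
  have h : ∀ n : ℕ, ∃ G, ApproxSol addP (truncRate K γ n) (eps n)
      (g₀.restrict {x | (eps n : ℝ) ≤ x}) T (ENNReal.ofReal (1 / (n + 1))) G := fun n =>
    exists_approxSol measurable_addP (hK.measurable_truncRate n) ENNReal.ofReal_ne_top
      (fun x y => min_le_right _ _) _ _ hT (by simp; positivity)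
  choose G hG using h
  exact ⟨G, hG⟩

/-- A bound for the total mass of the approximations. -/
def massBound (g₀ : Measure PosR) (T : ℝ) : ℝ := (g₀ univ).toReal + T + 1

lemma massBound_nonneg (hT : 0 ≤ T) : 0 ≤ massBound g₀ T := by
  unfold massBound
  positivity

lemma ofReal_massBound (hT : 0 ≤ T) [IsFiniteMeasure g₀] :
    ENNReal.ofReal (massBound g₀ T) = g₀ univ + ENNReal.ofReal T + 1 := by
  rw [massBound, ENNReal.ofReal_add (by positivity) zero_le_one,
    ENNReal.ofReal_add (by positivity) hT, ENNReal.ofReal_toReal (measure_ne_top _ _)]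
  simp

namespace IsApproximation

variable (hG : IsApproximation K γ T g₀ G)

include hG in
lemma mass_le [IsFiniteMeasure g₀] (hT : 0 ≤ T) (n : ℕ) (t : ℝ) :
    G n t univ ≤ ENNReal.ofReal (massBound g₀ T) := by
  rw [ofReal_massBound hT]
  refine ((hG n).mass t).trans (le_add_right ?_)
  gcongr
  exact Measure.restrict_le_self

include hG in
lemma isFiniteMeasure [IsFiniteMeasure g₀] (hT : 0 ≤ T) (n : ℕ) (t : ℝ) :
    IsFiniteMeasure (G n t) :=
  ⟨(hG.mass_le hT n t).trans_lt ENNReal.ofReal_lt_top⟩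

include hG in
-- The dissipation estimate with `s = (1 - γ) / 2`; the bound does not depend on `n`.
lemma dyadic_le (hK : KernelRegularity K γ lam) (hγ : γ < 1) (hT : 0 ≤ T) [IsFiniteMeasure g₀] :
    ∃ B, 0 ≤ B ∧ ∀ n z, 0 < z →
      ∫⁻ u in Ioc 0 T, G n u (dyadic z) ≤ ENNReal.ofReal (B * z ^ ((1 - γ) / 2)) := by
  obtain ⟨c₁, c₂, hc₁, -, hb⟩ := hK.bounds
  obtain ⟨c, hc, hlow⟩ := kernel_lower hc₁ (fun x y => (hb x y).1)
  refine ⟨massBound g₀ T / c + T, by have := massBound_nonneg (g₀ := g₀) hT; positivity,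
    fun n z hz => ?_⟩
  have h := dyadic_bound hc hT (hG n) (M := ENNReal.ofReal (massBound g₀ T)) (s := (1 - γ) / 2)
    ENNReal.ofReal_ne_top ?_ ?_ ?_ hz
  · rwa [ENNReal.toReal_ofReal (massBound_nonneg hT)] at h
  -- The summand `1` in `massBound` absorbs the error `1 / (n + 1)` of the scheme.
  · rw [ofReal_massBound hT]
    gcongr
    · exact Measure.restrict_le_self
    · rw [← ENNReal.ofReal_one]
      refine ENNReal.ofReal_le_ofReal ?_
      rw [div_le_one (by positivity)]
      linarith [(Nat.cast_nonneg n : (0 : ℝ) ≤ n)]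
  · have hms : MeasurableSet {x : PosR | (x : ℝ) < eps n} :=
      measurableSet_Iio.preimage measurable_subtype_coe
    rw [Measure.restrict_apply hms]
    convert measure_empty (μ := g₀)
    ext x
    simp
  · intro w hw x y hx1 hx2 hy1 hy2
    have := hlow (eps n) w (eps n).2.out hw (by linarith) x y hx1 hx2 hy1 hy2
    rw [show γ + lam + -lam - 1 = γ - 1 by ring] at this
    rwa [show -(2 * ((1 - γ) / 2)) = γ - 1 by ring]

include hG in
lemma smallWeight_le (hK : KernelRegularity K γ lam) (hγ : γ < 1) (hT : 0 ≤ T) [IsFiniteMeasure g₀]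
    {p : ℝ} (hp : p ≤ 0) (hps : 0 < p + (1 - γ) / 2) :
    ∃ B, 0 ≤ B ∧ ∀ n δ, 0 < δ → ∫⁻ u in Ioc 0 T, ∫⁻ x, smallWeight p δ x ∂(G n u) ≤
      ENNReal.ofReal (B * δ ^ (p + (1 - γ) / 2)) := by
  obtain ⟨B, hB, h⟩ := hG.dyadic_le hK hγ hT
  have h1 : (1 / 2 : ℝ) ^ (p + (1 - γ) / 2) < 1 :=
    Real.rpow_lt_one (by norm_num) (by norm_num) hps
  have h2 : 0 ≤ (1 - (1 / 2 : ℝ) ^ (p + (1 - γ) / 2))⁻¹ := inv_nonneg.2 (by linarith)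
  exact ⟨B * 2 ^ (-p) * (1 - (1 / 2) ^ (p + (1 - γ) / 2))⁻¹, by positivity, fun n δ hδ =>
    lintegral_smallWeight_le (hG n).measurable hB hp hps (h n) hδ⟩

include hG in
/-- At positive times, the approximations carry uniformly little mass at small sizes. -/
lemma small_mass (hK : KernelRegularity K γ lam) (hγ : γ < 1) (hT : 0 ≤ T) [IsFiniteMeasure g₀]
    {t : ℝ} (ht0 : 0 < t) (ht : t ≤ T) {ε : ℝ} (hε : 0 < ε) :
    ∃ δ₀, 0 < δ₀ ∧ ∃ N : ℕ, ∀ n ≥ N, ∀ δ ≤ δ₀, G n t {x | (x : ℝ) ≤ δ} ≤ ENNReal.ofReal ε := by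
  obtain ⟨B, hB, hsm⟩ := hG.smallWeight_le hK hγ hT (p := 0) le_rfl (by linarith)
  rw [zero_add] at hsm
  -- A bound integrated in time becomes a bound at time `t` by averaging over the window `(t - τ,
  -- t]`. The positivity of `t` makes room for it, and `τ ≤ ε/3` limits the mass injected in it.
  set τ := min t (ε / 3) with hτ
  have hτ0 : 0 < τ := by positivity
  obtain ⟨δ₀, hδ₀, hδB⟩ : ∃ δ₀ : ℝ, 0 < δ₀ ∧ B * δ₀ ^ ((1 - γ) / 2) ≤ τ * (ε / 3) := by
    have hcont : Tendsto (fun δ : ℝ => B * δ ^ ((1 - γ) / 2)) (𝓝[>] 0) (𝓝 (B * 0)) := by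
      refine (Tendsto.const_mul B ?_)
      have := (Real.continuousAt_rpow_const 0 ((1 - γ) / 2) (Or.inr (by linarith))).tendsto
      rw [Real.zero_rpow (by linarith)] at this
      exact this.mono_left nhdsWithin_le_nhds
    rw [mul_zero] at hcont
    have h1 := hcont.eventually_le_const (show 0 < τ * (ε / 3) by positivity)
    obtain ⟨δ, h2, h3⟩ := (h1.and self_mem_nhdsWithin).exists
    exact ⟨δ, h3, h2⟩
  obtain ⟨N, hN⟩ := exists_nat_gt (3 / ε)
  refine ⟨δ₀, hδ₀, N, fun n hn δ hδ => ?_⟩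
  have hn' : 1 / ((n : ℝ) + 1) ≤ ε / 3 := by
    have : (N : ℝ) ≤ n := by exact_mod_cast hn
    rw [div_le_div_iff₀ (by positivity) (by norm_num)]
    rw [div_lt_iff₀ hε] at hN
    nlinarith
  set A := {x : PosR | (x : ℝ) ≤ δ₀} with hA
  have hsub : {x : PosR | (x : ℝ) ≤ δ} ⊆ A := fun x (hx : (x : ℝ) ≤ δ) => hx.trans hδ
  refine (measure_mono hsub).trans ?_
  have hAm : MeasurableSet A := measurableSet_le δ₀
  -- Coagulation only removes mass from small sizes, so from `s` to `t` their mass grows by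
  -- injection and scheme error alone, at most `ε/3` each.
  have hstep : ∀ s ∈ Ioc (t - τ) t, G n t A ≤ G n s A + ENNReal.ofReal (ε / 3 + ε / 3) := by
    intro s hs
    have hs0 : 0 ≤ s := by linarith [hs.1, min_le_left t (ε / 3)]
    have h := (hG n).upper (A.indicator 1) (fun _ _ => 0) 1 ENNReal.one_ne_top
      (measurable_one.indicator hAm) (fun x => indicator_le_self' (fun _ _ => zero_le) x)
      (fun _ _ => zero_le) (fun x y => by
        have := y.2.out
        by_cases hx : x ∈ A
        · simpa [hx] using indicator_le_self' (f := (1 : PosR → ℝ≥0∞)) (fun _ _ => zero_le) _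
        · have : addP x y ∉ A := fun h => hx (by
            simp only [hA, mem_ofPred_eq, coe_addP] at h ⊢
            linarith)
          simp [this]) s t hs0 hs.2 ht
    simp only [lintegral_indicator_one hAm, mul_zero, one_mul] at h
    refine h.trans ?_
    rw [ENNReal.ofReal_add (by positivity) (by positivity), ← add_assoc]
    gcongr
    · simp [pairInt]
    · linarith [hs.1, min_le_right t (ε / 3)]
  have hint : ENNReal.ofReal τ * G n t A ≤ ENNReal.ofReal τ * ENNReal.ofReal ε := by
    calc ENNReal.ofReal τ * G n t A = ∫⁻ _ in Ioc (t - τ) t, G n t A := by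
          simp [mul_comm]
      _ ≤ ∫⁻ s in Ioc (t - τ) t, (G n s A + ENNReal.ofReal (ε / 3 + ε / 3)) :=
          setLIntegral_mono' measurableSet_Ioc hstep
      _ = (∫⁻ s in Ioc (t - τ) t, G n s A) +
            ENNReal.ofReal (ε / 3 + ε / 3) * ENNReal.ofReal τ := by
          rw [lintegral_add_right _ measurable_const]
          simp
      _ ≤ ENNReal.ofReal (τ * (ε / 3)) + ENNReal.ofReal (ε / 3 + ε / 3) * ENNReal.ofReal τ := by
          gcongr
          refine le_trans ?_ ((hsm n δ₀ hδ₀).trans (ENNReal.ofReal_le_ofReal hδB))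
          have h0 : 0 ≤ t - τ := by linarith [min_le_left t (ε / 3)]
          refine (lintegral_mono_set (Ioc_subset_Ioc h0 ht)).trans_eq
            (lintegral_congr fun u => ?_)
          rw [← lintegral_indicator_one hAm]
          refine lintegral_congr fun x => ?_
          simp [smallWeight, hA, indicator]
      _ = _ := by
          rw [← ENNReal.ofReal_mul (by positivity), ← ENNReal.ofReal_mul hτ0.le,
            ← ENNReal.ofReal_add (by positivity) (by positivity)]
          congr 1
          ring
  exact (ENNReal.mul_le_mul_iff_right (by simpa using hτ0) ENNReal.ofReal_ne_top).1 hint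

include hG in
/-- The part of the flux outside compact subsets of `(0, ∞)²` is uniformly small. -/
lemma flux_tail (hK : KernelRegularity K γ lam) (hexp : |γ + 2 * lam| < 1) (hγ : γ < 1)
    (hT : 0 ≤ T) [IsFiniteMeasure g₀] {α β : ℝ} (hα : 0 < α) (hαβ : α < β) {ε : ℝ} (hε : 0 < ε) :
    ∃ m₁ : ℕ, ∀ m ≥ m₁, ∀ n s t, 0 ≤ s → t ≤ T →
      (∫⁻ u in Ioc s t, pairInt (G n u) fun x y =>
        truncRate K γ n x y * ENNReal.ofReal (crossed α β x y)) ≤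
      (∫⁻ u in Ioc s t, pairInt (G n u) fun x y => truncRate K γ n x y *
        ENNReal.ofReal (crossed α β x y * (cutoff (m + 1) x * cutoff (m + 1) y))) +
        ENNReal.ofReal ε := by
  obtain ⟨c₁, c₂, hc₁, hc₁₂, hb⟩ := hK.bounds
  set a := γ + lam with ha
  set b := -lam with hb'
  -- The weight exponent is the worst of the two kernel powers, capped at `0` for the dyadic sum.
  -- That `p + (1-γ)/2 > 0` and `q < 1` is where `|γ + 2λ| < 1` enters.
  set p := min (min a b) 0 with hp
  set q := max a b with hq
  have hexp' := abs_lt.1 hexp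
  have hq1 : q < 1 := max_lt (by linarith) (by linarith)
  have hps : 0 < p + (1 - γ) / 2 := by
    rw [← sub_neg_eq_add, sub_pos]
    exact lt_min (lt_min (by linarith) (by linarith)) (by linarith)
  obtain ⟨C, hC, m₀, hm₀, htail⟩ := rate_crossed_tail (K := K) (a := a) (b := b) (c₂ := c₂) (p := p)
    (q := q) (by linarith) (fun x y => (hb x y).2) ((min_le_left _ _).trans (min_le_left _ _))
    ((min_le_left _ _).trans (min_le_right _ _)) (le_max_left _ _) (le_max_right _ _) hq1 hα hαβ
  obtain ⟨B, hB, hsm⟩ := hG.smallWeight_le hK hγ hT (p := p) (min_le_right _ _) hps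
  set θ := p + (1 - γ) / 2 with hθ
  set M := massBound g₀ T with hM
  have hM0 : 0 ≤ M := massBound_nonneg hT
  have hlim : Tendsto (fun m : ℕ => C * (M * (B * (1 / ((m : ℝ) + 1)) ^ θ +
      B * (1 / ((m : ℝ) + 1)) ^ θ + ((m : ℝ) + 1) ^ (q - 1) * (B * β ^ θ)))) atTop (𝓝 0) := by
    have hm : Tendsto (fun m : ℕ => (m : ℝ) + 1) atTop atTop :=
      tendsto_atTop_add_const_right _ _ tendsto_natCast_atTop_atTop
    have h1 : Tendsto (fun m : ℕ => (1 / ((m : ℝ) + 1)) ^ θ) atTop (𝓝 0) := by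
      have := (Real.continuousAt_rpow_const 0 θ (Or.inr hps.le)).tendsto.comp
        (tendsto_const_nhds (x := (1 : ℝ)).div_atTop hm)
      rw [Real.zero_rpow hps.ne'] at this
      exact this
    have h2 : Tendsto (fun m : ℕ => ((m : ℝ) + 1) ^ (q - 1)) atTop (𝓝 0) := by
      have := (tendsto_rpow_neg_atTop (y := 1 - q) (by linarith)).comp hm
      rw [neg_sub] at this
      exact this
    have := ((((h1.const_mul B).add (h1.const_mul B)).add
      (h2.mul_const (B * β ^ θ))).const_mul M).const_mul C
    simpa using this
  obtain ⟨m₁, hm₁⟩ := ((hlim.eventually_le_const hε).and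
    (eventually_ge_atTop ⌈m₀⌉₊)).exists_forall_of_atTop
  refine ⟨m₁, fun m hm n s t hs ht => ?_⟩
  obtain ⟨hsmall, hmm₀⟩ := hm₁ m hm
  have hmm : m₀ ≤ (m : ℝ) + 1 := by
    have := Nat.le_ceil m₀
    have h3 : (⌈m₀⌉₊ : ℝ) ≤ m := by exact_mod_cast hmm₀
    linarith
  set S : ℝ → ℝ → ℝ≥0∞ := fun δ u => ∫⁻ x, smallWeight p δ x ∂(G n u) with hS
  have hSm : ∀ δ, Measurable (S δ) := fun δ =>
    measurable_lintegral_family (hG n).measurable ENNReal.ofReal_ne_top (hG.mass_le hT n)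
      (F := fun _ => smallWeight p δ) ((measurable_smallWeight p δ).comp measurable_snd)
  set δ := 1 / ((m : ℝ) + 1) with hδ
  set R : ℝ → ℝ≥0∞ := fun u => ENNReal.ofReal C * (ENNReal.ofReal M *
    (S δ u + S δ u + ENNReal.ofReal (((m : ℝ) + 1) ^ (q - 1)) * S β u)) with hR
  have hm1 : Measurable fun u => S δ u + S δ u := (hSm δ).add (hSm δ)
  have hm2 : Measurable fun u => S δ u + S δ u + ENNReal.ofReal (((m : ℝ) + 1) ^ (q - 1)) * S β u :=
    hm1.add ((hSm β).const_mul _)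
  have hRm : Measurable R := (hm2.const_mul _).const_mul _
  have hpt : ∀ u, (pairInt (G n u) fun x y =>
        truncRate K γ n x y * ENNReal.ofReal (crossed α β x y)) ≤
      (pairInt (G n u) fun x y => truncRate K γ n x y *
        ENNReal.ofReal (crossed α β x y * (cutoff (m + 1) x * cutoff (m + 1) y))) + R u := by
    intro u
    have := hG.isFiniteMeasure hT n u
    have h1 := measurable_smallWeight p δ
    have h2 := measurable_smallWeight p β
    have hX := (continuous_crossed α β).measurable
    have hc := (continuous_cutoff ((m : ℝ) + 1)).measurable
    refine (pairInt_mono _ fun x y => htail _ hmm x y _ (min_le_left _ _)).trans ?_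
    rw [pairInt_add _ ((hK.measurable_truncRate n).mul ((hX.mul
        ((hc.comp measurable_fst).mul (hc.comp measurable_snd))).ennreal_ofReal)),
      pairInt_const_mul _ _ (((h1.comp measurable_fst).add (h1.comp measurable_snd)).add
        ((h2.comp measurable_fst).const_mul _)),
      pairInt_add (F := fun x y => smallWeight p δ x + smallWeight p δ y) _
        ((h1.comp measurable_fst).add (h1.comp measurable_snd)),
      pairInt_add (F := fun x _ => smallWeight p δ x) _ (h1.comp measurable_fst), pairInt_left _ h1, pairInt_right,
      pairInt_const_mul (F := fun x _ => smallWeight p β x) _ _ (h2.comp measurable_fst), pairInt_left _ h2]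
    refine add_le_add_right ?_ _
    rw [hR]
    simp only
    gcongr
    calc _ = G n u univ * (S δ u + S δ u + ENNReal.ofReal (((m : ℝ) + 1) ^ (q - 1)) * S β u) := by
          simp only [hS]
          ring
      _ ≤ _ := by
        gcongr
        exact hG.mass_le hT n u
  refine (lintegral_mono hpt).trans ?_
  rw [lintegral_add_right _ hRm]
  refine add_le_add_right ?_ _
  calc ∫⁻ u in Ioc s t, R u ≤ ∫⁻ u in Ioc 0 T, R u := lintegral_mono_set (Ioc_subset_Ioc hs ht)
    _ = ENNReal.ofReal C * (ENNReal.ofReal M * ((∫⁻ u in Ioc 0 T, S δ u) +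
          (∫⁻ u in Ioc 0 T, S δ u) +
          ENNReal.ofReal (((m : ℝ) + 1) ^ (q - 1)) * ∫⁻ u in Ioc 0 T, S β u)) := by
        rw [hR, lintegral_const_mul _ (hm2.const_mul _), lintegral_const_mul _ hm2,
          lintegral_add_left hm1, lintegral_add_left (hSm δ), lintegral_const_mul _ (hSm β)]
    _ ≤ ENNReal.ofReal C * (ENNReal.ofReal M * (ENNReal.ofReal (B * δ ^ θ) +
          ENNReal.ofReal (B * δ ^ θ) +
          ENNReal.ofReal (((m : ℝ) + 1) ^ (q - 1)) * ENNReal.ofReal (B * β ^ θ))) := by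
        have h3 := hsm n δ (by positivity)
        have h4 := hsm n β (hα.trans hαβ)
        gcongr
    _ ≤ ENNReal.ofReal ε := by
        have : 0 ≤ β := (hα.trans hαβ).le
        rw [← ENNReal.ofReal_mul (by positivity), ← ENNReal.ofReal_add (by positivity)
          (by positivity), ← ENNReal.ofReal_add (by positivity) (by positivity),
          ← ENNReal.ofReal_mul hM0, ← ENNReal.ofReal_mul hC]
        exact ENNReal.ofReal_le_ofReal hsmall

end IsApproximation

/-- The truncated integrand of the flux averaged over `(α, β)`. -/
def truncFlux (K : PosR → PosR → ℝ) (α β m : ℝ) (x y : PosR) : ℝ :=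
  K x y / y * (crossed α β x y * (cutoff m x * cutoff m y))

lemma KernelRegularity.truncFlux_nonneg (hK : KernelRegularity K γ lam) (α β m : ℝ) (x y : PosR) :
    0 ≤ truncFlux K α β m x y :=
  mul_nonneg (div_nonneg (hK.nonneg x y) y.2.out.le) (mul_nonneg (crossed_nonneg α β x y)
    (mul_nonneg (cutoff_nonneg m x) (cutoff_nonneg m y)))

lemma KernelRegularity.continuous_truncFlux (hK : KernelRegularity K γ lam) (α β m : ℝ) :
    Continuous (uncurry (truncFlux K α β m)) :=
  hK.continuous_rate.mul ((continuous_crossed α β).mul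
    (((continuous_cutoff m).comp continuous_fst).mul ((continuous_cutoff m).comp continuous_snd)))

lemma hasCompactSupport_truncFlux (α β : ℝ) {m : ℝ} (hm : 0 < m) :
    HasCompactSupport (uncurry (truncFlux K α β m)) := by
  refine HasCompactSupport.intro ((hasCompactSupport_cutoff hm).prod (hasCompactSupport_cutoff hm))
    fun q hq => ?_
  by_contra h
  have h' : K q.1 q.2 / q.2 * (crossed α β q.1 q.2 * (cutoff m q.1 * cutoff m q.2)) ≠ 0 := h
  simp only [mul_ne_zero_iff] at h'
  exact hq ⟨subset_tsupport _ h'.2.2.1, subset_tsupport _ h'.2.2.2⟩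

lemma rate_mul_cutoff (α β m : ℝ) (x y : PosR) :
    rate K x y * ENNReal.ofReal (crossed α β x y * (cutoff m x * cutoff m y)) =
      ENNReal.ofReal (truncFlux K α β m x y) := by
  rw [rate, truncFlux, ENNReal.ofReal_mul' (mul_nonneg (crossed_nonneg α β x y)
    (mul_nonneg (cutoff_nonneg m x) (cutoff_nonneg m y)))]

lemma tendsto_truncation (hγ : γ < 1) :
    Tendsto (fun n : ℕ => (eps n : ℝ) ^ (γ - 1)) atTop atTop := by
  have h1 : Tendsto (fun n : ℕ => (n : ℝ) + 1) atTop atTop :=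
    tendsto_atTop_add_const_right _ _ tendsto_natCast_atTop_atTop
  refine ((tendsto_rpow_atTop (y := 1 - γ) (by linarith)).comp h1).congr fun n => ?_
  rw [coe_eps, one_div, Real.inv_rpow (by positivity), ← Real.rpow_neg (by positivity)]
  simp

/-- `K / y` is bounded on the compact support of the cutoffs, while the truncation level tends to
infinity. -/
lemma KernelRegularity.eventually_truncRate_eq (hK : KernelRegularity K γ lam) (hγ : γ < 1)
    (α β : ℝ) {m : ℝ} (hm : 0 < m) :
    ∀ᶠ n in atTop, ∀ x y, truncRate K γ n x y *
      ENNReal.ofReal (crossed α β x y * (cutoff m x * cutoff m y)) =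
        ENNReal.ofReal (truncFlux K α β m x y) := by
  have hcomp := (isCompact_sizeInterval (u := 1 / (2 * m)) (by positivity) (2 * m))
  obtain ⟨B, hB⟩ := (hcomp.prod hcomp).exists_bound_of_continuousOn
    hK.continuous_rate.continuousOn
  filter_upwards [(tendsto_truncation hγ).eventually_ge_atTop B] with n hn x y
  rw [← rate_mul_cutoff]
  by_cases hc : cutoff m x ≠ 0 ∧ cutoff m y ≠ 0
  · congr 1
    refine min_eq_left (ENNReal.ofReal_le_ofReal (le_trans ?_ hn))
    exact (le_abs_self _).trans
      (hB (x, y) ⟨mem_of_cutoff_ne_zero hm hc.1, mem_of_cutoff_ne_zero hm hc.2⟩)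
  · have : cutoff m x * cutoff m y = 0 := by
      by_contra h
      exact hc (mul_ne_zero_iff.1 h)
    simp [this]

end Approximation

/-! ### Equicontinuity in time and existence of a limit. -/

section Limit

variable {K : PosR → PosR → ℝ} {γ lam T : ℝ} {g₀ : Measure PosR} {G : ℕ → ℝ → Measure PosR}

instance locallyCompactSpace_posR : LocallyCompactSpace PosR := isOpen_Ioi.locallyCompactSpace

lemma exists_support_bounds {f : PosR → ℝ} (hs : HasCompactSupport f) :
    ∃ α β : ℝ, 0 < α ∧ α < β ∧ ∀ x : PosR, f x ≠ 0 → α < x ∧ x < β := by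
  obtain ⟨B₁, h₁⟩ := IsCompact.exists_bound_of_continuousOn (f := fun x : PosR => (x : ℝ)) hs
    continuous_subtype_val.continuousOn
  obtain ⟨B₂, h₂⟩ := IsCompact.exists_bound_of_continuousOn (f := fun x : PosR => 1 / (x : ℝ)) hs
    (continuous_const.div continuous_subtype_val fun x => x.2.out.ne').continuousOn
  set B := max (max B₁ B₂) 0 + 2 with hB
  have hB2 : 2 ≤ B := by rw [hB]; linarith [le_max_right (max B₁ B₂) 0]
  have hB0 : 0 < B := by linarith
  refine ⟨1 / B, B, by positivity, ?_, fun x hx => ?_⟩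
  · rw [div_lt_iff₀ hB0]
    nlinarith
  · have hx0 := x.2.out
    have hxs := subset_tsupport f hx
    have e1 := (le_abs_self _).trans (h₁ x hxs)
    have e2 := (le_abs_self _).trans (h₂ x hxs)
    have e3 := (le_max_left B₁ B₂).trans (le_max_left _ 0)
    have e4 := (le_max_right B₁ B₂).trans (le_max_left _ 0)
    constructor
    · rw [div_lt_comm₀ hB0 hx0]
      linarith
    · linarith

/-- Since `f` vanishes outside `(α, β)`, it is unchanged when its argument is clamped to `[α, β]`,
and `crossed` is the distance between the clamped sizes. Flux bounds thus control the variation of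
`∫ f` in time. -/
lemma abs_sub_le_crossed {f : PosR → ℝ} {α β L : ℝ} (hα : 0 < α) (hαβ : α < β)
    (hf : ∀ x : PosR, f x ≠ 0 → α < x ∧ x < β) (hL : ∀ x y, |f x - f y| ≤ L * dist x y)
    (x y : PosR) : |f (addP x y) - f x| ≤ L * crossed α β x y := by
  let c : PosR → PosR := fun x => ⟨clamp α β x, mem_Ioi.2 (hα.trans_le (le_max_left _ _))⟩
  have hc : ∀ x, f x = f (c x) := by
    intro x
    rcases le_total (x : ℝ) α with h | h
    · have hcx : (c x : ℝ) = α := by simp [c, clamp, h]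
      rw [by_contra fun h0 => absurd (hf x h0).1 (not_lt.2 h),
        by_contra fun h0 => absurd (hf (c x) h0).1 (by rw [hcx]; exact lt_irrefl _)]
    rcases le_total (x : ℝ) β with h' | h'
    · congr 1
      ext
      simp [c, clamp, h, h']
    · have hcx : (c x : ℝ) = β := by simp [c, clamp, h', hαβ.le]
      rw [by_contra fun h0 => absurd (hf x h0).2 (not_lt.2 h'),
        by_contra fun h0 => absurd (hf (c x) h0).2 (by rw [hcx]; exact lt_irrefl _)]
  rw [hc (addP x y), hc x]
  refine (hL _ _).trans_eq ?_
  congr 1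
  rw [Subtype.dist_eq, Real.dist_eq]
  exact abs_of_nonneg (crossed_nonneg α β x y)

lemma ofReal_integral {μ : Measure PosR} [IsFiniteMeasure μ] {f : PosR → ℝ} (hf : Continuous f)
    (hs : HasCompactSupport f) (h0 : ∀ x, 0 ≤ f x) :
    ENNReal.ofReal (∫ x, f x ∂μ) = ∫⁻ x, ENNReal.ofReal (f x) ∂μ :=
  ofReal_integral_eq_lintegral_ofReal (hf.integrable_of_hasCompactSupport hs)
    (Eventually.of_forall h0)

namespace IsApproximation

variable (hG : IsApproximation K γ T g₀ G)

include hG in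
-- The part of the flux on a compact set has a bounded integrand, hence is linear in `t - s`; the
-- rest is below `ε` uniformly.
lemma flux_increment (hK : KernelRegularity K γ lam) (hexp : |γ + 2 * lam| < 1) (hγ : γ < 1)
    (hT : 0 ≤ T) [IsFiniteMeasure g₀] {α β : ℝ} (hα : 0 < α) (hαβ : α < β) {ε : ℝ} (hε : 0 < ε) :
    ∃ C, 0 ≤ C ∧ ∀ n s t, 0 ≤ s → s ≤ t → t ≤ T →
      (∫⁻ u in Ioc s t, pairInt (G n u) fun x y =>
        truncRate K γ n x y * ENNReal.ofReal (crossed α β x y)) ≤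
      ENNReal.ofReal (C * (t - s) + ε) := by
  obtain ⟨m, hm⟩ := hG.flux_tail hK hexp hγ hT hα hαβ hε
  have hm0 : (0 : ℝ) < (m : ℝ) + 1 := by positivity
  obtain ⟨B, hB⟩ := (hasCompactSupport_truncFlux (K := K) α β hm0).exists_bound_of_continuous
    (hK.continuous_truncFlux α β _)
  set M := massBound g₀ T with hM
  have hM0 : 0 ≤ M := massBound_nonneg hT
  refine ⟨max B 0 * M * M, by positivity, fun n s t hs hst ht => ?_⟩
  refine (hm m le_rfl n s t hs ht).trans ?_
  rw [ENNReal.ofReal_add (by have := sub_nonneg.2 hst; positivity) hε.le]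
  refine add_le_add_left ?_ _
  calc _ ≤ ∫⁻ u in Ioc s t, ENNReal.ofReal (max B 0) * ENNReal.ofReal M * ENNReal.ofReal M := by
        refine lintegral_mono fun u => pairInt_le_const (fun x y => ?_) (hG.mass_le hT n u)
        refine (mul_le_mul_left (min_le_left _ _) _).trans ?_
        rw [rate_mul_cutoff]
        exact ENNReal.ofReal_le_ofReal
          ((le_abs_self _).trans ((hB (x, y)).trans (le_max_left _ _)))
    _ = _ := by
        rw [← ENNReal.ofReal_mul (by positivity), ← ENNReal.ofReal_mul (by positivity),
          lintegral_const, Measure.restrict_apply MeasurableSet.univ, univ_inter,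
          Real.volume_Ioc, ← ENNReal.ofReal_mul (by positivity)]

include hG in
lemma asympEquicontinuous (hK : KernelRegularity K γ lam) (hexp : |γ + 2 * lam| < 1) (hγ : γ < 1)
    (hT : 0 ≤ T) [IsFiniteMeasure g₀] {f : PosR → ℝ} (hf : Continuous f)
    (hs : HasCompactSupport f) : AsympEquicontinuous atTop G T f := by
  refine AsympEquicontinuous.of_lipschitz (massBound_nonneg hT) (hG.mass_le hT) ?_ hf hs
  rintro f hf hs h0 ⟨L, hL0, hL⟩ ε hε
  obtain ⟨α, β, hα, hαβ, hsupp⟩ := exists_support_bounds hs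
  obtain ⟨C, hC, hinc⟩ := hG.flux_increment hK hexp hγ hT hα hαβ
    (show 0 < ε / (3 * (L + 1)) by positivity)
  obtain ⟨Bf, hBf⟩ := hs.exists_bound_of_continuous hf
  -- One constant must bound both the test function and its gain, as the approximate equation
  -- requires; `η` and `N` then make each error at most `ε/3`.
  set A := max Bf 0 + L * (β - α) with hA
  have hA1 : 0 ≤ L * (β - α) := mul_nonneg hL0 (by linarith)
  have hA0 : 0 ≤ A := by positivity
  set η := ε / (3 * (L * C + A + 1)) with hη
  have hη0 : 0 < η := by positivity
  obtain ⟨N, hN⟩ := exists_nat_gt (3 * A / ε)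
  refine ⟨η, hη0, ?_⟩
  filter_upwards [eventually_ge_atTop N] with n hn
  have hrn : A * (1 / ((n : ℝ) + 1)) ≤ ε / 3 := by
    have : (N : ℝ) ≤ n := by exact_mod_cast hn
    rw [mul_one_div, div_le_div_iff₀ (by positivity) (by norm_num)]
    rw [div_lt_iff₀ hε] at hN
    nlinarith
  have hLε : L * (ε / (3 * (L + 1))) ≤ ε / 3 := by
    rw [mul_div_assoc', div_le_div_iff₀ (by positivity) (by norm_num)]
    nlinarith
  have key : ∀ s t, 0 ≤ s → s ≤ t → t ≤ T → t - s ≤ η →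
      |∫ x, f x ∂(G n t) - ∫ x, f x ∂(G n s)| ≤ ε := by
    intro s t hs0 hst ht hη'
    have hfin := hG.isFiniteMeasure hT n
    have hΔ : 0 ≤ t - s := sub_nonneg.2 hst
    have hI : ∀ t, 0 ≤ ∫ x, f x ∂(G n t) := fun t => integral_nonneg h0
    have hfA : ∀ x, ENNReal.ofReal (f x) ≤ ENNReal.ofReal A := fun x =>
      ENNReal.ofReal_le_ofReal (((le_abs_self _).trans ((hBf x).trans (le_max_left _ 0))).trans
        (le_add_of_nonneg_right hA1))
    have hDA : ∀ x y, ENNReal.ofReal (L * crossed α β x y) ≤ ENNReal.ofReal A := fun x y =>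
      ENNReal.ofReal_le_ofReal ((mul_le_mul_of_nonneg_left (crossed_le hαβ.le x y) hL0).trans
        (le_add_of_nonneg_left (le_max_right _ _)))
    have hcr := fun x y => abs_le.1 (abs_sub_le_crossed hα hαβ hsupp hL x y)
    have hflux : (∫⁻ u in Ioc s t, pairInt (G n u) fun x y =>
        truncRate K γ n x y * ENNReal.ofReal (L * crossed α β x y)) ≤
        ENNReal.ofReal (L * (C * (t - s) + ε / (3 * (L + 1)))) := by
      rw [ENNReal.ofReal_mul hL0]
      refine le_trans (le_of_eq ?_) (mul_le_mul_right (hinc n s t hs0 hst ht) _)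
      rw [← lintegral_const_mul' _ _ ENNReal.ofReal_ne_top]
      refine lintegral_congr fun u => ?_
      rw [← pairInt_const_mul _ _ ((hK.measurable_truncRate n).mul
        (continuous_crossed α β).measurable.ennreal_ofReal)]
      congr 1
      ext x y
      rw [ENNReal.ofReal_mul hL0]
      ring
    have hup := (hG n).upper (fun x => ENNReal.ofReal (f x))
      (fun x y => ENNReal.ofReal (L * crossed α β x y)) (ENNReal.ofReal A) ENNReal.ofReal_ne_top
      hf.measurable.ennreal_ofReal hfA hDA (fun x y => by
        rw [← ENNReal.ofReal_add (h0 x) (mul_nonneg hL0 (crossed_nonneg α β x y))]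
        exact ENNReal.ofReal_le_ofReal (by linarith [(hcr x y).2])) s t hs0 hst ht
    have hlo := (hG n).lower (fun x => ENNReal.ofReal (f x))
      (fun x y => ENNReal.ofReal (L * crossed α β x y)) (ENNReal.ofReal A) ENNReal.ofReal_ne_top
      hf.measurable.ennreal_ofReal hfA hDA (fun x y => by
        rw [← ENNReal.ofReal_add (h0 _) (mul_nonneg hL0 (crossed_nonneg α β x y))]
        exact ENNReal.ofReal_le_ofReal (by linarith [(hcr x y).1])) s t hs0 hst ht
    rw [← ofReal_integral hf hs h0, ← ofReal_integral hf hs h0] at hup hlo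
    have hsum : L * (C * (t - s) + ε / (3 * (L + 1))) + A * (t - s) + A * (1 / ((n : ℝ) + 1)) ≤
        ε := by
      have h1 : (L * C + A) * (t - s) ≤ ε / 3 := by
        have h2 : (L * C + A + 1) * η = ε / 3 := by rw [hη]; field_simp
        have h3 : (L * C + A) * (t - s) ≤ (L * C + A + 1) * η :=
            mul_le_mul (by linarith) hη' hΔ (by positivity)
        linarith
      nlinarith
    have h1 : 0 ≤ L * (C * (t - s) + ε / (3 * (L + 1))) := by positivity
    have h2 : 0 ≤ A * (t - s) := by positivity
    have h3 : 0 ≤ A * (1 / ((n : ℝ) + 1)) := by positivity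
    rw [abs_le]
    constructor
    · have h4 : ENNReal.ofReal (∫ x, f x ∂(G n s)) ≤ ENNReal.ofReal (∫ x, f x ∂(G n t) +
          (L * (C * (t - s) + ε / (3 * (L + 1))) + A * (1 / ((n : ℝ) + 1)))) := by
        refine hlo.trans ?_
        rw [ENNReal.ofReal_add (hI t) (by positivity), ENNReal.ofReal_add h1 h3,
          ENNReal.ofReal_mul hA0 (q := 1 / ((n : ℝ) + 1)), ← add_assoc]
        gcongr
      have := (ENNReal.ofReal_le_ofReal_iff (add_nonneg (hI t) (by positivity))).1 h4
      linarith
    · have h4 : ENNReal.ofReal (∫ x, f x ∂(G n t)) ≤ ENNReal.ofReal (∫ x, f x ∂(G n s) +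
          (L * (C * (t - s) + ε / (3 * (L + 1))) + A * (t - s) + A * (1 / ((n : ℝ) + 1)))) := by
        refine hup.trans ?_
        rw [ENNReal.ofReal_add (hI s) (by positivity), ENNReal.ofReal_add (by positivity) h3,
          ENNReal.ofReal_add h1 h2,
          ENNReal.ofReal_mul hA0 (q := 1 / ((n : ℝ) + 1)), ENNReal.ofReal_mul hA0 (q := t - s),
          ← add_assoc, ← add_assoc]
        gcongr
      have := (ENNReal.ofReal_le_ofReal_iff (add_nonneg (hI s) (by positivity))).1 h4
      linarith
  intro s hs t ht hst
  rcases le_total s t with h | h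
  · exact key s t hs.1 h ht.2 ((le_abs_self _).trans hst)
  · rw [abs_sub_comm]
    rw [abs_sub_comm] at hst
    exact key t s ht.1 h hs.2 ((le_abs_self _).trans hst)

end IsApproximation

/-- `g` is a uniform weak-* limit of the families `G n` along a nonprincipal ultrafilter. -/
structure IsLimit (G : ℕ → ℝ → Measure PosR) (T M : ℝ) (g : ℝ → Measure PosR) : Prop where
  regular : ∀ t, (g t).Regular
  mass_le : ∀ t, g t univ ≤ ENNReal.ofReal M
  clamped : ∀ t, g t = g (max 0 (min t T))
  uniform : ∀ f : PosR → ℝ, Continuous f → HasCompactSupport f → ∀ ε > 0,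
    ∀ᶠ n in (hyperfilter ℕ : Filter ℕ), ∀ t ∈ Icc 0 T,
      |∫ x, f x ∂(G n t) - ∫ x, f x ∂(g t)| ≤ ε
  continuousOn : ∀ f : PosR → ℝ, Continuous f → HasCompactSupport f →
    ContinuousOn (fun t => ∫ x, f x ∂(g t)) (Icc 0 T)

lemma IsApproximation.exists_isLimit (hG : IsApproximation K γ T g₀ G)
    (hK : KernelRegularity K γ lam) (hexp : |γ + 2 * lam| < 1) (hγ : γ < 1)
    (hT : 0 ≤ T) [IsFiniteMeasure g₀] : ∃ g, IsLimit G T (massBound g₀ T) g := by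
  choose ν hreg hmass hlim using fun t => exists_ultralimit_measure (hyperfilter ℕ)
    (massBound_nonneg (g₀ := g₀) hT) (fun n => hG.mass_le hT n t)
  have hunif : ∀ f : PosR → ℝ, Continuous f → HasCompactSupport f →
      ContinuousOn (fun t => ∫ x, f x ∂(ν t)) (Icc 0 T) ∧ ∀ ε > 0,
      ∀ᶠ n in (hyperfilter ℕ : Filter ℕ), ∀ t ∈ Icc 0 T,
        |∫ x, f x ∂(G n t) - ∫ x, f x ∂(ν t)| ≤ ε := fun f hf hs =>
    uniform_of_pointwise (fun t _ => hlim t f hf hs) fun ε hε => by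
      obtain ⟨η, hη, h⟩ := hG.asympEquicontinuous hK hexp hγ hT hf hs ε hε
      exact ⟨η, hη, h.filter_mono Nat.hyperfilter_le_atTop⟩
  have hcl : ∀ t ∈ Icc 0 T, max 0 (min t T) = t := fun t ht => by simp [ht.1, ht.2]
  -- Ultralimits at times outside `[0, T]` are uncontrolled; extending by the end values makes the
  -- family measurable on the whole line.
  exact ⟨fun t => ν (max 0 (min t T)),
    { regular := fun t => hreg _
      mass_le := fun t => hmass _
      clamped := fun t => by simp [hT]
      uniform := fun f hf hs ε hε => ((hunif f hf hs).2 ε hε).mono fun n hn t ht => by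
        simpa only [hcl t ht] using hn t ht
      continuousOn := fun f hf hs => (hunif f hf hs).1.congr fun t ht => by
        simp only [hcl t ht] }⟩

end Limit

/-! ### Passage to the limit in the averaged balance law. -/

section LimitEquation

variable {K : PosR → PosR → ℝ} {γ lam T M : ℝ} {g₀ : Measure PosR} {G : ℕ → ℝ → Measure PosR}
  {g : ℝ → Measure PosR}

namespace IsLimit

variable (hg : IsLimit G T M g)

include hg in
lemma isFiniteMeasure (t : ℝ) : IsFiniteMeasure (g t) :=
  ⟨(hg.mass_le t).trans_lt ENNReal.ofReal_lt_top⟩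

include hg in
lemma measurable_lintegral_of_continuous (hT : 0 ≤ T) {f : PosR → ℝ} (hf : Continuous f)
    (h0 : ∀ x, 0 ≤ f x) (h1 : ∀ x, f x ≤ 1) :
    Measurable fun t => ∫⁻ x, ENNReal.ofReal (f x) ∂(g t) := by
  have hfin := hg.isFiniteMeasure
  have hcut : ∀ m : ℕ, Measurable fun t =>
      ∫⁻ x, ENNReal.ofReal (f x * cutoff (m + 1) x) ∂(g t) := by
    intro m
    have hc : Continuous fun x => f x * cutoff (m + 1) x := hf.mul (continuous_cutoff _)
    have hs : HasCompactSupport fun x => f x * cutoff (m + 1) x :=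
      (hasCompactSupport_cutoff (by positivity)).mul_left
    simp_rw [← fun t => ofReal_integral (μ := g t) hc hs
      fun x => mul_nonneg (h0 x) (cutoff_nonneg _ x)]
    refine Measurable.ennreal_ofReal ?_
    have : (fun t => ∫ x, f x * cutoff (m + 1) x ∂(g t)) =
        (fun t => ∫ x, f x * cutoff (m + 1) x ∂(g t)) ∘ fun t => max 0 (min t T) := by
      ext t
      simp only [comp_apply, ← hg.clamped t]
    rw [this]
    exact ((hg.continuousOn _ hc hs).comp_continuous (by fun_prop)
      fun t => ⟨le_max_left _ _, max_le hT (min_le_right _ _)⟩).measurable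
  refine measurable_of_tendsto_metrizable hcut (tendsto_pi_nhds.2 fun t => ?_)
  refine tendsto_lintegral_of_dominated_convergence (fun _ => 1) (fun m =>
    (hf.mul (continuous_cutoff _)).measurable.ennreal_ofReal) (fun m => Eventually.of_forall
      fun x => ?_) (by simp) (Eventually.of_forall fun x => ?_)
  · exact ENNReal.ofReal_le_one.2 (mul_le_one₀ (h1 x) (cutoff_nonneg _ x) (cutoff_le_one _ x))
  · refine tendsto_const_nhds.congr' ?_
    filter_upwards [eventually_cutoff_eq_one x] with m hm
    rw [hm, mul_one]

include hg in
-- The half-lines `Iic z` form a generating π-system, and their indicators are limits of continuous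
-- ramps.
lemma measurable (hT : 0 ≤ T) : Measurable g := by
  have hfin := hg.isFiniteMeasure
  refine Measurable.measure_of_isPiSystem (borel_eq_generateFrom_Iic PosR ▸ BorelSpace.measurable_eq)
    isPiSystem_Iic ?_ ?_
  · rintro _ ⟨z, rfl⟩
    let F : ℕ → PosR → ℝ := fun m x => max 0 (1 - m * max 0 ((x : ℝ) - z))
    have hF0 : ∀ m x, 0 ≤ F m x := fun m x => le_max_left _ _
    have hF1 : ∀ m x, F m x ≤ 1 := fun m x => max_le zero_le_one (by
      have : (0 : ℝ) ≤ m * max 0 ((x : ℝ) - z) := by positivity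
      linarith)
    have hFc : ∀ m, Continuous (F m) := fun m => by fun_prop
    refine measurable_of_tendsto_metrizable
      (fun m : ℕ => hg.measurable_lintegral_of_continuous hT (hFc m) (hF0 m) (hF1 m))
      (tendsto_pi_nhds.2 fun t => ?_)
    rw [← lintegral_indicator_one measurableSet_Iic]
    refine tendsto_lintegral_of_dominated_convergence (fun _ => 1) (fun m =>
      (hFc m).measurable.ennreal_ofReal) (fun m => Eventually.of_forall
        fun x => ENNReal.ofReal_le_one.2 (hF1 m x)) (by simp) (Eventually.of_forall fun x => ?_)
    refine tendsto_const_nhds.congr' ?_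
    by_cases hx : x ≤ z
    · have hx' : (x : ℝ) - z ≤ 0 := sub_nonpos.2 hx
      refine Eventually.of_forall fun m => ?_
      simp [F, hx, hx']
    · have hx' : 0 < (x : ℝ) - z := sub_pos.2 (not_le.1 hx)
      obtain ⟨N, hN⟩ := exists_nat_ge (1 / ((x : ℝ) - z))
      filter_upwards [eventually_ge_atTop N] with m hm
      have hm' : 1 / ((x : ℝ) - z) ≤ m := hN.trans (by exact_mod_cast hm)
      rw [div_le_iff₀ hx'] at hm'
      have : 1 - m * max 0 ((x : ℝ) - z) ≤ 0 := by rw [max_eq_right hx'.le]; linarith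
      simp [F, hx, this]
  · have := hg.measurable_lintegral_of_continuous hT (f := fun _ => 1) continuous_const
      (fun _ => zero_le_one) (fun _ => le_rfl)
    simpa using this

include hg in
-- A compactly supported test function does not see the removed mass once the injection size is
-- below its support.
lemma initial (hG : IsApproximation K γ T g₀ G) (hT : 0 ≤ T) (hg₀ : g₀.Regular) : g 0 = g₀ := by
  have := hg.regular 0
  refine Measure.ext_of_integral_eq_on_compactlySupported fun f => ?_
  obtain ⟨α, β, hα, -, hsupp⟩ := exists_support_bounds f.hasCompactSupport
  obtain ⟨N, hN⟩ := exists_nat_gt (1 / α)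
  have hev : ∀ᶠ n in (hyperfilter ℕ : Filter ℕ), ∫ x, f x ∂(G n 0) = ∫ x, f x ∂g₀ := by
    refine Filter.Eventually.filter_mono Nat.hyperfilter_le_atTop ?_
    filter_upwards [eventually_ge_atTop N] with n hn
    rw [(hG n).initial]
    refine setIntegral_eq_integral_of_forall_compl_eq_zero fun x hx => ?_
    by_contra h0
    refine hx (le_trans ?_ (hsupp x h0).1.le)
    have hn' : (N : ℝ) ≤ n := by exact_mod_cast hn
    rw [coe_eps, div_le_iff₀ (by positivity)]
    rw [div_lt_iff₀ hα] at hN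
    nlinarith
  refine eq_of_abs_sub_le_all fun ε hε => ?_
  obtain ⟨n, h1, h2⟩ := (hev.and
    (hg.uniform f f.continuous f.hasCompactSupport ε hε)).exists
  have h3 := h2 0 ⟨le_rfl, hT⟩
  rw [h1, abs_sub_comm] at h3
  exact h3

include hg in
/-- Integrals of `tailLength` converge: no mass concentrates at zero size. -/
lemma closeTo_tailLength (hG : IsApproximation K γ T g₀ G) (hK : KernelRegularity K γ lam)
    (hγ : γ < 1) (hT : 0 ≤ T) [IsFiniteMeasure g₀] {α β t : ℝ}
    (hαβ : α < β) (ht0 : 0 < t) (ht : t ≤ T) :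
    CloseTo (hyperfilter ℕ : Filter ℕ) (fun n => ∫⁻ x, ENNReal.ofReal (tailLength α β x) ∂(G n t))
      (∫⁻ x, ENNReal.ofReal (tailLength α β x) ∂(g t)) := by
  intro ε hε
  have hΔ : 0 < β - α := sub_pos.2 hαβ
  have hfin := hg.isFiniteMeasure
  have hfin' := hG.isFiniteMeasure hT
  have htail0 := tailLength_nonneg hαβ.le
  obtain ⟨δ₀, hδ₀, N, hsm⟩ := hG.small_mass hK hγ hT ht0 ht
    (show 0 < ε / (2 * (β - α)) by positivity)
  have hlimcut : Tendsto (fun m : ℕ =>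
      ∫⁻ x, ENNReal.ofReal (tailLength α β x * cutoff (m + 1) x) ∂(g t)) atTop
      (𝓝 (∫⁻ x, ENNReal.ofReal (tailLength α β x) ∂(g t))) := by
    refine tendsto_lintegral_of_dominated_convergence (fun _ => ENNReal.ofReal (β - α)) (fun m =>
      ((continuous_tailLength α β).mul (continuous_cutoff _)).measurable.ennreal_ofReal)
      (fun m => Eventually.of_forall fun x => ?_) ?_ (Eventually.of_forall fun x => ?_)
    · exact ENNReal.ofReal_le_ofReal ((mul_le_of_le_one_right (htail0 x) (cutoff_le_one _ x)).trans
        (tailLength_le α β x))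
    · simp [ENNReal.mul_ne_top]
    · refine tendsto_const_nhds.congr' ?_
      filter_upwards [eventually_cutoff_eq_one x] with m hm
      rw [hm, mul_one]
  have hIne : ∫⁻ x, ENNReal.ofReal (tailLength α β x) ∂(g t) ≠ ∞ := by
    refine ((lintegral_mono fun x => ENNReal.ofReal_le_ofReal
      (tailLength_le α β x)).trans_lt ?_).ne
    rw [lintegral_const]
    exact ENNReal.mul_lt_top ENNReal.ofReal_lt_top (measure_lt_top _ _)
  have hev : ∀ᶠ m : ℕ in atTop, (∫⁻ x, ENNReal.ofReal (tailLength α β x) ∂(g t)) ≤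
      (∫⁻ x, ENNReal.ofReal (tailLength α β x * cutoff (m + 1) x) ∂(g t)) +
        ENNReal.ofReal (ε / 2) := by
    have := (ENNReal.tendsto_nhds hIne).1 hlimcut (ENNReal.ofReal (ε / 2))
      (by simpa using (show 0 < ε / 2 by positivity))
    filter_upwards [this] with m hm
    exact tsub_le_iff_right.1 hm.1
  -- `tailLength` equals `β - α` near size zero, so it is not in `C_c`. With `m + 1 ≥ β` and
  -- `1/(m+1) ≤ δ₀`, the cutoff alters it only at sizes below `δ₀`, where the approximations have
  -- little mass.
  obtain ⟨m, hm, hmδ, hmβ⟩ := (hev.and ((eventually_ge_atTop ⌈1 / δ₀⌉₊).and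
    (eventually_ge_atTop ⌈β⌉₊))).exists
  have hmpos : (0 : ℝ) < (m : ℝ) + 1 := by positivity
  have hmδ' : 1 / ((m : ℝ) + 1) ≤ δ₀ := by
    have := (Nat.le_ceil (1 / δ₀)).trans (Nat.cast_le.2 hmδ)
    rw [div_le_iff₀ hδ₀] at this
    rw [div_le_iff₀ hmpos]
    nlinarith
  have hmβ' : β ≤ (m : ℝ) + 1 := by
    have := (Nat.le_ceil β).trans (Nat.cast_le.2 hmβ)
    linarith
  set f : PosR → ℝ := fun x => tailLength α β x * cutoff (m + 1) x with hf
  have hfc : Continuous f := (continuous_tailLength α β).mul (continuous_cutoff _)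
  have hfs : HasCompactSupport f := (hasCompactSupport_cutoff hmpos).mul_left
  have hf0 : ∀ x, 0 ≤ f x := fun x => mul_nonneg (htail0 x) (cutoff_nonneg _ x)
  have hfle : ∀ x, f x ≤ tailLength α β x := fun x =>
    mul_le_of_le_one_right (htail0 x) (cutoff_le_one _ x)
  have hsplit : ∀ x, ENNReal.ofReal (tailLength α β x) ≤ ENNReal.ofReal (f x) +
      ENNReal.ofReal (β - α) * {x : PosR | (x : ℝ) ≤ 1 / ((m : ℝ) + 1)}.indicator 1 x := by
    intro x
    by_cases hx : (x : ℝ) ≤ 1 / ((m : ℝ) + 1)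
    · refine le_add_left ?_
      rw [indicator_of_mem (by exact hx)]
      simpa using ENNReal.ofReal_le_ofReal (tailLength_le α β x)
    · refine le_add_right (ENNReal.ofReal_le_ofReal ?_)
      rcases le_total (x : ℝ) β with h | h
      · rw [hf]
        simp only
        rw [cutoff_eq_one hmpos (not_le.1 hx).le (h.trans hmβ'), mul_one]
      · refine le_trans ?_ (hf0 x)
        simp [tailLength, clamp, h]
  have hIG : ∀ n ≥ N, (∫⁻ x, ENNReal.ofReal (tailLength α β x) ∂(G n t)) ≤
      (∫⁻ x, ENNReal.ofReal (f x) ∂(G n t)) + ENNReal.ofReal (ε / 2) := by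
    intro n hn
    refine (lintegral_mono hsplit).trans ?_
    rw [lintegral_add_left hfc.measurable.ennreal_ofReal, lintegral_const_mul _
      (measurable_one.indicator (measurableSet_le _)), lintegral_indicator_one (measurableSet_le _)]
    refine add_le_add_right ((mul_le_mul_right (hsm n hn _ hmδ') _).trans_eq ?_) _
    rw [← ENNReal.ofReal_mul hΔ.le]
    congr 1
    field_simp
  have hconv := hg.uniform f hfc hfs (ε / 2) (by positivity)
  filter_upwards [hconv, (eventually_ge_atTop N).filter_mono Nat.hyperfilter_le_atTop] with n hn hnN
  have h1 := abs_le.1 (hn t ⟨ht0.le, ht⟩)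
  have e1 : (∫⁻ x, ENNReal.ofReal (f x) ∂(G n t)) ≤
      (∫⁻ x, ENNReal.ofReal (f x) ∂(g t)) + ENNReal.ofReal (ε / 2) := by
    rw [← ofReal_integral hfc hfs hf0, ← ofReal_integral hfc hfs hf0,
      ← ENNReal.ofReal_add (integral_nonneg hf0) (by positivity)]
    exact ENNReal.ofReal_le_ofReal (by linarith)
  have e2 : (∫⁻ x, ENNReal.ofReal (f x) ∂(g t)) ≤
      (∫⁻ x, ENNReal.ofReal (f x) ∂(G n t)) + ENNReal.ofReal (ε / 2) := by
    rw [← ofReal_integral hfc hfs hf0, ← ofReal_integral hfc hfs hf0,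
      ← ENNReal.ofReal_add (integral_nonneg hf0) (by positivity)]
    exact ENNReal.ofReal_le_ofReal (by linarith)
  have e3 : ∀ μ : Measure PosR, (∫⁻ x, ENNReal.ofReal (f x) ∂μ) ≤
      ∫⁻ x, ENNReal.ofReal (tailLength α β x) ∂μ := fun μ =>
    lintegral_mono fun x => ENNReal.ofReal_le_ofReal (hfle x)
  have hε2 : ENNReal.ofReal ε = ENNReal.ofReal (ε / 2) + ENNReal.ofReal (ε / 2) := by
    rw [← ENNReal.ofReal_add (by positivity) (by positivity), add_halves]
  rw [hε2, ← add_assoc, ← add_assoc]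
  constructor
  · refine (hIG n hnN).trans ?_
    gcongr
    exact e1.trans (by gcongr; exact hfle _)
  · refine hm.trans ?_
    gcongr
    exact e2.trans (by gcongr; exact hfle _)

include hg in
-- Monotone convergence in the cutoffs: the full averaged flux of the limit is recovered from
-- compactly supported integrands, the only ones for which convergence is known.
lemma iSup_truncFlux (hK : KernelRegularity K γ lam) (hT : 0 ≤ T) (α β t : ℝ) :
    ∫⁻ u in Ioc 0 t, pairInt (g u) (fun x y => rate K x y * ENNReal.ofReal (crossed α β x y)) =
      ⨆ m : ℕ, ∫⁻ u in Ioc 0 t, pairInt (g u) fun x y =>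
        ENNReal.ofReal (truncFlux K α β ((m : ℝ) + 1) x y) := by
  have hmeas : ∀ m : ℝ, Measurable (uncurry fun x y => ENNReal.ofReal (truncFlux K α β m x y)) :=
    fun m => (hK.continuous_truncFlux α β m).measurable.ennreal_ofReal
  have hmono : ∀ x y, Monotone fun m : ℕ => ENNReal.ofReal (truncFlux K α β ((m : ℝ) + 1) x y) := by
    intro x y m m' h
    refine ENNReal.ofReal_le_ofReal ?_
    have h1 : (m : ℝ) + 1 ≤ m' + 1 := by simpa using h
    have h0 : (0 : ℝ) < m + 1 := by positivity
    have h2 := hK.nonneg x y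
    have h3 := y.2.out.le
    have h4 := crossed_nonneg α β x y
    have h5 := cutoff_nonneg ((m : ℝ) + 1) y
    have h6 := cutoff_nonneg ((m' : ℝ) + 1) x
    unfold truncFlux
    gcongr
    · exact cutoff_mono h0 h1 x
    · exact cutoff_mono h0 h1 y
  have hpt : ∀ x y, rate K x y * ENNReal.ofReal (crossed α β x y) =
      ⨆ m : ℕ, ENNReal.ofReal (truncFlux K α β ((m : ℝ) + 1) x y) := by
    intro x y
    refine tendsto_nhds_unique ?_ (tendsto_atTop_iSup (hmono x y))
    refine tendsto_const_nhds.congr' ?_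
    filter_upwards [eventually_cutoff_eq_one x, eventually_cutoff_eq_one y] with m h1 h2
    rw [← rate_mul_cutoff, h1, h2, mul_one, mul_one]
  have hfin := hg.isFiniteMeasure
  have h1 : ∀ u, pairInt (g u) (fun x y => rate K x y * ENNReal.ofReal (crossed α β x y)) =
      ⨆ m : ℕ, pairInt (g u) fun x y => ENNReal.ofReal (truncFlux K α β ((m : ℝ) + 1) x y) := by
    intro u
    unfold pairInt
    simp_rw [hpt]
    rw [← lintegral_iSup (f := fun (m : ℕ) x => ∫⁻ y, ENNReal.ofReal
      (truncFlux K α β ((m : ℝ) + 1) x y) ∂(g u)) (fun m => (hmeas _).lintegral_prod_right')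
      (fun m m' h x => lintegral_mono fun y => hmono x y h)]
    refine lintegral_congr fun x => ?_
    exact lintegral_iSup (fun m => (hmeas _).of_uncurry_left) fun m m' h y => hmono x y h
  simp_rw [h1]
  exact lintegral_iSup (fun m => measurable_pairInt (hg.measurable hT) ENNReal.ofReal_ne_top
    hg.mass_le ((hmeas _).comp measurable_snd)) fun m m' h u =>
      pairInt_mono _ fun x y => hmono x y h

include hg in
/-- The limit satisfies the flux equation averaged over `z ∈ (α, β)`. -/
lemma balance (hG : IsApproximation K γ T g₀ G) (hK : KernelRegularity K γ lam)
    (hexp : |γ + 2 * lam| < 1) (hγ : γ < 1) (hT : 0 ≤ T) [IsFiniteMeasure g₀] {α β t : ℝ}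
    (hα : 0 < α) (hαβ : α < β) (ht0 : 0 < t) (ht : t ≤ T) (hM : M = massBound g₀ T) :
    (∫⁻ x, ENNReal.ofReal (tailLength α β x) ∂(g t)) +
      (∫⁻ u in Ioc 0 t, pairInt (g u) fun x y =>
        rate K x y * ENNReal.ofReal (crossed α β x y)) =
    (∫⁻ x, ENNReal.ofReal (tailLength α β x) ∂g₀) + ENNReal.ofReal t * ENNReal.ofReal (β - α) := by
  have hΔ : 0 < β - α := sub_pos.2 hαβ
  set l : Filter ℕ := (hyperfilter ℕ : Filter ℕ)
  have hl' : l ≤ atTop := Nat.hyperfilter_le_atTop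
  have hcont := continuous_tailLength α β
  have hI := hg.closeTo_tailLength hG hK hγ hT hαβ ht0 ht
  have hA : ∀ m : ℕ, CloseTo l (fun n => ∫⁻ u in Ioc 0 t, pairInt (G n u) fun x y =>
        ENNReal.ofReal (truncFlux K α β ((m : ℝ) + 1) x y))
      (∫⁻ u in Ioc 0 t, pairInt (g u) fun x y =>
        ENNReal.ofReal (truncFlux K α β ((m : ℝ) + 1) x y)) := fun m =>
    closeTo_lintegral_pairInt (massBound_nonneg (g₀ := g₀) hT) hT (hG.mass_le hT)
      (hM ▸ hg.mass_le) hg.uniform (hK.continuous_truncFlux α β _)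
      (hasCompactSupport_truncFlux α β (by positivity)) (hK.truncFlux_nonneg α β _) ⟨ht0.le, ht⟩
  have heq : ∀ m : ℕ, ∀ᶠ n in l, ∀ x y, truncRate K γ n x y *
      ENNReal.ofReal (crossed α β x y * (cutoff ((m : ℝ) + 1) x * cutoff ((m : ℝ) + 1) y)) =
        ENNReal.ofReal (truncFlux K α β ((m : ℝ) + 1) x y) := fun m =>
    (hK.eventually_truncRate_eq hγ α β (by positivity)).filter_mono hl'
  have htailC : ∀ x : PosR, ENNReal.ofReal (tailLength α β x) ≤ ENNReal.ofReal (β - α) := fun x =>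
    ENNReal.ofReal_le_ofReal (tailLength_le α β x)
  have hcrC : ∀ x y : PosR, ENNReal.ofReal (crossed α β x y) ≤ ENNReal.ofReal (β - α) := fun x y =>
    ENNReal.ofReal_le_ofReal (crossed_le hαβ.le x y)
  have htailD : ∀ x y : PosR, ENNReal.ofReal (tailLength α β x) =
      ENNReal.ofReal (tailLength α β (addP x y)) + ENNReal.ofReal (crossed α β x y) := fun x y => by
    rw [tailLength_eq α β x y, ENNReal.ofReal_add (tailLength_nonneg hαβ.le _)
      (crossed_nonneg α β x y)]
  have hr : ∀ ε : ℝ, 0 < ε → ∀ᶠ n : ℕ in l,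
      ENNReal.ofReal (β - α) * ENNReal.ofReal (1 / ((n : ℝ) + 1)) ≤ ENNReal.ofReal ε := by
    intro ε hε
    have h1 : Tendsto (fun n : ℕ => (β - α) * (1 / ((n : ℝ) + 1))) atTop (𝓝 0) := by
      simpa using tendsto_one_div_add_atTop_nhds_zero_nat.const_mul (β - α)
    filter_upwards [(h1.eventually_le_const hε).filter_mono hl'] with n hn
    rw [← ENNReal.ofReal_mul hΔ.le]
    exact ENNReal.ofReal_le_ofReal hn
  refine le_antisymm ?_ ?_
  -- Upper bound: for fixed `m` the cut flux of the limit is approximated by a quantity below the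
  -- full flux of `G n`, so no tail estimate is needed.
  · rw [hg.iSup_truncFlux hK hT, ENNReal.add_iSup]
    refine iSup_le fun m => ENNReal.le_of_forall_pos_le_add fun ε hε _ => ?_
    have hε3 : (0 : ℝ) < ε / 3 := by positivity
    obtain ⟨n, ⟨⟨-, h1⟩, ⟨-, h2⟩⟩, h3, h4⟩ := (((hI _ hε3).and (hA m _ hε3)).and
      ((heq m).and (hr _ hε3))).exists
    have h5 := (hG n).balance_le (fun x => ENNReal.ofReal (tailLength α β x))
      (fun x y => ENNReal.ofReal (crossed α β x y)) (ENNReal.ofReal (β - α)) ENNReal.ofReal_ne_top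
      hcont.measurable.ennreal_ofReal htailC hcrC htailD t ht0.le ht
    have h6 : (∫⁻ u in Ioc 0 t, pairInt (G n u) fun x y =>
        ENNReal.ofReal (truncFlux K α β ((m : ℝ) + 1) x y)) ≤
        ∫⁻ u in Ioc 0 t, pairInt (G n u) fun x y =>
          truncRate K γ n x y * ENNReal.ofReal (crossed α β x y) := by
      refine lintegral_mono fun u => pairInt_mono _ fun x y => ?_
      rw [← h3 x y]
      gcongr
      exact mul_le_of_le_one_right (crossed_nonneg α β x y)
        (mul_le_one₀ (cutoff_le_one _ x) (cutoff_nonneg _ y) (cutoff_le_one _ y))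
    have hεeq : (ε : ℝ≥0∞) = ENNReal.ofReal (ε / 3) + ENNReal.ofReal (ε / 3) +
        ENNReal.ofReal (ε / 3) := by
      rw [← ENNReal.ofReal_add (by positivity) (by positivity),
        ← ENNReal.ofReal_add (by positivity) (by positivity), ← ENNReal.ofReal_coe_nnreal]
      congr 1
      ring
    rw [hεeq]
    calc _ ≤ ((∫⁻ x, ENNReal.ofReal (tailLength α β x) ∂(G n t)) + ENNReal.ofReal (ε / 3)) +
          ((∫⁻ u in Ioc 0 t, pairInt (G n u) fun x y =>
            truncRate K γ n x y * ENNReal.ofReal (crossed α β x y)) + ENNReal.ofReal (ε / 3)) :=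
          add_le_add h1 (h2.trans (add_le_add_left h6 _))
      _ = ((∫⁻ x, ENNReal.ofReal (tailLength α β x) ∂(G n t)) +
          (∫⁻ u in Ioc 0 t, pairInt (G n u) fun x y =>
            truncRate K γ n x y * ENNReal.ofReal (crossed α β x y))) + (ENNReal.ofReal (ε / 3) +
            ENNReal.ofReal (ε / 3)) := by ring
      _ ≤ ((∫⁻ x, ENNReal.ofReal (tailLength α β x) ∂g₀) +
            ENNReal.ofReal t * ENNReal.ofReal (β - α) + ENNReal.ofReal (ε / 3)) +
            (ENNReal.ofReal (ε / 3) + ENNReal.ofReal (ε / 3)) := by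
          refine add_le_add_left (h5.trans ?_) _
          refine add_le_add (add_le_add ?_ ?_) h4
          · exact lintegral_mono' Measure.restrict_le_self le_rfl
          · gcongr
            exact tailLength_le α β _
      _ = _ := by ring
  -- Lower bound: no flux may be lost in the limit, which is the role of `flux_tail`. The five
  -- errors come from the initial data, the scheme, the mass term, the tail and the cut flux.
  · refine ENNReal.le_of_forall_pos_le_add fun ε hε _ => ?_
    have hε5 : (0 : ℝ) < ε / 5 := by positivity
    obtain ⟨m, hm⟩ := hG.flux_tail hK hexp hγ hT hα hαβ hε5
    have hinit : ∀ᶠ n in l, (∫⁻ x, ENNReal.ofReal (tailLength α β x) ∂g₀) ≤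
        (∫⁻ x, ENNReal.ofReal (tailLength α β x) ∂(G n 0)) + ENNReal.ofReal (ε / 5) := by
      have hms : ∀ n, MeasurableSet {x : PosR | (eps n : ℝ) ≤ x} := fun n =>
        measurableSet_Ici.preimage measurable_subtype_coe
      have hlim : Tendsto (fun n => ∫⁻ x, ENNReal.ofReal (tailLength α β x) ∂(G n 0)) atTop
          (𝓝 (∫⁻ x, ENNReal.ofReal (tailLength α β x) ∂g₀)) := by
        simp_rw [fun n => (hG n).initial, ← fun n => lintegral_indicator (μ := g₀) (hms n)]
        refine tendsto_lintegral_of_dominated_convergence (fun _ => ENNReal.ofReal (β - α))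
          (fun n => hcont.measurable.ennreal_ofReal.indicator (hms n))
          (fun n => Eventually.of_forall fun x => (indicator_le_self _ _ x).trans (htailC x))
          (by simp [ENNReal.mul_ne_top]) (Eventually.of_forall fun x => ?_)
        refine tendsto_const_nhds.congr' ?_
        have := tendsto_one_div_add_atTop_nhds_zero_nat.eventually_le_const x.2.out
        filter_upwards [this] with n hn
        rw [indicator_of_mem]
        exact hn
      have hne : ∫⁻ x, ENNReal.ofReal (tailLength α β x) ∂g₀ ≠ ∞ := by
        refine ((lintegral_mono htailC).trans_lt ?_).ne
        rw [lintegral_const]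
        exact ENNReal.mul_lt_top ENNReal.ofReal_lt_top (measure_lt_top _ _)
      refine Eventually.filter_mono hl' ?_
      filter_upwards [(ENNReal.tendsto_nhds hne).1 hlim (ENNReal.ofReal (ε / 5))
        (by simpa using hε5)] with n hn
      exact tsub_le_iff_right.1 hn.1
    -- Once the injection size is at most `α`, all injected mass has the full weight `β - α`.
    have heps : ∀ᶠ n in l, (eps n : ℝ) ≤ α :=
      (tendsto_one_div_add_atTop_nhds_zero_nat.eventually_le_const hα).filter_mono hl'
    obtain ⟨n, ⟨⟨⟨h1, -⟩, ⟨h2, -⟩⟩, h3, h4⟩, h5, h6⟩ := ((((hI _ hε5).and (hA m _ hε5)).and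
      ((heq m).and (hr _ hε5))).and (hinit.and heps)).exists
    have h7 := (hG n).balance_ge (fun x => ENNReal.ofReal (tailLength α β x))
      (fun x y => ENNReal.ofReal (crossed α β x y)) (ENNReal.ofReal (β - α)) ENNReal.ofReal_ne_top
      hcont.measurable.ennreal_ofReal htailC hcrC htailD t ht0.le ht
    rw [tailLength_eq_of_le h6] at h7
    have h8 := hm m le_rfl n 0 t le_rfl ht
    simp_rw [h3] at h8
    have h9 : (∫⁻ u in Ioc 0 t, pairInt (g u) fun x y =>
        ENNReal.ofReal (truncFlux K α β ((m : ℝ) + 1) x y)) ≤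
        ∫⁻ u in Ioc 0 t, pairInt (g u) fun x y =>
          rate K x y * ENNReal.ofReal (crossed α β x y) := by
      rw [hg.iSup_truncFlux hK hT]
      exact le_iSup (fun m : ℕ => ∫⁻ u in Ioc 0 t, pairInt (g u) fun x y =>
        ENNReal.ofReal (truncFlux K α β ((m : ℝ) + 1) x y)) m
    have hεeq : (ε : ℝ≥0∞) = ENNReal.ofReal (ε / 5) + ENNReal.ofReal (ε / 5) +
        ENNReal.ofReal (ε / 5) + ENNReal.ofReal (ε / 5) + ENNReal.ofReal (ε / 5) := by
      rw [← ENNReal.ofReal_add (by positivity) (by positivity),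
        ← ENNReal.ofReal_add (by positivity) (by positivity),
        ← ENNReal.ofReal_add (by positivity) (by positivity),
        ← ENNReal.ofReal_add (by positivity) (by positivity), ← ENNReal.ofReal_coe_nnreal]
      congr 1
      ring
    rw [hεeq]
    set η := ENNReal.ofReal (ε / 5) with hη
    calc _ ≤ (∫⁻ x, ENNReal.ofReal (tailLength α β x) ∂(G n 0)) + η +
            ENNReal.ofReal t * ENNReal.ofReal (β - α) := by gcongr
      _ = (∫⁻ x, ENNReal.ofReal (tailLength α β x) ∂(G n 0)) +
            ENNReal.ofReal t * ENNReal.ofReal (β - α) + η := by ring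
      _ ≤ ((∫⁻ x, ENNReal.ofReal (tailLength α β x) ∂(G n t)) +
          (∫⁻ u in Ioc 0 t, pairInt (G n u) fun x y =>
            truncRate K γ n x y * ENNReal.ofReal (crossed α β x y)) + η) + η := by
          rw [(hG n).initial]
          refine add_le_add_left (h7.trans (add_le_add_right h4 _)) _
      _ ≤ (((∫⁻ x, ENNReal.ofReal (tailLength α β x) ∂(g t)) + η) +
          (((∫⁻ u in Ioc 0 t, pairInt (g u) fun x y =>
            rate K x y * ENNReal.ofReal (crossed α β x y)) + η) + η) + η) + η := by
          refine add_le_add_left (add_le_add_left (add_le_add h1 (h8.trans ?_)) _) _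
          exact add_le_add_left (h2.trans (add_le_add_left h9 _)) _
      _ = _ := by ring

end IsLimit

end LimitEquation

/-! ### From averages over `(α, β)` to almost every `z`. -/

section Averages

variable {K : PosR → PosR → ℝ} {γ lam T : ℝ} {g : ℝ → Measure PosR} {M : ℝ≥0∞}

/-- The indicator of the jumps from `x` to `x + y` that cross `z`. -/
def crossing (z : ℝ) (x y : PosR) : ℝ≥0∞ := if (x : ℝ) ≤ z ∧ z < x + y then 1 else 0

lemma measurable_crossing : Measurable fun p : ℝ × PosR × PosR => crossing p.1 p.2.1 p.2.2 := by
  refine Measurable.ite ?_ measurable_const measurable_const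
  refine (_root_.measurableSet_le (f := fun p : ℝ × PosR × PosR => (p.2.1 : ℝ)) (g := fun p => p.1)
    (by fun_prop) (by fun_prop)).inter
    (measurableSet_lt (f := fun p : ℝ × PosR × PosR => p.1)
      (g := fun p => (p.2.1 : ℝ) + p.2.2) (by fun_prop) (by fun_prop))

lemma setLIntegral_le_indicator {α β : ℝ} (hαβ : α < β) (x : PosR) :
    ∫⁻ z in Ioc α β, (if (x : ℝ) ≤ z then (1 : ℝ≥0∞) else 0) =
      ENNReal.ofReal (tailLength α β x) := by
  have h1 : (fun z : ℝ => if (x : ℝ) ≤ z then (1 : ℝ≥0∞) else 0) = (Ici (x : ℝ)).indicator 1 := by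
    ext z
    simp [indicator_apply]
  rw [h1, lintegral_indicator_one measurableSet_Ici, Measure.restrict_apply measurableSet_Ici]
  rcases le_or_gt (x : ℝ) α with h | h
  · have h2 : Ici (x : ℝ) ∩ Ioc α β = Ioc α β := inter_eq_right.2 fun z hz => h.trans hz.1.le
    rw [h2, Real.volume_Ioc, tailLength_eq_of_le h]
  · have h2 : Ici (x : ℝ) ∩ Ioc α β = Icc (x : ℝ) β := by
      ext z
      simp only [mem_inter_iff, mem_Ici, mem_Ioc, mem_Icc]
      exact ⟨fun h => ⟨h.1, h.2.2⟩, fun h' => ⟨h'.1, h.trans_le h'.1, h'.2⟩⟩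
    rw [h2, Real.volume_Icc, tailLength, clamp]
    rcases le_total (x : ℝ) β with h3 | h3
    · simp [h3, h.le]
    · simp [h3, hαβ.le]

/-- A jump crosses `z` exactly when `x ≤ z` holds and `x + y ≤ z` fails, so this is a difference of
two tail lengths. -/
lemma setLIntegral_crossing {α β : ℝ} (hαβ : α < β) (x y : PosR) :
    ∫⁻ z in Ioc α β, crossing z x y = ENNReal.ofReal (crossed α β x y) := by
  have hy := y.2.out
  have h1 : ∀ z : ℝ, (if (x : ℝ) ≤ z then (1 : ℝ≥0∞) else 0) =
      (if (addP x y : ℝ) ≤ z then (1 : ℝ≥0∞) else 0) + crossing z x y := by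
    intro z
    rw [coe_addP, crossing]
    by_cases h : (x : ℝ) ≤ z <;> by_cases h' : z < (x : ℝ) + y
    · simp [h, h', not_le.2 h']
    · simp [h, h', not_lt.1 h']
    · simp [h, not_le.2 h']
    · exfalso; linarith
  have h2 := setLIntegral_le_indicator hαβ x
  simp_rw [h1] at h2
  rw [lintegral_add_left (Measurable.ite measurableSet_Ici measurable_const measurable_const),
    setLIntegral_le_indicator hαβ, tailLength_eq α β x y,
    ENNReal.ofReal_add (tailLength_nonneg hαβ.le _) (crossed_nonneg α β x y)] at h2
  exact (ENNReal.add_right_inj ENNReal.ofReal_ne_top).1 h2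

lemma setLIntegral_measure_le (μ : Measure PosR) [SFinite μ] {α β : ℝ} (hαβ : α < β) :
    ∫⁻ z in Ioc α β, μ {x | (x : ℝ) ≤ z} = ∫⁻ x, ENNReal.ofReal (tailLength α β x) ∂μ := by
  have h1 : ∀ z : ℝ, μ {x | (x : ℝ) ≤ z} = ∫⁻ x, (if (x : ℝ) ≤ z then (1 : ℝ≥0∞) else 0) ∂μ := by
    intro z
    rw [← lintegral_indicator_one (measurableSet_le z)]
    simp only [indicator_apply, mem_ofPred_eq, Pi.one_apply]
  simp_rw [h1]
  rw [lintegral_lintegral_swap]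
  · exact lintegral_congr fun x => setLIntegral_le_indicator hαβ x
  · exact (Measurable.ite (_root_.measurableSet_le (f := fun p : ℝ × PosR => (p.2 : ℝ))
      (g := fun p => p.1) (by fun_prop) (by fun_prop)) measurable_const
        measurable_const).aemeasurable

/-- The integrand of the flux through size `z`, for the mass measure. -/
def fluxIntegrand (K : PosR → PosR → ℝ) (z : ℝ) (x y : PosR) : ℝ≥0∞ := rate K x y * crossing z x y

lemma KernelRegularity.measurable_fluxIntegrand (hK : KernelRegularity K γ lam) :
    Measurable fun p : ℝ × PosR × PosR => fluxIntegrand K p.1 p.2.1 p.2.2 :=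
  (hK.measurable_rate.comp measurable_snd).mul measurable_crossing

lemma measurable_flux (hK : KernelRegularity K γ lam) (hg : Measurable g) (hM : M ≠ ∞)
    (hgM : ∀ t, g t univ ≤ M) :
    Measurable fun p : ℝ × ℝ => pairInt (g p.2) (fluxIntegrand K p.1) := by
  refine measurable_pairInt (G := fun p : ℝ × ℝ => g p.2) (hg.comp measurable_snd) hM
    (fun p => hgM p.2) (F := fun p => fluxIntegrand K p.1) ?_
  exact hK.measurable_fluxIntegrand.comp
    (by fun_prop : Measurable fun p : (ℝ × ℝ) × PosR × PosR => (p.1.1, p.2))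

lemma setLIntegral_pairInt_fluxIntegrand (hK : KernelRegularity K γ lam) (μ : Measure PosR)
    [SFinite μ] {α β : ℝ} (hαβ : α < β) :
    ∫⁻ z in Ioc α β, pairInt μ (fluxIntegrand K z) =
      pairInt μ fun x y => rate K x y * ENNReal.ofReal (crossed α β x y) := by
  have hm := hK.measurable_fluxIntegrand
  unfold pairInt
  rw [lintegral_lintegral_swap]
  · refine lintegral_congr fun x => ?_
    rw [lintegral_lintegral_swap]
    · refine lintegral_congr fun y => ?_
      simp only [fluxIntegrand]
      rw [← setLIntegral_crossing hαβ, ← lintegral_const_mul]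
      · exact measurable_crossing.comp (by fun_prop : Measurable fun z : ℝ => (z, x, y))
    · exact (hm.comp (by fun_prop : Measurable fun p : ℝ × PosR => (p.1, x, p.2))).aemeasurable
  · refine Measurable.aemeasurable (Measurable.lintegral_prod_right'
      (f := fun q : (ℝ × PosR) × PosR => fluxIntegrand K q.1.1 q.1.2 q.2) ?_)
    exact hm.comp (by fun_prop : Measurable fun q : (ℝ × PosR) × PosR => (q.1.1, q.1.2, q.2))

/-- Measures agreeing on intervals agree, provided one is locally finite: boundedness of `V`
supplies this, so `U` need not be known finite beforehand. The intervals stay away from `0`, hence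
the exhaustion by `(δ, ∞)`. -/
lemma ae_eq_of_setLIntegral_Ioc {U V : ℝ → ℝ≥0∞} (hU : Measurable U) (hV : Measurable V)
    {C : ℝ≥0} (hVC : ∀ z, V z ≤ C)
    (h : ∀ α β, 0 < α → α < β → ∫⁻ z in Ioc α β, U z = ∫⁻ z in Ioc α β, V z) :
    ∀ᵐ z ∂(volume.restrict (Ioi (0 : ℝ))), U z = V z := by
  have hk : ∀ δ : ℝ, 0 < δ → ∀ᵐ z ∂(volume.restrict (Ioi δ)), U z = V z := by
    intro δ hδ
    have hloc : IsLocallyFiniteMeasure ((volume.restrict (Ioi δ)).withDensity V) := by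
      refine Measure.isLocallyFiniteMeasure_of_le (μ := C • (volume : Measure ℝ)) ?_
      calc (volume.restrict (Ioi δ)).withDensity V
          ≤ (volume.restrict (Ioi δ)).withDensity fun _ => (C : ℝ≥0∞) :=
            withDensity_mono (Eventually.of_forall hVC)
        _ = C • volume.restrict (Ioi δ) := by rw [withDensity_const]; rfl
        _ ≤ C • (volume : Measure ℝ) := by
            gcongr
            exact Measure.restrict_le_self
    have heq : (volume.restrict (Ioi δ)).withDensity V =
        (volume.restrict (Ioi δ)).withDensity U := by
      refine Measure.ext_of_Ioc _ _ fun a b hab => ?_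
      rw [withDensity_apply _ measurableSet_Ioc, withDensity_apply _ measurableSet_Ioc,
        Measure.restrict_restrict measurableSet_Ioc, Ioc_inter_Ioi]
      rcases lt_or_ge (max a δ) b with hb | hb
      · exact (h _ _ (hδ.trans_le (le_max_right _ _)) hb).symm
      · simp [Ioc_eq_empty (not_lt.2 hb)]
    exact (withDensity_eq_iff_of_sigmaFinite hU.aemeasurable hV.aemeasurable).1 heq.symm
  have hunion : Ioi (0 : ℝ) = ⋃ n : ℕ, Ioi (1 / ((n : ℝ) + 1)) := by
    ext z
    simp only [mem_Ioi, mem_iUnion]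
    exact ⟨fun hz => exists_nat_one_div_lt hz, fun ⟨n, hn⟩ => lt_trans (by positivity) hn⟩
  rw [hunion, ae_restrict_iUnion_iff]
  exact fun n => hk _ (by positivity)

end Averages

/-! ### Between mass measures and number densities. -/

section Translation

variable {K : PosR → PosR → ℝ} {γ lam T : ℝ}

/-- The number density measure with mass measure `μ`. -/
def numberMeasure (μ : Measure PosR) : Measure PosR :=
  μ.withDensity fun x => ENNReal.ofReal (1 / (x : ℝ))

lemma measurable_ofReal_coe : Measurable fun x : PosR => ENNReal.ofReal (x : ℝ) := by fun_prop

lemma measurable_ofReal_inv : Measurable fun x : PosR => ENNReal.ofReal (1 / (x : ℝ)) := by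
  fun_prop

lemma firstMoment_numberMeasure (μ : Measure PosR) : firstMoment (numberMeasure μ) = μ := by
  rw [firstMoment, numberMeasure, ← withDensity_mul _ measurable_ofReal_inv measurable_ofReal_coe]
  convert withDensity_one using 2
  ext x
  rw [Pi.mul_apply, Pi.one_apply, ← ENNReal.ofReal_mul (by have := x.2.out; positivity),
    one_div_mul_cancel x.2.out.ne', ENNReal.ofReal_one]

lemma numberMeasure_firstMoment (μ : Measure PosR) : numberMeasure (firstMoment μ) = μ := by
  rw [firstMoment, numberMeasure, ← withDensity_mul _ measurable_ofReal_coe measurable_ofReal_inv]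
  convert withDensity_one using 2
  ext x
  rw [Pi.mul_apply, Pi.one_apply, ← ENNReal.ofReal_mul x.2.out.le,
    mul_one_div_cancel x.2.out.ne', ENNReal.ofReal_one]

lemma continuous_inv_coe : Continuous fun x : PosR => 1 / (x : ℝ) :=
  continuous_const.div continuous_subtype_val fun x => x.2.out.ne'

lemma regular_numberMeasure (μ : Measure PosR) [IsFiniteMeasure μ] : (numberMeasure μ).Regular := by
  have : IsLocallyFiniteMeasure (numberMeasure μ) :=
    IsLocallyFiniteMeasure.withDensity_ofReal continuous_inv_coe
  infer_instance

lemma integral_numberMeasure (μ : Measure PosR) (φ : PosR → ℝ) :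
    ∫ x, φ x ∂(numberMeasure μ) = ∫ x, 1 / (x : ℝ) * φ x ∂μ := by
  rw [numberMeasure, integral_withDensity_eq_integral_toReal_smul measurable_ofReal_inv
    (Eventually.of_forall fun x => ENNReal.ofReal_lt_top)]
  refine integral_congr_ae (Eventually.of_forall fun x => ?_)
  have := x.2.out
  simp only [smul_eq_mul]
  rw [ENNReal.toReal_ofReal (by positivity)]

lemma massUpTo_eq (μ : Measure PosR) (z : ℝ) :
    massUpTo μ z = (firstMoment μ {x | (x : ℝ) ≤ z}).toReal := by
  rw [massUpTo, firstMoment, withDensity_apply _ (measurableSet_le z),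
    integral_eq_lintegral_of_nonneg_ae (Eventually.of_forall fun x => x.2.out.le)
      continuous_subtype_val.aestronglyMeasurable]

/-- The two densities `1/x` and `1/y` turn `x K` into `K / y`, and `z - x < y` is the crossing
condition. -/
lemma flux_numberMeasure (hK : KernelRegularity K γ lam) (μ : Measure PosR) [IsFiniteMeasure μ]
    (z : ℝ) : flux K (numberMeasure μ) z = pairInt μ (fluxIntegrand K z) := by
  have hreg : MeasurableSet (fluxRegion z) :=
    (_root_.measurableSet_le (f := fun p : PosR × PosR => (p.1 : ℝ)) (g := fun _ => z)
      (by fun_prop) (by fun_prop)).inter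
    (measurableSet_lt (f := fun p : PosR × PosR => z - (p.1 : ℝ)) (g := fun p => (p.2 : ℝ))
      (by fun_prop) (by fun_prop))
  have hKm : Measurable fun p : PosR × PosR => ENNReal.ofReal ((p.1 : ℝ) * K p.1 p.2) := by
    have := hK.continuous.measurable
    fun_prop
  have hw := measurable_ofReal_inv
  have hw2 : Measurable fun p : PosR × PosR =>
      ENNReal.ofReal (1 / (p.1 : ℝ)) * ENNReal.ofReal (1 / (p.2 : ℝ)) := by fun_prop
  have hF : Measurable fun p : PosR × PosR => fluxIntegrand K z p.1 p.2 :=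
    hK.measurable_fluxIntegrand.comp (measurable_const.prodMk measurable_id)
  rw [flux, ← lintegral_indicator hreg, numberMeasure, prod_withDensity hw hw,
    lintegral_withDensity_eq_lintegral_mul _ hw2 (hKm.indicator hreg),
    pairInt, ← lintegral_prod (fun p : PosR × PosR => fluxIntegrand K z p.1 p.2) hF.aemeasurable]
  refine lintegral_congr fun p => ?_
  have h1 := p.1.2.out
  have h2 := p.2.2.out
  by_cases hp : p ∈ fluxRegion z
  · have hp' : (p.1 : ℝ) ≤ z ∧ z < (p.1 : ℝ) + p.2 := ⟨hp.1, by linarith [hp.2]⟩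
    simp only [Pi.mul_apply, indicator_of_mem hp, fluxIntegrand, crossing, hp', and_self, if_true,
      mul_one, rate]
    rw [← ENNReal.ofReal_mul (by positivity), ← ENNReal.ofReal_mul (by positivity)]
    congr 1
    field_simp
  · have hp' : ¬ ((p.1 : ℝ) ≤ z ∧ z < (p.1 : ℝ) + p.2) := fun h =>
      hp ⟨h.1, by linarith [h.2]⟩
    simp [indicator_of_notMem hp, fluxIntegrand, crossing, hp']

end Translation

/-! ### Verification that the limit is a weak flux solution. -/

section WeakFluxSolution

variable {K : PosR → PosR → ℝ} {γ lam T M : ℝ} {g₀ : Measure PosR} {G : ℕ → ℝ → Measure PosR}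
  {g : ℝ → Measure PosR}

lemma exists_cutoff_approx (φ : ZeroAtInftyContinuousMap PosR ℝ) {ε : ℝ} (hε : 0 < ε) :
    ∃ m : ℝ, 0 < m ∧ ∀ x, |φ x - φ x * cutoff m x| ≤ ε := by
  have h0 := φ.zero_at_infty'.eventually (Metric.ball_mem_nhds (0 : ℝ) hε)
  obtain ⟨S, hS, hSφ⟩ := mem_cocompact.1 h0
  obtain ⟨B₁, h₁⟩ := hS.exists_bound_of_continuousOn continuous_subtype_val.continuousOn
  obtain ⟨B₂, h₂⟩ := hS.exists_bound_of_continuousOn continuous_inv_coe.continuousOn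
  have hm : 0 < max (max B₁ B₂) 1 := lt_max_of_lt_right one_pos
  refine ⟨_, hm, fun x => ?_⟩
  by_cases hx : x ∈ S
  · rw [cutoff_eq_one hm]
    · simp [hε.le]
    · rw [div_le_comm₀ hm x.2.out]
      exact ((le_abs_self _).trans (h₂ x hx)).trans ((le_max_right _ _).trans (le_max_left _ _))
    · exact ((le_abs_self _).trans (h₁ x hx)).trans ((le_max_left _ _).trans (le_max_left _ _))
  · have h3 : |φ x| < ε := by simpa using hSφ hx
    have h4 : |1 - cutoff (max (max B₁ B₂) 1) x| ≤ 1 := by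
      rw [abs_le]
      constructor <;> linarith [cutoff_nonneg (max (max B₁ B₂) 1) x,
        cutoff_le_one (max (max B₁ B₂) 1) x]
    calc |φ x - φ x * cutoff (max (max B₁ B₂) 1) x|
        = |φ x| * |1 - cutoff (max (max B₁ B₂) 1) x| := by rw [← abs_mul]; congr 1; ring
      _ ≤ ε * 1 := by gcongr
      _ = ε := mul_one ε

namespace IsLimit

variable (hg : IsLimit G T M g)

include hg in
lemma continuousOn_zeroAtInfty (hM : 0 ≤ M) (φ : ZeroAtInftyContinuousMap PosR ℝ) :
    ContinuousOn (fun t => ∫ x, φ x ∂(g t)) (Icc 0 T) := by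
  have hφ : Continuous φ := φ.continuous
  have hbd : ∃ C, ∀ x, ‖φ x‖ ≤ C := ⟨‖φ.toBCF‖, fun x => φ.toBCF.norm_coe_le_norm x⟩
  obtain ⟨C, hC⟩ := hbd
  refine continuousOn_of_uniform_approx_of_continuousOn fun u hu => ?_
  obtain ⟨ε, hε, hεu⟩ := Metric.mem_uniformity_dist.1 hu
  obtain ⟨m, hm, hmε⟩ := exists_cutoff_approx φ (ε := ε / (2 * (M + 1))) (by positivity)
  have hcs : HasCompactSupport fun x => φ x * cutoff m x := (hasCompactSupport_cutoff hm).mul_left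
  have hcc : Continuous fun x => φ x * cutoff m x := hφ.mul (continuous_cutoff m)
  refine ⟨_, hg.continuousOn _ hcc hcs, fun t _ => hεu ?_⟩
  have := hg.isFiniteMeasure t
  have hi : Integrable φ (g t) := Integrable.of_bound hφ.aestronglyMeasurable C
    (Eventually.of_forall hC)
  rw [Real.dist_eq, ← integral_sub hi (hcc.integrable_of_hasCompactSupport hcs)]
  have hmass : (g t).real univ ≤ M := ENNReal.toReal_le_of_le_ofReal hM (hg.mass_le t)
  calc |∫ x, (φ x - φ x * cutoff m x) ∂(g t)|
      ≤ ε / (2 * (M + 1)) * (g t).real univ :=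
        norm_integral_le_of_norm_le_const (f := fun x => φ x - φ x * cutoff m x)
          (Eventually.of_forall hmε)
    _ ≤ ε / (2 * (M + 1)) * M := by gcongr
    _ < ε := by
        rw [div_mul_eq_mul_div, div_lt_iff₀ (by positivity)]
        nlinarith

include hg in
lemma measurable_mass_le (hT : 0 ≤ T) :
    Measurable fun p : ℝ × ℝ => g p.1 {x | (x : ℝ) ≤ p.2} := by
  have h := measurable_lintegral_family (G := fun p : ℝ × ℝ => g p.1)
    ((hg.measurable hT).comp measurable_fst) ENNReal.ofReal_ne_top (fun p => hg.mass_le p.1)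
    (F := fun p x => if (x : ℝ) ≤ p.2 then (1 : ℝ≥0∞) else 0)
    (Measurable.ite (_root_.measurableSet_le (f := fun q : (ℝ × ℝ) × PosR => (q.2 : ℝ))
      (g := fun q => q.1.2) (by fun_prop) (by fun_prop)) measurable_const measurable_const)
  convert h using 2 with p
  rw [← lintegral_indicator_one (measurableSet_le p.2)]
  simp only [indicator_apply, mem_ofPred_eq, Pi.one_apply]

include hg in
lemma measurable_integratedFlux (hT : 0 ≤ T) (hK : KernelRegularity K γ lam) :
    Measurable fun p : ℝ × ℝ => ∫⁻ s in Ioc 0 p.1, pairInt (g s) (fluxIntegrand K p.2) := by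
  have hH := measurable_flux hK (hg.measurable hT) ENNReal.ofReal_ne_top hg.mass_le
  have hset : MeasurableSet {q : (ℝ × ℝ) × ℝ | 0 < q.2 ∧ q.2 ≤ q.1.1} :=
    (measurableSet_lt (f := fun _ : (ℝ × ℝ) × ℝ => (0 : ℝ)) (g := fun q => q.2)
      (by fun_prop) (by fun_prop)).inter
    (_root_.measurableSet_le (f := fun q : (ℝ × ℝ) × ℝ => q.2) (g := fun q => q.1.1)
      (by fun_prop) (by fun_prop))
  have h := Measurable.lintegral_prod_right' (ν := (volume : Measure ℝ))
    ((hH.comp (by fun_prop : Measurable fun q : (ℝ × ℝ) × ℝ => (q.1.2, q.2))).indicator hset)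
  convert h using 2 with p
  rw [← lintegral_indicator measurableSet_Ioc]
  rfl

include hg in
-- Tonelli identifies `balance` with the integral of this identity over `(α, β)`. The sum form, with
-- the bounded right-hand side, also yields finiteness of the flux.
lemma mass_add_flux_ae (hG : IsApproximation K γ T g₀ G) (hK : KernelRegularity K γ lam)
    (hexp : |γ + 2 * lam| < 1) (hγ : γ < 1) (hT : 0 ≤ T) [IsFiniteMeasure g₀]
    (hM : M = massBound g₀ T) {t : ℝ} (ht0 : 0 < t) (ht : t ≤ T) :
    ∀ᵐ z ∂(volume.restrict (Ioi (0 : ℝ))),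
      g t {x | (x : ℝ) ≤ z} + ∫⁻ s in Ioc 0 t, pairInt (g s) (fluxIntegrand K z) =
        g₀ {x | (x : ℝ) ≤ z} + ENNReal.ofReal t := by
  have hfin := hg.isFiniteMeasure
  have hm1 : Measurable fun z : ℝ => g t {x | (x : ℝ) ≤ z} :=
    (hg.measurable_mass_le hT).comp measurable_prodMk_left
  have hm2 : Measurable fun z : ℝ => ∫⁻ s in Ioc 0 t, pairInt (g s) (fluxIntegrand K z) :=
    (hg.measurable_integratedFlux hT hK).comp (measurable_prodMk_left (x := t))
  have hm3 : Measurable fun z : ℝ => g₀ {x | (x : ℝ) ≤ z} :=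
    Monotone.measurable fun a b hab => measure_mono fun x (hx : (x : ℝ) ≤ a) => hx.trans hab
  refine ae_eq_of_setLIntegral_Ioc (hm1.add hm2) (hm3.add_const _)
    (C := (g₀ univ + ENNReal.ofReal t).toNNReal) (fun z => ?_) fun α β hα hαβ => ?_
  · rw [ENNReal.coe_toNNReal (by simp)]
    gcongr
    exact subset_univ _
  · rw [lintegral_add_left hm1, lintegral_add_left hm3, setLIntegral_measure_le _ hαβ,
      setLIntegral_measure_le _ hαβ, setLIntegral_const, Real.volume_Ioc,
      ← hg.balance hG hK hexp hγ hT hα hαβ ht0 ht hM, lintegral_lintegral_swap]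
    · congr 1
      exact lintegral_congr fun s => setLIntegral_pairInt_fluxIntegrand hK _ hαβ
    · exact (measurable_flux hK (hg.measurable hT) ENNReal.ofReal_ne_top hg.mass_le).aemeasurable

include hg in
lemma isWeakFluxSolution (hG : IsApproximation K γ T g₀ G) (hK : KernelRegularity K γ lam)
    (hexp : |γ + 2 * lam| < 1) (hγ : γ < 1) (hT : 0 < T) [IsFiniteMeasure g₀] (hg₀ : g₀.Regular)
    (hM : M = massBound g₀ T) :
    IsWeakFluxSolution K T (numberMeasure g₀) fun t => numberMeasure (g t) where
  radon t _ := by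
    have := hg.isFiniteMeasure t
    exact regular_numberMeasure _
  weakStar_continuous φ := by
    simp only [integral_numberMeasure]
    exact hg.continuousOn _ (continuous_inv_coe.mul φ.continuous) φ.hasCompactSupport.mul_left
  initial := by rw [hg.initial hG hT.le hg₀]
  firstMoment_finite t _ := by
    rw [firstMoment_numberMeasure]
    exact hg.isFiniteMeasure t
  firstMoment_weakStar_continuous φ := by
    simp only [firstMoment_numberMeasure]
    exact hg.continuousOn_zeroAtInfty (hM ▸ massBound_nonneg hT.le) φ
  flux_finite := by
    have hfin := hg.isFiniteMeasure
    -- The integrated flux is monotone in `t`, so finiteness at `T` gives one null set of `z` for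
    -- all times.
    filter_upwards [hg.mass_add_flux_ae hG hK hexp hγ hT.le hM hT le_rfl] with z hz t ht
    simp only [integratedFlux, flux_numberMeasure hK]
    calc ∫⁻ s in Ioc 0 t, pairInt (g s) (fluxIntegrand K z)
        ≤ ∫⁻ s in Ioc 0 T, pairInt (g s) (fluxIntegrand K z) :=
          lintegral_mono_set (Ioc_subset_Ioc_right ht.2)
      _ ≤ g₀ {x | (x : ℝ) ≤ z} + ENNReal.ofReal T := hz ▸ le_add_self
      _ < ⊤ := ENNReal.add_lt_top.2 ⟨measure_lt_top _ _, ENNReal.ofReal_lt_top⟩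
  flux_eq := by
    have hfin := hg.isFiniteMeasure
    have hm1 := hg.measurable_mass_le hT.le
    have hm2 := hg.measurable_integratedFlux hT.le hK
    have hm3 : Measurable fun z : ℝ => g₀ {x | (x : ℝ) ≤ z} :=
      Monotone.measurable fun a b hab => measure_mono fun x (hx : (x : ℝ) ≤ a) => hx.trans hab
    simp only [integratedFlux, flux_numberMeasure hK, massUpTo_eq, firstMoment_numberMeasure]
    rw [Measure.volume_eq_prod, ← Measure.prod_restrict, Measure.ae_prod_iff_ae_ae]
    -- `balance` is available only for `t > 0`; the single time `0` is negligible. Joint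
    -- measurability of both sides allows the null sets of `z` to depend on `t`.
    · have h0 : ∀ᵐ t ∂(volume.restrict (Icc (0 : ℝ) T)), t ≠ 0 :=
        ae_restrict_of_ae (Measure.ae_ne volume 0)
      filter_upwards [h0, ae_restrict_mem measurableSet_Icc] with t ht0 ht
      have htpos : 0 < t := lt_of_le_of_ne ht.1 ht0.symm
      filter_upwards [hg.mass_add_flux_ae hG hK hexp hγ hT.le hM htpos ht.2] with z hz
      have hne : ∫⁻ s in Ioc 0 t, pairInt (g s) (fluxIntegrand K z) ≠ ⊤ :=
        ne_top_of_le_ne_top (by simp) (hz ▸ le_add_self :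
          _ ≤ g₀ {x | (x : ℝ) ≤ z} + ENNReal.ofReal t)
      have h := congrArg ENNReal.toReal hz
      rw [ENNReal.toReal_add (measure_ne_top _ _) hne, ENNReal.toReal_add (measure_ne_top _ _)
        ENNReal.ofReal_ne_top, ENNReal.toReal_ofReal ht.1] at h
      linarith
    · exact measurableSet_eq_fun
        (hm1.ennreal_toReal.sub (hm3.comp measurable_snd).ennreal_toReal)
        (hm2.ennreal_toReal.neg.add measurable_fst)

end IsLimit

end WeakFluxSolution

end FluxCoagulation

end

theorem mainTheorem1 (K : FluxCoagulation.PosR → FluxCoagulation.PosR → ℝ) (γ lam : ℝ)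
    (hK : FluxCoagulation.KernelRegularity K γ lam)
    (hexp : |γ + 2 * lam| < 1) (hγ : γ < 1)
    (T : ℝ) (hT : 0 < T)
    (f₀ : MeasureTheory.Measure FluxCoagulation.PosR) (hf₀ : f₀.Regular)
    (hf₀_moment : MeasureTheory.IsFiniteMeasure (FluxCoagulation.firstMoment f₀)) :
    ∃ f : ℝ → MeasureTheory.Measure FluxCoagulation.PosR,
      FluxCoagulation.IsWeakFluxSolution K T f₀ f := by
  obtain ⟨G, hG⟩ := FluxCoagulation.exists_isApproximation
    (g₀ := FluxCoagulation.firstMoment f₀) hK hT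
  obtain ⟨g, hg⟩ := hG.exists_isLimit hK hexp hγ hT.le
  have h := hg.isWeakFluxSolution hG hK hexp hγ hT inferInstance rfl
  rw [FluxCoagulation.numberMeasure_firstMoment] at h
  exact ⟨_, h⟩
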